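/- Let $c\in\mathbb C$. The topological $N=2$ superconformal algebra is the Lie superalgebra with even basis elements $\mathcal L_m,\mathcal H_m$ ($m\in\mathbb Z$) and $C$ (central), odd basis elements $\mathcal G_m,\mathcal Q_m$ ($m\in\mathbb Z$), and relations $$[\mathcal L_m,\mathcal L_n]=(m-n)\mathcal L_{m+n},\quad [\mathcal H_m,\mathcal H_n]=\tfrac C3 m\,\delta_{m+n},\quad [\mathcal L_m,\mathcal G_n]=(m-n)\mathcal G_{m+n},\quad [\mathcal H_m,\mathcal G_n]=\mathcal G_{m+n},$$ $$[\mathcal L_m,\mathcal Q_n]=-n\mathcal Q_{m+n},\quad [\mathcal H_m,\mathcal Q_n]=-\mathcal Q_{m+n},\quad [\mathcal L_m,\mathcal H_n]=-n\mathcal H_{m+n}+\tfrac C6(m^2+m)\delta_{m+n},$$ $$\{\mathcal G_m,\mathcal Q_n\}=2\mathcal L_{m+n}-2n\mathcal H_{m+n}+\tfrac C3(m^2+m)\delta_{m+n},\quad \{\mathcal G_m,\mathcal G_n\}=\{\mathcal Q_m,\mathcal Q_n\}=0 .$$ For $\Delta,q\in\mathbb C$ let $\mathcal V^G_{\Delta,q}$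 (resp. $\mathcal V^Q_{\Delta,q}$) be the Verma module induced from a highest weight vector $|\Delta,q\rangle$ with $\mathcal L_0=\Delta$, $\mathcal H_0=q$, $C=c$, which is annihilated by all modes $\mathcal L_k,\mathcal H_k,\mathcal G_k,\mathcal Q_k$ with $k\ge 1$ and by $\mathcal G_0$ (resp. by $\mathcal Q_0$). A vector $\Psi$ in such a module is a singular vector at level $m\in\mathbb N_0$ with charge $n\in\mathbb Z$ if $\mathcal L_0\Psi=(\Delta+m)\Psi$, $\mathcal H_0\Psi=(q+n)\Psi$, $\Psi$ is annihilated by all modes with $k\ge1$, and $\Psi$ is not a scalar multiple of $|\Delta,q\rangle$. It is of type $G$ if $\mathcal G_0\Psi=0$, of type $Q$ if $\mathcal Q_0\Psi=0$, and of type $GQ$ (chiral) if $\mathcal G_0\Psi=\mathcal Q_0\Psi=0$. (No non-vanishing condition is imposed; so the types $G$ and $Q$ contain the chiral vectors, and the bounds below hold a fortiori for $\mathcal G_0$-closed vectors with $\mathcal Q_0\Psi\ne0$ and for $\mathcal Q_0$-closed vectors with $\mathcal G_0\Psi\neq 0$.) Write $(A,B)=(\mathcal G,\mathcal Q)$ in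 $\mathcal V^G_{\Delta,q}$ and $(A,B)=(\mathcal Q,\mathcal G)$ in $\mathcal V^Q_{\Delta,q}$. The normal form of $\Psi$ is its decomposition in the standard basis, consisting of the vectors $X|\Delta,q\rangle$, where $X$ runs through the terms $$X=\mathcal L_{-l_r}\cdots\mathcal L_{-l_1}\,\mathcal H_{-h_s}\cdots\mathcal H_{-h_1}\,A_{-a_t}\cdots A_{-a_1}\,B_{-b_u}\cdots B_{-b_1}\,\mathcal L_{-1}^{k}A_{-1}^{r_1}B_{-1}^{r_2}B_0^{r_3}$$ with $l_r\ge\dots\ge l_1\ge2$, $h_s\ge\dots\ge h_1\ge1$, $a_t>\dots>a_1\ge2$, $b_u>\dots>b_1\ge2$, $k\in\mathbb N_0$, $r_1,r_2,r_3\in\{0,1\}$; a vector at level $m$ with charge $n$ involves only terms of level $m$ (minus the sum of all mode indices) and charge $n$ (number of $\mathcal G$'s minus number of $\mathcal Q$'s). **Theorem.** Assume $c\neq3$. At fixed level $m\in\mathbb N_0$ and charge $n\in\mathbb Z$, the number of linearly independent singular vectors of a given type is at most the number in the following table, and every such singular vector has a unique normal form, in which at least one element of the corresponding ordering kernel has a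 nonzero coefficient. (Kernel elements containing $\mathcal L_{-1}^{m-1}$ are absent for $m=0$.) | module | type | $n$ | bound | ordering kernel | |---|---|---|---|---| | $\mathcal V^G$ | $G$ | $-1$ | 1 | $\mathcal L_{-1}^m\mathcal Q_0$ | | | | $0$ | 2 | $\mathcal L_{-1}^m,\ \mathcal L_{-1}^{m-1}\mathcal G_{-1}\mathcal Q_0$ | | | | $1$ | 1 | $\mathcal L_{-1}^{m-1}\mathcal G_{-1}$ | | $\mathcal V^G$ | $Q$ | $-2$ | 1 | $\mathcal L_{-1}^{m-1}\mathcal Q_{-1}\mathcal Q_0$ | | | | $-1$ | 2 | $\mathcal L_{-1}^m\mathcal Q_0,\ \mathcal L_{-1}^{m-1}\mathcal Q_{-1}$ | | | | $0$ | 1 | $\mathcal L_{-1}^m$ | | $\mathcal V^G$ | $GQ$ | $-1$ | 1 | $\mathcal L_{-1}^m\mathcal Q_0$ | | | | $0$ | 1 | $\mathcal L_{-1}^m$ | | $\mathcal V^Q$ | $Q$ | $-1$ | 1 | $\mathcal L_{-1}^{m-1}\mathcal Q_{-1}$ | | | | $0$ | 2 | $\mathcal L_{-1}^m,\ \mathcal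 L_{-1}^{m-1}\mathcal Q_{-1}\mathcal G_0$ | | | | $1$ | 1 | $\mathcal L_{-1}^m\mathcal G_0$ | | $\mathcal V^Q$ | $G$ | $0$ | 1 | $\mathcal L_{-1}^m$ | | | | $1$ | 2 | $\mathcal L_{-1}^m\mathcal G_0,\ \mathcal L_{-1}^{m-1}\mathcal G_{-1}$ | | | | $2$ | 1 | $\mathcal L_{-1}^{m-1}\mathcal G_{-1}\mathcal G_0$ | | $\mathcal V^Q$ | $GQ$ | $0$ | 1 | $\mathcal L_{-1}^m$ | | | | $1$ | 1 | $\mathcal L_{-1}^m\mathcal G_0$ | For each module and type, charges that are not listed have bound $0$ and empty kernel: there are no singular vectors of that type with such a charge. Moreover, chiral singular vectors at level $m$ exist only if $\Delta=-m$. -/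

import Mathlib

/-! The topological `N = 2` superconformal algebra, its generic Verma modules, their singular
vectors and their standard bases. -/

noncomputable section

namespace TopN2

/-! ### The universal enveloping algebra -/

/-- The basis `L_m, H_m, G_m, Q_m` (`m ∈ ℤ`), `C` of the topological `N = 2` algebra:
`L_m, H_m, C` are even, `G_m, Q_m` are odd. -/
inductive Gen : Type
  | L (m : ℤ)
  | H (m : ℤ)
  | G (m : ℤ)
  | Q (m : ℤ)
  | C

/-- The free associative algebra on the basis, i.e. the tensor algebra of the superalgebra. -/
abbrev Free : Type := FreeAlgebra ℂ Gen

/-- A basis element in the free algebra. -/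
def gen (x : Gen) : Free := FreeAlgebra.ι ℂ x

/-- The Kronecker symbol `δ_m`. -/
def delta (m : ℤ) : ℂ := if m = 0 then 1 else 0

/-- The (anti-)commutation relations of the topological `N = 2` algebra. -/
inductive Rel : Free → Free → Prop
  | LL (m n : ℤ) : Rel
      (gen (.L m) * gen (.L n) - gen (.L n) * gen (.L m))
      (((m : ℂ) - n) • gen (.L (m + n)))
  | HH (m n : ℤ) : Rel
      (gen (.H m) * gen (.H n) - gen (.H n) * gen (.H m))
      (((m : ℂ) / 3 * delta (m + n)) • gen .C)
  | LG (m n : ℤ) : Rel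
      (gen (.L m) * gen (.G n) - gen (.G n) * gen (.L m))
      (((m : ℂ) - n) • gen (.G (m + n)))
  | HG (m n : ℤ) : Rel
      (gen (.H m) * gen (.G n) - gen (.G n) * gen (.H m))
      (gen (.G (m + n)))
  | LQ (m n : ℤ) : Rel
      (gen (.L m) * gen (.Q n) - gen (.Q n) * gen (.L m))
      ((-(n : ℂ)) • gen (.Q (m + n)))
  | HQ (m n : ℤ) : Rel
      (gen (.H m) * gen (.Q n) - gen (.Q n) * gen (.H m))
      (-gen (.Q (m + n)))
  | LH (m n : ℤ) : Rel
      (gen (.L m) * gen (.H n) - gen (.H n) * gen (.L m))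
      ((-(n : ℂ)) • gen (.H (m + n)) + (((m : ℂ) ^ 2 + m) / 6 * delta (m + n)) • gen .C)
  | GQ (m n : ℤ) : Rel
      (gen (.G m) * gen (.Q n) + gen (.Q n) * gen (.G m))
      ((2 : ℂ) • gen (.L (m + n)) - (2 * (n : ℂ)) • gen (.H (m + n))
        + (((m : ℂ) ^ 2 + m) / 3 * delta (m + n)) • gen .C)
  | GG (m n : ℤ) : Rel (gen (.G m) * gen (.G n) + gen (.G n) * gen (.G m)) 0
  | QQ (m n : ℤ) : Rel (gen (.Q m) * gen (.Q n) + gen (.Q n) * gen (.Q m)) 0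
  | central (x : Gen) : Rel (gen .C * gen x) (gen x * gen .C)

/-- The universal enveloping algebra of the topological `N = 2` algebra. -/
def U : Type := RingQuot Rel

instance : Ring U := inferInstanceAs (Ring (RingQuot Rel))

instance : Algebra ℂ U := inferInstanceAs (Algebra ℂ (RingQuot Rel))

/-- The quotient map from the free algebra to the enveloping algebra. -/
def U.proj : Free →ₐ[ℂ] U := RingQuot.mkAlgHom ℂ Rel

/-- The image of a basis element in the enveloping algebra. -/
def U.of (x : Gen) : U := U.proj (gen x)

/-- The Virasoro mode `L_m`. -/
def L (m : ℤ) : U := U.of (.L m)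
/-- The `U(1)` current mode `H_m`. -/
def H (m : ℤ) : U := U.of (.H m)
/-- The fermionic mode `G_m`. -/
def G (m : ℤ) : U := U.of (.G m)
/-- The fermionic mode `Q_m`. -/
def Q (m : ℤ) : U := U.of (.Q m)
/-- The central element `C`. -/
def C : U := U.of .C

/-- The two kinds of fermionic modes; also the two kinds of generic Verma modules. -/
inductive Fermion : Type
  | G
  | Q

/-- `G ↔ Q`. -/
def Fermion.other : Fermion → Fermion
  | .G => .Q
  | .Q => .G

/-- The mode `G_m` or `Q_m`. -/
def Fermion.mode : Fermion → ℤ → U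
  | .G, m => TopN2.G m
  | .Q, m => TopN2.Q m

/-- The `H_0`-charge of `G_m` is `1`, that of `Q_m` is `-1`. -/
def Fermion.charge : Fermion → ℤ
  | .G => 1
  | .Q => -1

/-! ### Generic Verma modules -/

/-- The highest weight conditions: the elements of the enveloping algebra that have to annihilate a
highest weight vector of weight `(Δ, q)`, central charge `c`, annihilated by `G_0` (if `A = G`) or
by `Q_0` (if `A = Q`). -/
def hwConditions (A : Fermion) (Δ q c : ℂ) : Set U :=
  {x | ∃ m : ℤ, 0 < m ∧ (x = L m ∨ x = H m ∨ x = G m ∨ x = Q m)} ∪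
    {L 0 - algebraMap ℂ U Δ, H 0 - algebraMap ℂ U q, C - algebraMap ℂ U c, A.mode 0}

/-- The generic Verma module `V^A_{Δ,q}` with central charge `c`: the left module induced from the
one-dimensional module of the subalgebra spanned by `L_0, H_0, C, A_0` and all positive modes,
written as the quotient of the enveloping algebra by the left ideal generated by the highest
weight conditions. -/
def Verma (A : Fermion) (Δ q c : ℂ) : Type :=
  U ⧸ Submodule.span U (hwConditions A Δ q c)

instance (A : Fermion) (Δ q c : ℂ) : AddCommGroup (Verma A Δ q c) :=
  inferInstanceAs (AddCommGroup (U ⧸ Submodule.span U (hwConditions A Δ q c)))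

instance (A : Fermion) (Δ q c : ℂ) : Module U (Verma A Δ q c) :=
  inferInstanceAs (Module U (U ⧸ Submodule.span U (hwConditions A Δ q c)))

instance (A : Fermion) (Δ q c : ℂ) : Module ℂ (Verma A Δ q c) :=
  Module.compHom _ (algebraMap ℂ U)

instance (A : Fermion) (Δ q c : ℂ) : IsScalarTower ℂ U (Verma A Δ q c) where
  smul_assoc z u x := by
    rw [Algebra.smul_def, mul_smul]
    rfl

/-- The quotient map from the enveloping algebra to the Verma module. -/
def Verma.proj (A : Fermion) (Δ q c : ℂ) : U →ₗ[U] Verma A Δ q c :=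
  (Submodule.span U (hwConditions A Δ q c)).mkQ

/-- The highest weight vector `|Δ, q⟩^A`. -/
def hwv (A : Fermion) (Δ q c : ℂ) : Verma A Δ q c :=
  Verma.proj A Δ q c 1

/-! ### Singular vectors -/

/-- The additional vanishing conditions on singular vectors: with respect to `G_0`, to `Q_0`, or to
both of them (chiral). -/
inductive Closure : Type
  | G
  | Q
  | GQ

/-- `Ψ` satisfies the additional vanishing conditions `N`. -/
def Closure.Holds {A : Fermion} {Δ q c : ℂ} (N : Closure) (Ψ : Verma A Δ q c) : Prop :=
  match N with
  | .G => TopN2.G 0 • Ψ = 0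
  | .Q => TopN2.Q 0 • Ψ = 0
  | .GQ => TopN2.G 0 • Ψ = 0 ∧ TopN2.Q 0 • Ψ = 0

/-- `Ψ` is a singular vector at level `m` and with charge `n` that satisfies the additional
vanishing conditions `N`. Nothing is required of a zero mode which is not mentioned in `N`. -/
structure IsSingular {A : Fermion} {Δ q c : ℂ} (N : Closure) (m : ℕ) (n : ℤ)
    (Ψ : Verma A Δ q c) : Prop where
  level : L 0 • Ψ = (Δ + m) • Ψ
  charge : H 0 • Ψ = (q + n) • Ψ
  positive : ∀ k : ℤ, 0 < k → L k • Ψ = 0 ∧ H k • Ψ = 0 ∧ G k • Ψ = 0 ∧ Q k • Ψ = 0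
  closed : N.Holds Ψ
  not_proportional : ∀ z : ℂ, Ψ ≠ z • hwv A Δ q c

/-! ### The standard basis and the normal form -/

/-- The exponents of a standard monomial. In `V^A`, with `B` the other fermion, they stand for
`L_{-l_r} ⋯ L_{-l_1} H_{-h_s} ⋯ H_{-h_1} A_{-a_t} ⋯ A_{-a_1} B_{-b_u} ⋯ B_{-b_1}
  L_{-1}^k A_{-1}^{r₁} B_{-1}^{r₂} B_0^{r₃}`,
where `l_r ≥ ⋯ ≥ l_1 ≥ 2`, `h_s ≥ ⋯ ≥ h_1 ≥ 1`, `a_t > ⋯ > a_1 ≥ 2`, `b_u > ⋯ > b_1 ≥ 2`. -/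
structure Term : Type where
  l : Multiset ℕ
  h : Multiset ℕ
  a : Finset ℕ
  b : Finset ℕ
  k : ℕ
  r₁ : Fin 2
  r₂ : Fin 2
  r₃ : Fin 2
  two_le_l : ∀ i ∈ l, 2 ≤ i
  one_le_h : ∀ i ∈ h, 1 ≤ i
  two_le_a : ∀ i ∈ a, 2 ≤ i
  two_le_b : ∀ i ∈ b, 2 ≤ i

namespace Term

/-- The level of a term. -/
def level (X : Term) : ℕ :=
  X.l.sum + X.h.sum + ∑ i ∈ X.a, i + ∑ i ∈ X.b, i + X.k + X.r₁ + X.r₂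

/-- The charge of a term in `V^A`. -/
def charge (A : Fermion) (X : Term) : ℤ :=
  A.charge * (X.a.card + (X.r₁ : ℕ)) + A.other.charge * (X.b.card + (X.r₂ : ℕ) + (X.r₃ : ℕ))

/-- The standard monomial of a term in `V^A`, an element of the enveloping algebra. -/
def monomial (A : Fermion) (X : Term) : U :=
  ((X.l.sort (· ≥ ·)).map fun i : ℕ => L (-(i : ℤ))).prod *
  ((X.h.sort (· ≥ ·)).map fun i : ℕ => H (-(i : ℤ))).prod *
  ((X.a.sort (· ≥ ·)).map fun i : ℕ => A.mode (-(i : ℤ))).prod *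
  ((X.b.sort (· ≥ ·)).map fun i : ℕ => A.other.mode (-(i : ℤ))).prod *
  L (-1) ^ X.k * A.mode (-1) ^ (X.r₁ : ℕ) * A.other.mode (-1) ^ (X.r₂ : ℕ) *
  A.other.mode 0 ^ (X.r₃ : ℕ)

/-- The term `L_{-1}^k A_{-1}^{r₁} B_{-1}^{r₂} B_0^{r₃}`. -/
def low (k : ℕ) (r₁ r₂ r₃ : Fin 2) : Term where
  l := 0
  h := 0
  a := ∅
  b := ∅
  k := k
  r₁ := r₁
  r₂ := r₂
  r₃ := r₃
  two_le_l := by simp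
  one_le_h := by simp
  two_le_a := by simp
  two_le_b := by simp

end Term

/-- The set `𝒞^A_{m,n}` of the terms of level `m` and charge `n` in `V^A`. -/
def terms (A : Fermion) (m : ℕ) (n : ℤ) : Set Term :=
  {X | X.level = m ∧ X.charge A = n}

/-- `x` is a normal form of `Ψ` at level `m` and charge `n`: the family of the coefficients of `Ψ`
in its decomposition along the standard vectors `X |Δ, q⟩^A`, `X ∈ 𝒞^A_{m,n}`. -/
def IsNormalForm {A : Fermion} {Δ q c : ℂ} (m : ℕ) (n : ℤ) (x : Term →₀ ℂ)
    (Ψ : Verma A Δ q c) : Prop :=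
  (x.support : Set Term) ⊆ terms A m n ∧
    (x.sum fun X z => z • (X.monomial A • hwv A Δ q c)) = Ψ

/-! ### The ordering kernels and the table of maximal dimensions -/

/-- The set consisting of the term `L_{-1}^{m-r₁-r₂} A_{-1}^{r₁} B_{-1}^{r₂} B_0^{r₃}` of level `m`;
it is empty if `m < r₁ + r₂`. -/
def lowTerm (m : ℕ) (r₁ r₂ r₃ : Fin 2) : Set Term :=
  {X | ∃ k : ℕ, k + r₁ + r₂ = m ∧ X = Term.low k r₁ r₂ r₃}

/-- The ordering kernels at level `m` and charge `n` in `V^A`, for annihilation by the positive modes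
and by the zero modes in `N`. -/
def kernel (A : Fermion) (N : Closure) (m : ℕ) (n : ℤ) : Set Term :=
  match A, N, n with
  -- In `V^G` the exponents are those of `G_{-1}`, `Q_{-1}`, `Q_0`.
  | .G, .G, 1 => lowTerm m 1 0 0
  | .G, .G, 0 => lowTerm m 0 0 0 ∪ lowTerm m 1 0 1
  | .G, .G, -1 => lowTerm m 0 0 1
  | .G, .Q, 0 => lowTerm m 0 0 0
  | .G, .Q, -1 => lowTerm m 0 0 1 ∪ lowTerm m 0 1 0
  | .G, .Q, -2 => lowTerm m 0 1 1
  | .G, .GQ, 0 => lowTerm m 0 0 0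
  | .G, .GQ, -1 => lowTerm m 0 0 1
  -- In `V^Q` the exponents are those of `Q_{-1}`, `G_{-1}`, `G_0`.
  | .Q, .Q, 1 => lowTerm m 0 0 1
  | .Q, .Q, 0 => lowTerm m 0 0 0 ∪ lowTerm m 1 0 1
  | .Q, .Q, -1 => lowTerm m 1 0 0
  | .Q, .G, 2 => lowTerm m 0 1 1
  | .Q, .G, 1 => lowTerm m 0 0 1 ∪ lowTerm m 0 1 0
  | .Q, .G, 0 => lowTerm m 0 0 0
  | .Q, .GQ, 1 => lowTerm m 0 0 1
  | .Q, .GQ, 0 => lowTerm m 0 0 0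
  | _, _, _ => ∅

/-- The maximal number of linearly independent singular vectors of type `N` and charge `n` in
`V^A`. -/
def maxDim (A : Fermion) (N : Closure) (n : ℤ) : ℕ :=
  match A, N, n with
  | .G, .G, -1 => 1
  | .G, .G, 0 => 2
  | .G, .G, 1 => 1
  | .G, .Q, -2 => 1
  | .G, .Q, -1 => 2
  | .G, .Q, 0 => 1
  | .G, .GQ, -1 => 1
  | .G, .GQ, 0 => 1
  | .Q, .Q, -1 => 1
  | .Q, .Q, 0 => 2
  | .Q, .Q, 1 => 1
  | .Q, .G, 0 => 1
  | .Q, .G, 1 => 2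
  | .Q, .G, 2 => 1
  | .Q, .GQ, 0 => 1
  | .Q, .GQ, 1 => 1
  | _, _, _ => 0

end TopN2

end

noncomputable section

namespace TopN2

/-! The first ingredient is a Poincaré-Birkhoff-Witt theorem for the Verma modules. The superalgebra
is made to act on formal words by the reordering rule: a letter is prepended if the order allows it,
otherwise it is moved past the first letter at the cost of a bracket. The super Jacobi identity
shows that this satisfies the commutation relations on sorted words (`comm_of_nil`), so sorted words
form a module over `U` with a vector obeying the highest weight conditions. The resulting map
`coord` sends the vector of a sorted word to that word (`coord_wv`) and is inverted on the left by
`ofCoord` (`ofCoord_coord`). Hence standard vectors form a basis and normal forms are unique.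

The second ingredient is a filtration in which `L_{-1}` has degree 2, the other `L` and all
fermionic modes have degree 1, and `H` and `C` have degree 0. To leading order `L_{-1}` commutes
with everything, and it is the only letter of degree 2. A positive mode acting on a product can
produce a new `L_{-1}` only by consuming one specific letter: `L_k` consumes `L_{-1-k}` with factor
`2k+1`, and a fermionic `F_k` consumes the opposite fermion of mode `-1-k` with factor 2. If the
operator lowers the expected degree of `Ψ`, the consumed letter cannot occur in the leading terms of
`Ψ` (`symbol`, `not_mem_of_symbol`), because replacing that letter by `L_{-1}` is injective on
words.

The letters `H_{-n}` need a composite operator, since the brackets of `H_n` create no `L_{-1}`. With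
`L_{-1}` treated as a scalar, the fermions form a Clifford algebra, and the current minus its
fermionic bilinear commutes with them. This difference, multiplied by `L_{-1}`, is `T`. Its
commutator with `H_{-n}` has leading coefficient `nc/3 - n = n(c-3)/3` (`T_H`), and this is where `c
≠ 3` enters. The letters `H` have to be removed before the fermions, because a fermion commuted with
`H` gives a fermion of higher degree than `H`.

What survives in the leading terms of a singular vector is `L_{-1}^k A_{-1}^{r₁} B_{-1}^{r₂}
B_0^{r₃}`. If `A_0` annihilates the vector, then `r₂ = 0` in every leading term. If `B_0` does, then
`r₁ = 0` in at least one (`exists_A_neg_one_not_mem`). Level and charge then leave exactly the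
ordering kernel (`exists_kernel_coord_ne_zero`). So the coefficients on the kernel determine a
singular vector, which gives the dimension bounds; the chiral condition on `Δ` comes from `{G_0,
Q_0} = 2 L_0`. -/

instance : DecidableEq Gen := Classical.decEq _

/-! ### The super bracket -/

/-- The parity of a basis element. -/
def Gen.odd : Gen → Bool
  | .G _ => true
  | .Q _ => true
  | _ => false

/-- The sign in the supercommutator of two basis elements. -/
def eps (x y : Gen) : ℂ := if x.odd && y.odd then -1 else 1

/-- A basis element as an element of the superalgebra. -/
abbrev e (x : Gen) : Gen →₀ ℂ := Finsupp.single x 1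

/-- The super bracket of two basis elements. -/
def bracket : Gen → Gen → (Gen →₀ ℂ)
  | .L m, .L n => ((m : ℂ) - n) • e (.L (m + n))
  | .L m, .H n => (-(n : ℂ)) • e (.H (m + n)) + (((m : ℂ) ^ 2 + m) / 6 * delta (m + n)) • e .C
  | .H m, .L n => (m : ℂ) • e (.H (m + n)) - (((n : ℂ) ^ 2 + n) / 6 * delta (m + n)) • e .C
  | .L m, .G n => ((m : ℂ) - n) • e (.G (m + n))
  | .G m, .L n => ((m : ℂ) - n) • e (.G (m + n))
  | .L m, .Q n => (-(n : ℂ)) • e (.Q (m + n))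
  | .Q m, .L n => (m : ℂ) • e (.Q (m + n))
  | .H m, .H n => ((m : ℂ) / 3 * delta (m + n)) • e .C
  | .H m, .G n => e (.G (m + n))
  | .G m, .H n => - e (.G (m + n))
  | .H m, .Q n => - e (.Q (m + n))
  | .Q m, .H n => e (.Q (m + n))
  | .G m, .Q n => (2 : ℂ) • e (.L (m + n)) - (2 * (n : ℂ)) • e (.H (m + n))
        + (((m : ℂ) ^ 2 + m) / 3 * delta (m + n)) • e .C
  | .Q m, .G n => (2 : ℂ) • e (.L (m + n)) - (2 * (m : ℂ)) • e (.H (m + n))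
        + (((n : ℂ) ^ 2 + n) / 3 * delta (m + n)) • e .C
  | _, _ => 0

theorem eps_comm (x y : Gen) : eps x y = eps y x := by
  simp [eps, Bool.and_comm]

theorem eps_mul_self (x y : Gen) : eps x y * eps x y = 1 := by
  unfold eps; split <;> norm_num

theorem delta_mul_of_ne {k : ℤ} (h : k ≠ 0) : delta k = 0 := by simp [delta, h]

theorem bracket_swap (x y : Gen) : bracket y x = (-eps x y) • bracket x y := by
  cases x <;> cases y <;> simp only [bracket, eps, Gen.odd, smul_zero, Bool.and_self,
    Bool.and_false, Bool.false_and, if_true, if_false, Bool.false_eq_true]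
  case L.L m n => rw [add_comm n m]; module
  case H.H m n =>
    rw [add_comm n m]
    -- The coefficient `m/3` is antisymmetric in the two modes only where the Kronecker symbol is
    -- nonzero.
    by_cases h : m + n = 0
    · obtain rfl : n = -m := by omega
      push_cast; module
    · simp [delta_mul_of_ne h]
  all_goals (rename_i m n; rw [add_comm n m]; module)

theorem odd_of_mem_bracket {x y k : Gen} (h : k ∈ (bracket x y).support) :
    k.odd = xor x.odd y.odd := by
  contrapose! h
  rw [Finsupp.notMem_support_iff]
  cases x <;> cases y <;> cases k <;> simp_all [bracket, Gen.odd]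

theorem bracket_self (x : Gen) : bracket x x = 0 := by
  cases x <;> simp [bracket]
  rename_i m
  by_cases h : m = 0
  · simp [h]
  · simp [delta_mul_of_ne (show m + m ≠ 0 by omega)]

/-- The bracket with a basis element on the right, extended linearly. -/
def brL (α : Gen →₀ ℂ) (z : Gen) : Gen →₀ ℂ := Finsupp.linearCombination ℂ (fun k => bracket k z) α

/-- The bracket with a basis element on the left, extended linearly. -/
def brR (x : Gen) (β : Gen →₀ ℂ) : Gen →₀ ℂ := Finsupp.linearCombination ℂ (bracket x) β

/-- For each choice of kinds, both sides are combinations of one family of letters of mode `m + n +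
p` and of `C`, so the identity reduces to polynomial identities in the modes. The form chosen, with
`y` acting last in the final term, is the one that the induction on words consumes. -/
theorem jacobi (x y z : Gen) :
    brL (bracket x y) z = brR x (bracket y z) + eps y z • brL (bracket x z) y := by
  cases x <;> cases y <;> cases z <;>
    simp only [bracket, eps, Gen.odd, brL, brR, map_add, map_sub, map_smul, map_neg, map_zero,
      Finsupp.linearCombination_single, one_smul, smul_zero, Bool.and_self,
      Bool.and_false, Bool.false_and, if_true, if_false, Bool.false_eq_true, add_zero, zero_add,
      neg_zero, sub_zero, sub_self]
  all_goals rename_i m n p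
  all_goals try rw [add_right_comm m p n]
  all_goals try rw [← add_assoc m n p]
  all_goals (
    -- The cocycle identities for `C` hold only on the support of the Kronecker symbol; there one
    -- mode is eliminated.
    by_cases h : m + n + p = 0
    · obtain rfl : p = -m - n := by omega
      push_cast
      try simp only [h]
      module
    · try simp only [delta_mul_of_ne h]
      push_cast
      module)

/-! ### Supports of linear combinations -/

open Classical in
theorem _root_.Finsupp.exists_mem_support_of_linearCombination {α β : Type*} {f : α → β →₀ ℂ}
    {g : α →₀ ℂ} {b : β} (h : b ∈ (Finsupp.linearCombination ℂ f g).support) :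
    ∃ a ∈ g.support, b ∈ (f a).support := by
  rw [Finsupp.linearCombination_apply] at h
  obtain ⟨a, ha, hb⟩ := Finset.mem_biUnion.1 (Finsupp.support_sum h)
  exact ⟨a, ha, Finsupp.support_smul hb⟩

theorem _root_.Finsupp.linearCombination_congr_support {α M : Type*} [AddCommGroup M] [Module ℂ M]
    {f f' : α → M} {g : α →₀ ℂ} (h : ∀ a ∈ g.support, f a = f' a) :
    Finsupp.linearCombination ℂ f g = Finsupp.linearCombination ℂ f' g := by
  simp only [Finsupp.linearCombination_apply, Finsupp.sum]
  exact Finset.sum_congr rfl fun a ha => by rw [h a ha]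

/-! ### Sorted words -/

/-- The letters of the standard monomials of `V^A`. -/
def neg (A : Fermion) : Gen → Prop
  | .L m => m ≤ -1
  | .H m => m ≤ -1
  | .G m => m ≤ (match A with | .G => -1 | .Q => 0)
  | .Q m => m ≤ (match A with | .G => 0 | .Q => -1)
  | .C => False

/-- The sorting key of the letters in the standard monomials of `V^A`. -/
def key (A : Fermion) : Gen → ℕ ×ₗ ℤ
  | .L m => if m = -1 then toLex (4, 0) else toLex (0, m)
  | .H m => toLex (1, m)
  | .G m => match A with
    | .G => if m = -1 then toLex (5, 0) else toLex (2, m)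
    | .Q => if m = -1 then toLex (6, 0) else if m = 0 then toLex (7, 0) else toLex (3, m)
  | .Q m => match A with
    | .Q => if m = -1 then toLex (5, 0) else toLex (2, m)
    | .G => if m = -1 then toLex (6, 0) else if m = 0 then toLex (7, 0) else toLex (3, m)
  | .C => toLex (8, 0)

theorem key_injective {A : Fermion} {x y : Gen} (hx : neg A x) (hy : neg A y)
    (h : key A x = key A y) : x = y := by
  cases A <;> cases x <;> cases y <;> simp only [neg, key] at hx hy h ⊢ <;>
    (try split_ifs at h) <;> simp_all

/-- `x` may stand on the left of `y` in a standard monomial. -/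
def prec (A : Fermion) (x y : Gen) : Prop := key A x < key A y ∨ (x = y ∧ x.odd = false)

theorem prec_trans {A : Fermion} {x y z : Gen} (h : prec A x y) (h' : prec A y z) :
    prec A x z := by
  rcases h with h | ⟨rfl, h⟩
  · rcases h' with h' | ⟨rfl, -⟩
    · exact .inl (h.trans h')
    · exact .inl h
  · exact h'

theorem prec_total {A : Fermion} {x y : Gen} (hx : neg A x) (hy : neg A y) (hne : x ≠ y)
    (h : ¬ prec A x y) : prec A y x := by
  rcases lt_trichotomy (key A x) (key A y) with h' | h' | h'
  · exact absurd (.inl h') h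
  · exact absurd (key_injective hx hy h') hne
  · exact .inl h'

/-- The words of the standard monomials of `V^A`. -/
def Sorted (A : Fermion) (v : List Gen) : Prop := (∀ x ∈ v, neg A x) ∧ v.Pairwise (prec A)

/-- The letter `x` may be prepended to `v`. -/
def fits (A : Fermion) (x : Gen) (v : List Gen) : Prop := neg A x ∧ ∀ y ∈ v, prec A x y

theorem sorted_nil (A : Fermion) : Sorted A [] := by simp [Sorted]

theorem sorted_cons {A : Fermion} {x : Gen} {v : List Gen} :
    Sorted A (x :: v) ↔ fits A x v ∧ Sorted A v := by
  simp only [Sorted, fits, List.mem_cons, List.pairwise_cons, forall_eq_or_imp]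
  tauto

theorem not_prec_of_not_fits {A : Fermion} {x y : Gen} {w : List Gen} (hv : Sorted A (y :: w))
    (h : ¬ fits A x (y :: w)) (hx : neg A x) : ¬ prec A x y := by
  intro hxy
  refine h ⟨hx, ?_⟩
  intro z hz
  rcases List.mem_cons.1 hz with rfl | hz
  · exact hxy
  · exact prec_trans hxy ((sorted_cons.1 hv).1.2 z hz)

theorem not_fits_self {A : Fermion} {x : Gen} {w : List Gen} (hx : x.odd = true) :
    ¬ fits A x (x :: w) := by
  rintro ⟨-, h⟩
  have := h x (by simp)
  simp [prec, hx] at this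

/-- As `x` may not precede `y`, totality of the order puts `y` before `x`, and `y` already precedes
`w`. This makes the reordering recursion terminate: once `x` has been moved into `w`, putting `y`
back in front needs no further reordering. -/
theorem fits_of_perm {A : Fermion} {x y : Gen} {v w : List Gen} (hv : Sorted A (y :: w))
    (h : ¬ fits A x (y :: w)) (hne : x ≠ y) (hp : v.Perm (x :: w)) (hs : Sorted A v) :
    fits A y v := by
  have hx : neg A x := hs.1 x (hp.symm.subset (by simp))
  have hy := (sorted_cons.1 hv).1
  refine ⟨hy.1, fun z hz => ?_⟩
  rcases List.mem_cons.1 (hp.subset hz) with rfl | hz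
  · exact prec_total hx hy.1 hne (not_prec_of_not_fits hv h hx)
  · exact hy.2 z hz

theorem fits_of_fits_cons {A : Fermion} {x y : Gen} {v : List Gen} (h : fits A x (y :: v)) :
    fits A x v := ⟨h.1, fun z hz => h.2 z (by simp [hz])⟩

theorem Sorted.eq_of_perm {A : Fermion} {v w : List Gen} (hv : Sorted A v) (hw : Sorted A w)
    (h : v.Perm w) : v = w := by
  refine h.eq_of_pairwise (le := prec A) ?_ hv.2 hw.2
  intro a b _ _ hab hba
  rcases hab with hab | hab
  · rcases hba with hba | hba
    · exact absurd (hab.trans hba) (lt_irrefl _)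
    · exact hba.1.symm
  · exact hab.1

/-! ### The action on words -/

open Classical in
/-- The action of the basis elements on words, with a bound `n` on the recursion depth. -/
def act (A : Fermion) (lam : Gen → ℂ) : ℕ → Gen → List Gen → (List Gen →₀ ℂ)
  | 0, x, v => if fits A x v then Finsupp.single (x :: v) 1 else
      -- The value 0 on a nonempty word is junk for exhausted depth; a depth of at least the length
      -- of a sorted word never meets it.
      if v = [] then Finsupp.single [] (lam x) else 0
  | n + 1, x, v => if fits A x v then Finsupp.single (x :: v) 1 else
      match v with
      | [] => Finsupp.single [] (lam x)
      -- On a sorted word an even letter fits in front of itself, so this case concerns odd letters,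
      -- whose squares are half their vanishing self-brackets.
      | y :: w => if x = y then 0 else
          eps x y • Finsupp.linearCombination ℂ (act A lam n y) (act A lam n x w) +
            Finsupp.linearCombination ℂ (fun z => act A lam n z w) (bracket x y)

section Action

variable {A : Fermion} {lam : Gen → ℂ}

theorem act_of_fits {n : ℕ} {x : Gen} {v : List Gen} (h : fits A x v) :
    act A lam n x v = Finsupp.single (x :: v) 1 := by
  cases n <;> simp [act, h]

theorem act_nil {n : ℕ} {x : Gen} (h : ¬ fits A x []) :
    act A lam n x [] = Finsupp.single [] (lam x) := by
  cases n <;> simp [act, h]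

theorem act_zero_cons {x y : Gen} {w : List Gen} (h : ¬ fits A x (y :: w)) :
    act A lam 0 x (y :: w) = 0 := by
  simp [act, h]

theorem act_same {n : ℕ} {x : Gen} {w : List Gen} (h : ¬ fits A x (x :: w)) :
    act A lam n x (x :: w) = 0 := by
  cases n <;> simp [act, h]

theorem act_succ_cons {n : ℕ} {x y : Gen} {w : List Gen} (h : ¬ fits A x (y :: w)) (hne : x ≠ y) :
    act A lam (n + 1) x (y :: w) =
      eps x y • Finsupp.linearCombination ℂ (act A lam n y) (act A lam n x w) +
        Finsupp.linearCombination ℂ (fun z => act A lam n z w) (bracket x y) := by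
  simp [act, h, hne]

/-- Reordering alone only permutes the letters, whereas every bracket and every evaluation on the
empty word shortens the word. The dichotomy supports all later inductions: a short word is handled
by the induction hypothesis, a permuted one by `fits_of_perm`. -/
theorem act_support {n : ℕ} {x : Gen} {v v' : List Gen} (hv : Sorted A v)
    (h : v' ∈ (act A lam n x v).support) :
    Sorted A v' ∧ (v'.length ≤ v.length ∨ v'.Perm (x :: v)) := by
  classical
  induction n generalizing x v v' with
  | zero =>
    by_cases hf : fits A x v
    · rw [act_of_fits hf] at h
      obtain rfl := Finset.mem_singleton.1 (Finsupp.support_single_subset h)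
      exact ⟨sorted_cons.2 ⟨hf, hv⟩, .inr (List.Perm.refl _)⟩
    · cases v with
      | nil =>
        rw [act_nil hf] at h
        obtain rfl := Finset.mem_singleton.1 (Finsupp.support_single_subset h)
        exact ⟨hv, .inl le_rfl⟩
      | cons y w => simp [act_zero_cons hf] at h
  | succ n ih =>
    by_cases hf : fits A x v
    · rw [act_of_fits hf] at h
      obtain rfl := Finset.mem_singleton.1 (Finsupp.support_single_subset h)
      exact ⟨sorted_cons.2 ⟨hf, hv⟩, .inr (List.Perm.refl _)⟩
    · cases v with
      | nil =>
        rw [act_nil hf] at h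
        obtain rfl := Finset.mem_singleton.1 (Finsupp.support_single_subset h)
        exact ⟨hv, .inl le_rfl⟩
      | cons y w =>
        have hw := (sorted_cons.1 hv).2
        by_cases hne : x = y
        · subst hne
          simp [act_same hf] at h
        · rw [act_succ_cons hf hne] at h
          rcases Finset.mem_union.1 (Finsupp.support_add h) with h | h
          · obtain ⟨u, hu, hu'⟩ :=
              Finsupp.exists_mem_support_of_linearCombination (Finsupp.support_smul h)
            obtain ⟨hus, hul⟩ := ih hw hu
            obtain ⟨hs, hl⟩ := ih hus hu'
            refine ⟨hs, ?_⟩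
            rcases hul with hul | hul
            · left
              rcases hl with hl | hl
              · simp only [List.length_cons]; omega
              · rw [hl.length_eq]; simp only [List.length_cons]; omega
            · rw [act_of_fits (fits_of_perm hv hf hne hul hus)] at hu'
              obtain rfl := Finset.mem_singleton.1 (Finsupp.support_single_subset hu')
              exact .inr ((hul.cons y).trans (List.Perm.swap _ _ _))
          · obtain ⟨z, -, hz⟩ := Finsupp.exists_mem_support_of_linearCombination h
            obtain ⟨hs, hl⟩ := ih hw hz
            refine ⟨hs, .inl ?_⟩
            rcases hl with hl | hl
            · simp only [List.length_cons]; omega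
            · rw [hl.length_eq]; simp

/-- The recursion stabilises once the depth reaches the length of the word, so that `rho` may use
the length as depth and still satisfy the recursion without any bound. -/
theorem act_succ {n : ℕ} {x : Gen} {v : List Gen} (hv : Sorted A v) (hn : v.length ≤ n) :
    act A lam n x v = act A lam (n + 1) x v := by
  induction n generalizing x v with
  | zero =>
    obtain rfl : v = [] := List.length_eq_zero_iff.1 (by omega)
    by_cases hf : fits A x []
    · simp [act_of_fits hf]
    · simp [act_nil hf]
  | succ n ih =>
    by_cases hf : fits A x v
    · simp [act_of_fits hf]
    · cases v with
      | nil => simp [act_nil hf]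
      | cons y w =>
        have hw := (sorted_cons.1 hv).2
        simp only [List.length_cons] at hn
        by_cases hne : x = y
        · subst hne
          simp [act_same hf]
        · rw [act_succ_cons hf hne, act_succ_cons hf hne, ← ih (x := x) hw (by omega)]
          congr 1
          · congr 1
            refine Finsupp.linearCombination_congr_support fun u hu => ?_
            obtain ⟨hus, hul⟩ := act_support hw hu
            -- A word that has grown to the length of `y :: w` is too long for the induction
            -- hypothesis, but there `y` is simply prepended at any depth.
            rcases hul with hul | hul
            · exact ih hus (by omega)
            · have := fits_of_perm hv hf hne hul hus
              simp [act_of_fits this]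
          · exact Finsupp.linearCombination_congr_support fun z _ => ih hw (by omega)

theorem act_eq {n : ℕ} {x : Gen} {v : List Gen} (hv : Sorted A v) (hn : v.length ≤ n) :
    act A lam n x v = act A lam v.length x v := by
  induction n, hn using Nat.le_induction with
  | base => rfl
  | succ n hn ih => rw [← act_succ hv hn, ih]

/-- A subadditive weight of the superalgebra bounds the weights in the action. -/
theorem act_weight {wt : Gen → ℤ}
    (hwt : ∀ x y, ∀ z ∈ (bracket x y).support, wt z ≤ wt x + wt y)
    (hlam : ∀ x, lam x ≠ 0 → 0 ≤ wt x) {n : ℕ} {x : Gen} {v v' : List Gen}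
    (h : v' ∈ (act A lam n x v).support) : (v'.map wt).sum ≤ wt x + (v.map wt).sum := by
  classical
  have hfit : ∀ {n : ℕ} {x : Gen} {v v' : List Gen}, fits A x v →
      v' ∈ (act A lam n x v).support → (v'.map wt).sum ≤ wt x + (v.map wt).sum := by
    intro n x v v' hf h
    rw [act_of_fits hf] at h
    obtain rfl := Finset.mem_singleton.1 (Finsupp.support_single_subset h)
    simp
  have hnil : ∀ {n : ℕ} {x : Gen} {v' : List Gen}, ¬ fits A x [] →
      v' ∈ (act A lam n x []).support → (v'.map wt).sum ≤ wt x + (([] : List Gen).map wt).sum := by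
    intro n x v' hf h
    rw [act_nil hf] at h
    obtain rfl := Finset.mem_singleton.1 (Finsupp.support_single_subset h)
    simpa using hlam x (by simpa using h)
  induction n generalizing x v v' with
  | zero =>
    by_cases hf : fits A x v
    · exact hfit hf h
    · cases v with
      | nil => exact hnil hf h
      | cons y w => simp [act_zero_cons hf] at h
  | succ n ih =>
    by_cases hf : fits A x v
    · exact hfit hf h
    · cases v with
      | nil => exact hnil hf h
      | cons y w =>
        simp only [List.map_cons, List.sum_cons]
        by_cases hne : x = y
        · subst hne
          simp [act_same hf] at h
        · rw [act_succ_cons hf hne] at h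
          rcases Finset.mem_union.1 (Finsupp.support_add h) with h | h
          · obtain ⟨u, hu, hu'⟩ :=
              Finsupp.exists_mem_support_of_linearCombination (Finsupp.support_smul h)
            have := ih hu
            have := ih hu'
            linarith
          · obtain ⟨z, hz, hz'⟩ := Finsupp.exists_mem_support_of_linearCombination h
            have := ih hz'
            have := hwt x y z hz
            linarith

variable (A lam) in
/-- The operator of a basis element on the space of words. -/
def rho (x : Gen) : (List Gen →₀ ℂ) →ₗ[ℂ] (List Gen →₀ ℂ) :=
  Finsupp.linearCombination ℂ fun v => act A lam v.length x v

variable (A lam) in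
/-- The operator of an element of the superalgebra on the space of words. -/
def Rho (α : Gen →₀ ℂ) : (List Gen →₀ ℂ) →ₗ[ℂ] (List Gen →₀ ℂ) :=
  Finsupp.linearCombination ℂ (rho A lam) α

theorem rho_single (x : Gen) (v : List Gen) :
    rho A lam x (Finsupp.single v 1) = act A lam v.length x v := by
  simp [rho]

theorem rho_of_fits {x : Gen} {v : List Gen} (h : fits A x v) :
    rho A lam x (Finsupp.single v 1) = Finsupp.single (x :: v) 1 := by
  rw [rho_single, act_of_fits h]

theorem rho_nil {x : Gen} (h : ¬ neg A x) :
    rho A lam x (Finsupp.single [] 1) = lam x • Finsupp.single [] 1 := by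
  rw [rho_single, act_nil fun h' => h h'.1, Finsupp.smul_single, smul_eq_mul, mul_one]

theorem rho_same {x : Gen} {v : List Gen} (h : x.odd = true) :
    rho A lam x (Finsupp.single (x :: v) 1) = 0 := by
  rw [rho_single, act_same (not_fits_self h)]

theorem Rho_apply (α : Gen →₀ ℂ) (f : List Gen →₀ ℂ) :
    Rho A lam α f = Finsupp.linearCombination ℂ (fun z => rho A lam z f) α := by
  simp [Rho, Finsupp.linearCombination_apply, Finsupp.sum, LinearMap.sum_apply]

/-- The reordering rule freed from the depth parameter: it is the commutation relation of `x` and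
`y` on `w`, by construction. -/
theorem rho_cons {x y : Gen} {w : List Gen} (hv : Sorted A (y :: w)) (h : ¬ fits A x (y :: w))
    (hne : x ≠ y) : rho A lam x (Finsupp.single (y :: w) 1) =
      eps x y • rho A lam y (rho A lam x (Finsupp.single w 1)) +
        Rho A lam (bracket x y) (Finsupp.single w 1) := by
  have hw := (sorted_cons.1 hv).2
  rw [rho_single, List.length_cons, act_succ_cons h hne, Rho_apply]
  simp only [rho_single]
  congr 2
  refine Finsupp.linearCombination_congr_support fun u hu => ?_
  obtain ⟨hus, hul⟩ := act_support hw hu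
  rcases hul with hul | hul
  · exact act_eq hus hul
  · have := fits_of_perm hv h hne hul hus
    simp [act_of_fits this]

theorem rho_support {x : Gen} {v v' : List Gen} (hv : Sorted A v)
    (h : v' ∈ (rho A lam x (Finsupp.single v 1)).support) :
    Sorted A v' ∧ (v'.length ≤ v.length ∨ v'.Perm (x :: v)) := by
  rw [rho_single] at h
  exact act_support hv h

/-! ### Commutation relations of the operators on words -/

variable (A lam) in
/-- The operators of `x` and `y` satisfy their commutation relation on `f`. -/
def Comm (x y : Gen) (f : List Gen →₀ ℂ) : Prop :=
  rho A lam x (rho A lam y f) = eps x y • rho A lam y (rho A lam x f) +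
    Rho A lam (bracket x y) f

theorem Comm.symm {x y : Gen} {f : List Gen →₀ ℂ} (h : Comm A lam x y f) : Comm A lam y x f := by
  unfold Comm at *
  rw [h, bracket_swap x y, eps_comm y x, smul_add, smul_smul, eps_mul_self, Rho, Rho, map_smul,
    LinearMap.smul_apply]
  module

theorem Comm.linear {x y : Gen} {f : List Gen →₀ ℂ}
    (h : ∀ v ∈ f.support, Comm A lam x y (Finsupp.single v 1)) : Comm A lam x y f := by
  unfold Comm at *
  have key : ∀ T T' : (List Gen →₀ ℂ) →ₗ[ℂ] (List Gen →₀ ℂ),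
      (∀ v ∈ f.support, T (Finsupp.single v 1) = T' (Finsupp.single v 1)) → T f = T' f := by
    intro T T' hT
    conv_lhs => rw [← Finsupp.sum_single f]
    conv_rhs => rw [← Finsupp.sum_single f]
    simp only [Finsupp.sum, map_sum]
    refine Finset.sum_congr rfl fun v hv => ?_
    have : Finsupp.single v (f v) = f v • Finsupp.single v (1 : ℂ) := by simp
    rw [this, map_smul, map_smul, hT v hv]
  exact key (rho A lam x ∘ₗ rho A lam y)
    (eps x y • (rho A lam y ∘ₗ rho A lam x) + Rho A lam (bracket x y)) h

theorem Comm.of_even {x : Gen} (hx : x.odd = false) (f : List Gen →₀ ℂ) : Comm A lam x x f := by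
  simp [Comm, bracket_self, Rho, eps, hx]

/-- When `y` fits, `y · v` is the word `y :: v`, and moving `x` past `y` there is the defining
recursion. If `x` fits in front of `y :: v` as well, then `y` cannot fit in front of `x :: v`, and
the two letters exchange roles. -/
theorem Comm.of_fits {x y : Gen} {v : List Gen} (hv : Sorted A v) (hy : fits A y v) :
    Comm A lam x y (Finsupp.single v 1) := by
  have main : ∀ {x y : Gen}, fits A y v → x ≠ y → ¬ fits A x (y :: v) →
      Comm A lam x y (Finsupp.single v 1) := by
    intro x y hy hne hf
    unfold Comm
    rw [rho_of_fits hy, rho_cons (sorted_cons.2 ⟨hy, hv⟩) hf hne]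
  by_cases hne : x = y
  · subst hne
    cases hx : x.odd with
    | false => exact Comm.of_even hx _
    | true =>
      unfold Comm
      rw [rho_of_fits hy, rho_same hx, bracket_self]
      simp [Rho]
  · by_cases hf : fits A x (y :: v)
    · refine (main (fits_of_fits_cons hf) (Ne.symm hne) fun h => ?_).symm
      have h1 := hf.2 y (by simp)
      have h2 := h.2 x (by simp)
      rcases h1 with h1 | h1
      · rcases h2 with h2 | h2
        · exact absurd (h1.trans h2) (lt_irrefl _)
        · exact hne h2.1.symm
      · exact hne h1.1
    · exact main hy hne hf

theorem Rho_zero (f : List Gen →₀ ℂ) : Rho A lam 0 f = 0 := by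
  simp [Rho]

theorem Rho_add (α β : Gen →₀ ℂ) (f : List Gen →₀ ℂ) :
    Rho A lam (α + β) f = Rho A lam α f + Rho A lam β f := by
  simp [Rho]

theorem Rho_smul (r : ℂ) (α : Gen →₀ ℂ) (f : List Gen →₀ ℂ) :
    Rho A lam (r • α) f = r • Rho A lam α f := by
  simp [Rho]

theorem Rho_linearCombination {ι : Type*} (g : ι → Gen →₀ ℂ) (α : ι →₀ ℂ) (f : List Gen →₀ ℂ) :
    Rho A lam (Finsupp.linearCombination ℂ g α) f =
      Finsupp.linearCombination ℂ (fun k => Rho A lam (g k) f) α := by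
  simp [Rho, Finsupp.linearCombination_apply, Finsupp.sum, LinearMap.sum_apply]

/-- The commutation relation extended linearly to `α`, which must be homogeneous in parity for a
single sign `s` to work. Brackets of letters are, by `eps_of_mem_bracket`. -/
theorem Rho_comm_left {α : Gen →₀ ℂ} {z : Gen} {s : ℂ} {f : List Gen →₀ ℂ}
    (hs : ∀ k ∈ α.support, eps k z = s) (h : ∀ k ∈ α.support, Comm A lam k z f) :
    Rho A lam α (rho A lam z f) = s • rho A lam z (Rho A lam α f) + Rho A lam (brL α z) f := by
  rw [brL, Rho_linearCombination, Rho_apply, Rho_apply]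
  simp only [Finsupp.linearCombination_apply, Finsupp.sum, map_sum, Finset.smul_sum,
    ← Finset.sum_add_distrib, map_smul]
  refine Finset.sum_congr rfl fun k hk => ?_
  rw [h k hk, hs k hk]
  module

theorem Rho_comm_right {α : Gen →₀ ℂ} {x : Gen} {s : ℂ} {f : List Gen →₀ ℂ}
    (hs : ∀ k ∈ α.support, eps x k = s) (h : ∀ k ∈ α.support, Comm A lam x k f) :
    rho A lam x (Rho A lam α f) = s • Rho A lam α (rho A lam x f) + Rho A lam (brR x α) f := by
  rw [brR, Rho_linearCombination, Rho_apply, Rho_apply]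
  simp only [Finsupp.linearCombination_apply, Finsupp.sum, map_sum, Finset.smul_sum,
    ← Finset.sum_add_distrib, map_smul]
  refine Finset.sum_congr rfl fun k hk => ?_
  rw [h k hk, hs k hk]
  module

theorem eps_of_mem_bracket {x z k : Gen} (y : Gen) (h : k ∈ (bracket x z).support) :
    eps k y = eps x y * eps z y := by
  simp only [eps, odd_of_mem_bracket h]
  cases x.odd <;> cases z.odd <;> cases y.odd <;> simp

theorem eps_eq (x y : Gen) : eps x y = 1 ∨ eps x y = -1 := by
  unfold eps; split <;> simp

/-- Both letters have to be moved past `z`. Moving them all the way in either order leaves the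
relation of `x` and `y` on the shorter word `w`, and the leftover double brackets cancel by the
Jacobi identity. -/
theorem Comm.of_cons {x y z : Gen} {w : List Gen} (hv : Sorted A (z :: w))
    (hx : ¬ fits A x (z :: w)) (hy : ¬ fits A y (z :: w)) (hxz : x ≠ z) (hyz : y ≠ z)
    (ih : ∀ u, Sorted A u → u.length ≤ w.length → ∀ x y, Comm A lam x y (Finsupp.single u 1)) :
    Comm A lam x y (Finsupp.single (z :: w) 1) := by
  obtain ⟨hz, hw⟩ := sorted_cons.1 hv
  have hC : ∀ {x y : Gen}, ¬ fits A y (z :: w) → y ≠ z →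
      Comm A lam x z (rho A lam y (Finsupp.single w 1)) := by
    intro x y hy hyz
    -- The words in `y · w` may be as long as `z :: w`, out of reach of `ih`; but those are
    -- rearrangements of `y :: w`, in front of which `z` fits.
    refine Comm.linear fun u hu => ?_
    obtain ⟨hus, hul⟩ := rho_support hw hu
    rcases hul with hul | hul
    · exact ih u hus hul _ _
    · exact Comm.of_fits hus (fits_of_perm hv hy hyz hul hus)
  have C1 : Comm A lam x z _ := hC hy hyz
  have C2 : Comm A lam y z _ := hC hx hxz
  have C3 : Comm A lam x y _ := ih w hw le_rfl x y
  have R1 := Rho_comm_left (A := A) (lam := lam) (α := bracket x z) (z := y)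
    (f := Finsupp.single w 1)
    (fun k hk => eps_of_mem_bracket y hk) fun k _ => ih w hw le_rfl k y
  have R2 := Rho_comm_right (A := A) (lam := lam) (α := bracket y z) (x := x)
    (f := Finsupp.single w 1) (s := eps y x * eps z x)
    (fun k hk => by rw [eps_comm]; exact eps_of_mem_bracket x hk) fun k _ => ih w hw le_rfl x k
  have R3 := Rho_comm_left (A := A) (lam := lam) (α := bracket x y) (z := z)
    (f := Finsupp.single w 1)
    (fun k hk => eps_of_mem_bracket z hk) fun k _ => ih w hw le_rfl k z
  rw [jacobi, Rho_add, Rho_smul] at R3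
  unfold Comm at *
  rw [rho_of_fits hz] at R3
  rw [R3, rho_cons hv hy hyz, rho_cons hv hx hxz]
  simp only [map_add, map_smul]
  rw [C1, C2, C3, R1, R2]
  simp only [map_add, map_smul, eps_comm y x, eps_comm z y, eps_comm z x]
  rcases eps_eq y z with h | h <;> rw [h] <;> module

/-- The degenerate case of a repeated letter `z`, which must then be odd. The rule that `z · z`
vanishes replaces the recursion, and is consistent with it because `[[x, z], z] = 0`. -/
theorem Comm.of_cons_same {x z : Gen} {w : List Gen} (hv : Sorted A (z :: w))
    (hx : ¬ fits A x (z :: w)) (hz' : ¬ fits A z (z :: w)) (hxz : x ≠ z)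
    (ih : ∀ u, Sorted A u → u.length ≤ w.length → ∀ x y, Comm A lam x y (Finsupp.single u 1)) :
    Comm A lam x z (Finsupp.single (z :: w) 1) := by
  obtain ⟨hz, hw⟩ := sorted_cons.1 hv
  have hodd : z.odd = true := by
    by_contra h
    refine hz' ⟨hz.1, fun y hy => ?_⟩
    rcases List.mem_cons.1 hy with rfl | hy
    · exact .inr ⟨rfl, by simpa using h⟩
    · exact hz.2 y hy
  have hzz : eps z z = -1 := by simp [eps, hodd]
  have C1 : Comm A lam z z (rho A lam x (Finsupp.single w 1)) := by
    refine Comm.linear fun u hu => ?_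
    obtain ⟨hus, hul⟩ := rho_support hw hu
    rcases hul with hul | hul
    · exact ih u hus hul _ _
    · exact Comm.of_fits hus (fits_of_perm hv hx hxz hul hus)
  have R1 := Rho_comm_left (A := A) (lam := lam) (α := bracket x z) (z := z)
    (f := Finsupp.single w 1)
    (fun k hk => eps_of_mem_bracket z hk) fun k _ => ih w hw le_rfl k z
  have J := jacobi x z z
  -- For odd `z` with vanishing self-bracket the Jacobi identity says that this double bracket
  -- equals its own negative.
  have hJ : brL (bracket x z) z = 0 := by
    rw [bracket_self, hzz, brR, map_zero, zero_add, neg_smul, one_smul] at J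
    exact self_eq_neg.1 J
  rw [hJ, Rho_zero, rho_of_fits hz, add_zero] at R1
  unfold Comm at *
  rw [bracket_self, Rho_zero, add_zero, hzz, neg_smul, one_smul] at C1
  have C1 := self_eq_neg.1 C1
  rw [R1, rho_same hodd, rho_cons hv hx hxz, hzz]
  simp only [map_add, map_smul, C1, map_zero]
  module

theorem Comm.of_same (x : Gen) (w : List Gen) :
    Comm A lam x x (Finsupp.single (x :: w) 1) := by
  cases ho : x.odd with
  | false => exact Comm.of_even ho _
  | true =>
    unfold Comm
    rw [rho_same ho, bracket_self, Rho_zero, map_zero, smul_zero, add_zero]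

/-- The commutation relations hold on sorted words if they hold on the empty word. -/
theorem comm_of_nil
    (h0 : ∀ x y, ¬ neg A x → ¬ neg A y → Comm A lam x y (Finsupp.single [] 1))
    {v : List Gen} (hv : Sorted A v) (x y : Gen) : Comm A lam x y (Finsupp.single v 1) := by
  suffices ∀ n, ∀ v, Sorted A v → v.length ≤ n → ∀ x y, Comm A lam x y (Finsupp.single v 1) from
    this v.length v hv le_rfl x y
  have nil : ∀ x y, Comm A lam x y (Finsupp.single [] 1) := by
    intro x y
    by_cases hy : neg A y
    · exact Comm.of_fits (sorted_nil A) ⟨hy, by simp⟩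
    · by_cases hx : neg A x
      · exact (Comm.of_fits (sorted_nil A) ⟨hx, by simp⟩).symm
      · exact h0 x y hx hy
  intro n
  induction n with
  | zero =>
    intro v hv hn x y
    obtain rfl : v = [] := List.length_eq_zero_iff.1 (by omega)
    exact nil x y
  | succ n ih =>
    intro v hv hn x y
    cases v with
    | nil => exact nil x y
    | cons z w =>
      have hn : w.length ≤ n := Nat.le_of_succ_le_succ hn
      have ih' : ∀ u, Sorted A u → u.length ≤ w.length → ∀ x y,
          Comm A lam x y (Finsupp.single u 1) := fun u hu hl => ih u hu (hl.trans hn)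
      by_cases hy : fits A y (z :: w)
      · exact Comm.of_fits hv hy
      by_cases hx : fits A x (z :: w)
      · exact (Comm.of_fits hv hx).symm
      by_cases hxz : x = z
      · by_cases hyz : y = z
        · rw [hxz, hyz]
          exact Comm.of_same z w
        · subst hxz
          exact (Comm.of_cons_same hv hy hx hyz ih').symm
      · by_cases hyz : y = z
        · subst hyz
          exact Comm.of_cons_same hv hx hy hxz ih'
        · exact Comm.of_cons hv hx hy hxz hyz ih'

/-! ### The highest weight as a character -/

/-- The highest weight. -/
def hw (Δ q c : ℂ) : Gen → ℂ
  | .L m => if m = 0 then Δ else 0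
  | .H m => if m = 0 then q else 0
  | .C => c
  | _ => 0

/-- The letters outside the standard monomials span the subalgebra from which the Verma module is
induced. -/
theorem not_neg_of_mem_bracket {x y k : Gen} (hx : ¬ neg A x) (hy : ¬ neg A y)
    (h : k ∈ (bracket x y).support) : ¬ neg A k := by
  contrapose! h
  rw [Finsupp.notMem_support_iff]
  cases x <;> cases y <;> cases k <;> simp_all only [bracket, neg, Finsupp.coe_add,
    Finsupp.coe_smul, Finsupp.coe_neg, Finsupp.coe_zero, Finsupp.coe_sub, Pi.add_apply,
    Pi.smul_apply, Pi.neg_apply, Pi.zero_apply, Pi.sub_apply, Finsupp.single_apply, reduceCtorEq,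
    if_false, smul_zero, add_zero, sub_zero, neg_zero, Gen.L.injEq, Gen.H.injEq, Gen.G.injEq,
    Gen.Q.injEq] <;> rw [if_neg (by cases A <;> (try simp only at hx hy h) <;> omega)] <;> simp

/-- The highest weight is a character of the inducing subalgebra. Opposite modes there can only both
be zero, and the one dangerous bracket `{G_0, Q_0} = 2 L_0` is absent because only one of these two
lies in the subalgebra. -/
theorem hw_bracket {Δ q c : ℂ} {x y : Gen} (hx : ¬ neg A x) (hy : ¬ neg A y) :
    Finsupp.linearCombination ℂ (hw Δ q c) (bracket x y) = 0 := by
  cases x <;> cases y <;> simp only [bracket, map_add, map_sub, map_smul, map_neg, map_zero,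
      Finsupp.linearCombination_single, one_smul, hw, smul_zero, neg_zero, delta]
  all_goals
    rename_i m n
    simp only [neg] at hx hy
    by_cases h : m + n = 0
    · first
        | (exfalso; cases A <;> simp only at hx hy <;> omega)
        | (obtain rfl : m = 0 := by omega
           obtain rfl : n = 0 := by omega
           simp)
    · simp [h]

theorem comm_nil {Δ q c : ℂ} {x y : Gen} (hx : ¬ neg A x) (hy : ¬ neg A y) :
    Comm A (hw Δ q c) x y (Finsupp.single [] 1) := by
  have hR : Rho A (hw Δ q c) (bracket x y) (Finsupp.single [] 1) = 0 := by
    rw [Rho_apply, Finsupp.linearCombination_congr_support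
      (f' := fun z => hw Δ q c z • Finsupp.single [] 1)
      fun k hk => rho_nil (not_neg_of_mem_bracket hx hy hk)]
    have := hw_bracket (Δ := Δ) (q := q) (c := c) hx hy
    simp only [Finsupp.linearCombination_apply, Finsupp.sum, smul_eq_mul] at this ⊢
    simp only [smul_smul]
    rw [← Finset.sum_smul, this, zero_smul]
  have hs : hw Δ q c y * hw Δ q c x = eps x y * hw Δ q c x * hw Δ q c y := by
    cases x <;> cases y <;> simp only [eps, Gen.odd, hw, Bool.and_self, Bool.and_false,
      Bool.false_and, if_true, if_false, Bool.false_eq_true] <;> ring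
  unfold Comm
  rw [hR, rho_nil hy, map_smul, rho_nil hx, map_smul, rho_nil hy, smul_smul, smul_smul, smul_smul,
    add_zero, hs]

end Action

/-! ### The enveloping algebra -/

theorem proj_gen (x : Gen) : U.proj (gen x) = U.of x := rfl

theorem rel_eq {a b : Free} (h : Rel a b) : U.proj a = U.proj b :=
  RingQuot.mkAlgHom_rel ℂ h

/-- The defining relations list each pair of kinds in one order only; super antisymmetry of
`bracket` supplies the other order and yields one uniform formula. -/
theorem of_mul_of (x y : Gen) : U.of x * U.of y =
    eps x y • (U.of y * U.of x) + Finsupp.linearCombination ℂ U.of (bracket x y) := by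
  have symm : ∀ x y : Gen, (U.of x * U.of y =
      eps x y • (U.of y * U.of x) + Finsupp.linearCombination ℂ U.of (bracket x y)) →
      (U.of y * U.of x =
      eps y x • (U.of x * U.of y) + Finsupp.linearCombination ℂ U.of (bracket y x)) := by
    intro x y h
    rw [h, bracket_swap x y, eps_comm y x, smul_add, smul_smul, eps_mul_self, map_smul]
    module
  have hC : ∀ x, U.of .C * U.of x =
      eps .C x • (U.of x * U.of .C) + Finsupp.linearCombination ℂ U.of (bracket .C x) := by
    intro x
    have := rel_eq (Rel.central x)
    simp only [map_mul, proj_gen] at this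
    simp [eps, Gen.odd, bracket, this]
  cases x <;> cases y
  case C.L | C.H | C.G | C.Q | C.C => exact hC _
  case L.C | H.C | G.C | Q.C => exact symm _ _ (hC _)
  case' H.L n m => refine symm _ _ ?_; have h := rel_eq (Rel.LH m n)
  case' G.L n m => refine symm _ _ ?_; have h := rel_eq (Rel.LG m n)
  case' Q.L n m => refine symm _ _ ?_; have h := rel_eq (Rel.LQ m n)
  case' G.H n m => refine symm _ _ ?_; have h := rel_eq (Rel.HG m n)
  case' Q.H n m => refine symm _ _ ?_; have h := rel_eq (Rel.HQ m n)
  case' Q.G n m => refine symm _ _ ?_; have h := rel_eq (Rel.GQ m n)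
  case' L.L m n => have h := rel_eq (Rel.LL m n)
  case' L.H m n => have h := rel_eq (Rel.LH m n)
  case' L.G m n => have h := rel_eq (Rel.LG m n)
  case' L.Q m n => have h := rel_eq (Rel.LQ m n)
  case' H.H m n => have h := rel_eq (Rel.HH m n)
  case' H.G m n => have h := rel_eq (Rel.HG m n)
  case' H.Q m n => have h := rel_eq (Rel.HQ m n)
  case' G.G m n => have h := rel_eq (Rel.GG m n)
  case' G.Q m n => have h := rel_eq (Rel.GQ m n)
  case' Q.Q m n => have h := rel_eq (Rel.QQ m n)
  all_goals
    simp only [map_mul, map_sub, map_add, map_smul, map_neg, map_zero, proj_gen] at h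
    simp only [eps, Gen.odd, bracket, Bool.and_self,
      Bool.false_and, if_true, if_false, Bool.false_eq_true, map_sub, map_add, map_smul, map_neg,
      map_zero, Finsupp.linearCombination_single, one_smul]
    rw [← h]
    module

theorem lift_rel {E : Type*} [Ring E] [Algebra ℂ E] {f : Gen → E}
    (hf : ∀ x y, f x * f y =
      eps x y • (f y * f x) + Finsupp.linearCombination ℂ f (bracket x y)) {a b : Free}
    (h : Rel a b) : FreeAlgebra.lift ℂ f a = FreeAlgebra.lift ℂ f b := by
  cases h <;> simp only [gen, map_sub, map_add, map_mul, map_smul, map_neg, map_zero,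
    FreeAlgebra.lift_ι_apply]
  case central x => simpa [eps, Gen.odd, bracket] using hf .C x
  all_goals
    rw [hf]
    simp only [eps, Gen.odd, bracket, Bool.and_self,
      Bool.false_and, if_true, if_false, Bool.false_eq_true, map_sub, map_add, map_smul, map_neg,
      map_zero, Finsupp.linearCombination_single, one_smul]
    module

theorem U.induction {P : U → Prop} (hsmul : ∀ r : ℂ, P (algebraMap ℂ U r))
    (hof : ∀ x, P (U.of x)) (hmul : ∀ a b, P a → P b → P (a * b))
    (hadd : ∀ a b, P a → P b → P (a + b)) (a : U) : P a := by
  obtain ⟨f, rfl⟩ : ∃ f, U.proj f = a := RingQuot.mkAlgHom_surjective ℂ Rel a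
  induction f using FreeAlgebra.induction with
  | grade0 r => rw [AlgHom.commutes]; exact hsmul r
  | grade1 x => exact hof x
  | mul a b ha hb => rw [map_mul]; exact hmul _ _ ha hb
  | add a b ha hb => rw [map_add]; exact hadd _ _ ha hb

/-! ### The module of sorted words -/

variable {A : Fermion} {Δ q c : ℂ}

/-- The space spanned by the sorted words. -/
def words (A : Fermion) : Submodule ℂ (List Gen →₀ ℂ) :=
  Finsupp.supported ℂ ℂ {v | Sorted A v}

theorem sorted_of_mem_words {f : List Gen →₀ ℂ} (hf : f ∈ words A) {v : List Gen}
    (hv : v ∈ f.support) : Sorted A v :=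
  hf hv

theorem words_induction {P : (List Gen →₀ ℂ) → Prop} (h0 : P 0)
    (hadd : ∀ f g, P f → P g → P (f + g)) (hsmul : ∀ (r : ℂ) f, P f → P (r • f))
    (hs : ∀ v, Sorted A v → P (Finsupp.single v 1)) {f : List Gen →₀ ℂ} (hf : f ∈ words A) :
    P f := by
  rw [words, Finsupp.supported_eq_span_single] at hf
  induction hf using Submodule.span_induction with
  | mem x hx => obtain ⟨v, hv, rfl⟩ := hx; exact hs v hv
  | zero => exact h0
  | add f g _ _ hf hg => exact hadd f g hf hg
  | smul r f _ hf => exact hsmul r f hf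

theorem rho_mem_words {lam : Gen → ℂ} (x : Gen) {f : List Gen →₀ ℂ} (hf : f ∈ words A) :
    rho A lam x f ∈ words A := by
  refine words_induction (P := fun f => rho A lam x f ∈ words A) (by simp)
    (fun f g hf hg => by rw [map_add]; exact add_mem hf hg)
    (fun r f hf => by rw [map_smul]; exact Submodule.smul_mem _ r hf) (fun v hv => ?_) hf
  intro u hu
  exact (rho_support hv hu).1

/-- The space of sorted words, to become a module over the enveloping algebra. -/
def Model (A : Fermion) (_Δ _q _c : ℂ) : Type := words A

instance : AddCommGroup (Model A Δ q c) := inferInstanceAs (AddCommGroup (words A))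

instance : Module ℂ (Model A Δ q c) := inferInstanceAs (Module ℂ (words A))

/-- The inclusion of the sorted words into the words. -/
def Model.val : Model A Δ q c →ₗ[ℂ] (List Gen →₀ ℂ) := (words A).subtype

theorem Model.val_injective : Function.Injective (Model.val (A := A) (Δ := Δ) (q := q) (c := c)) :=
  Subtype.val_injective

theorem Model.val_mem (f : Model A Δ q c) : f.val ∈ words A := f.2

/-- The operator of a basis element on the space of sorted words. -/
def rhoW (A : Fermion) (Δ q c : ℂ) (x : Gen) : Module.End ℂ (Model A Δ q c) :=
  (rho A (hw Δ q c) x).restrict (p := words A) (q := words A) fun _ hf => rho_mem_words x hf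

theorem val_rhoW (x : Gen) (f : Model A Δ q c) :
    (rhoW A Δ q c x f).val = rho A (hw Δ q c) x f.val := rfl

/-- Restriction to sorted words turns the pointwise relations into identities of operators, which is
what the universal property of `U` asks for. -/
theorem rhoW_comm (x y : Gen) : rhoW A Δ q c x * rhoW A Δ q c y =
    eps x y • (rhoW A Δ q c y * rhoW A Δ q c x) +
      Finsupp.linearCombination ℂ (rhoW A Δ q c) (bracket x y) := by
  ext1 f
  apply Model.val_injective
  have h : Comm A (hw Δ q c) x y f.val :=
    Comm.linear fun v hv => comm_of_nil (fun x y hx hy => comm_nil hx hy)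
      (sorted_of_mem_words f.val_mem hv) x y
  rw [Comm, Rho_apply] at h
  simpa [val_rhoW, Finsupp.linearCombination_apply, Finsupp.sum, LinearMap.sum_apply] using h

/-- The action of the enveloping algebra on the space of sorted words. -/
def toEnd (A : Fermion) (Δ q c : ℂ) : U →ₐ[ℂ] Module.End ℂ (Model A Δ q c) :=
  RingQuot.liftAlgHom ℂ
    ⟨FreeAlgebra.lift ℂ (rhoW A Δ q c), fun _ _ h => lift_rel rhoW_comm h⟩

theorem toEnd_of (x : Gen) : toEnd A Δ q c (U.of x) = rhoW A Δ q c x := by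
  have : toEnd A Δ q c (U.of x) = FreeAlgebra.lift ℂ (rhoW A Δ q c) (gen x) :=
    RingQuot.liftAlgHom_mkAlgHom_apply ℂ (FreeAlgebra.lift ℂ (rhoW A Δ q c))
      (fun _ _ h => lift_rel rhoW_comm h) (gen x)
  rw [this, gen, FreeAlgebra.lift_ι_apply]

instance : Module U (Model A Δ q c) :=
  Module.compHom (Model A Δ q c) (toEnd A Δ q c).toRingHom

theorem Model.smul_def (a : U) (f : Model A Δ q c) : a • f = toEnd A Δ q c a f := rfl

/-- The empty word. -/
def Model.nil (A : Fermion) (Δ q c : ℂ) : Model A Δ q c :=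
  (⟨Finsupp.single [] 1, Finsupp.single_mem_supported ℂ 1 (sorted_nil A)⟩ : words A)

theorem Model.hwConditions_smul {x : U} (hx : x ∈ hwConditions A Δ q c) :
    x • Model.nil A Δ q c = 0 := by
  have key : ∀ x, ¬ neg A x → (toEnd A Δ q c (U.of x) -
      algebraMap ℂ (Module.End ℂ (Model A Δ q c)) (hw Δ q c x))
      (Model.nil A Δ q c) = 0 := by
    intro x hx
    rw [LinearMap.sub_apply, sub_eq_zero, toEnd_of]
    apply Model.val_injective
    exact rho_nil hx
  rw [Model.smul_def]
  rcases hx with ⟨m, hm, hx⟩ | hx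
  · have key' : ∀ x, ¬ neg A x → hw Δ q c x = 0 →
        toEnd A Δ q c (U.of x) (Model.nil A Δ q c) = 0 := by
      intro x hx h
      simpa [h] using key x hx
    rcases hx with rfl | rfl | rfl | rfl
    · exact key' (.L m) (by simp only [neg]; omega) (by simp [hw, hm.ne'])
    · exact key' (.H m) (by simp only [neg]; omega) (by simp [hw, hm.ne'])
    · exact key' (.G m) (by cases A <;> simp only [neg] <;> omega) rfl
    · exact key' (.Q m) (by cases A <;> simp only [neg] <;> omega) rfl
  · simp only [Set.mem_insert_iff, Set.mem_singleton_iff] at hx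
    rcases hx with rfl | rfl | rfl | rfl
    · rw [map_sub, AlgHom.commutes]
      simpa [hw, L] using key (.L 0) (by simp [neg])
    · rw [map_sub, AlgHom.commutes]
      simpa [hw, H] using key (.H 0) (by simp [neg])
    · rw [map_sub, AlgHom.commutes]
      exact key .C (by simp [neg])
    · cases A
      · simpa [hw, Fermion.mode, G] using key (.G 0) (by simp [neg])
      · simpa [hw, Fermion.mode, Q] using key (.Q 0) (by simp [neg])

/-- The map from the Verma module to the module of sorted words. -/
def toModel (A : Fermion) (Δ q c : ℂ) : Verma A Δ q c →ₗ[U] Model A Δ q c :=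
  Submodule.liftQ _ (LinearMap.toSpanSingleton U (Model A Δ q c) (Model.nil A Δ q c)) <| by
    rw [Submodule.span_le]
    intro x hx
    exact Model.hwConditions_smul hx

theorem toModel_hwv : toModel A Δ q c (hwv A Δ q c) = Model.nil A Δ q c := by
  have : toModel A Δ q c (hwv A Δ q c) = (1 : U) • Model.nil A Δ q c := rfl
  rw [this, one_smul]

theorem algebraMap_smul_verma (r : ℂ) (u : Verma A Δ q c) : algebraMap ℂ U r • u = r • u := rfl

/-- The coordinates of a vector of the Verma module along the sorted words. -/
def coord (A : Fermion) (Δ q c : ℂ) : Verma A Δ q c →ₗ[ℂ] (List Gen →₀ ℂ) where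
  toFun u := (toModel A Δ q c u).val
  map_add' u v := by rw [map_add, map_add]
  map_smul' r u := by
    rw [← algebraMap_smul_verma, map_smul, Model.smul_def, AlgHom.commutes]
    rfl

theorem coord_of_smul (x : Gen) (u : Verma A Δ q c) :
    coord A Δ q c (U.of x • u) = rho A (hw Δ q c) x (coord A Δ q c u) := by
  simp only [coord, LinearMap.coe_mk, AddHom.coe_mk]
  rw [map_smul, Model.smul_def, toEnd_of]
  rfl

theorem coord_hwv : coord A Δ q c (hwv A Δ q c) = Finsupp.single [] 1 := by
  simp only [coord, LinearMap.coe_mk, AddHom.coe_mk, toModel_hwv]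
  rfl

theorem coord_mem_words (u : Verma A Δ q c) : coord A Δ q c u ∈ words A :=
  (toModel A Δ q c u).val_mem

variable (A Δ q c) in
/-- The vector of a word in the Verma module. -/
def wv : List Gen → Verma A Δ q c
  | [] => hwv A Δ q c
  | x :: v => U.of x • wv v

/-- The independence half of Poincaré-Birkhoff-Witt: each letter of a sorted word fits in front of
the rest, so the word is rebuilt without any reordering. -/
theorem coord_wv {v : List Gen} (hv : Sorted A v) :
    coord A Δ q c (wv A Δ q c v) = Finsupp.single v 1 := by
  induction v with
  | nil => exact coord_hwv
  | cons x v ih =>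
    obtain ⟨hx, hv⟩ := sorted_cons.1 hv
    rw [wv, coord_of_smul, ih hv, rho_of_fits hx]

variable (A Δ q c) in
/-- The vector with given coordinates. -/
def ofCoord : (List Gen →₀ ℂ) →ₗ[ℂ] Verma A Δ q c := Finsupp.linearCombination ℂ (wv A Δ q c)

theorem ofCoord_single (v : List Gen) :
    ofCoord A Δ q c (Finsupp.single v 1) = wv A Δ q c v := by
  simp [ofCoord]

theorem of_smul_hwv {x : Gen} (hx : ¬ neg A x) :
    U.of x • hwv A Δ q c = hw Δ q c x • hwv A Δ q c := by
  have key : ∀ a : U, a ∈ hwConditions A Δ q c → a • hwv A Δ q c = 0 := by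
    intro a ha
    have h : a • hwv A Δ q c = Verma.proj A Δ q c (a • 1) := (map_smul _ _ _).symm
    rw [h, smul_eq_mul, mul_one]
    exact (Submodule.Quotient.mk_eq_zero _).2 (Submodule.subset_span ha)
  have key' : ∀ (a : U) (r : ℂ), a - algebraMap ℂ U r ∈ hwConditions A Δ q c →
      a • hwv A Δ q c = r • hwv A Δ q c := by
    intro a r h
    have := key _ h
    rwa [sub_smul, sub_eq_zero] at this
  have key0 : ∀ (a : U), a ∈ hwConditions A Δ q c →
      a • hwv A Δ q c = (0 : ℂ) • hwv A Δ q c := by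
    intro a h
    rw [zero_smul, key a h]
  cases x with
  | L m =>
    simp only [neg] at hx
    by_cases h : m = 0
    · subst h
      simp only [hw, if_true]
      exact key' _ _ (.inr (by simp [L]))
    · simp only [hw, if_neg h]
      exact key0 _ (.inl ⟨m, by omega, by simp [L]⟩)
  | H m =>
    simp only [neg] at hx
    by_cases h : m = 0
    · subst h
      simp only [hw, if_true]
      exact key' _ _ (.inr (by simp [H]))
    · simp only [hw, if_neg h]
      exact key0 _ (.inl ⟨m, by omega, by simp [H]⟩)
  | C => exact key' _ _ (.inr (by simp [C, hw]))
  | G m =>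
    refine key0 _ ?_
    by_cases h : 0 < m
    · exact .inl ⟨m, h, by simp [G]⟩
    · cases A <;> simp only [neg] at hx
      · obtain rfl : m = 0 := by omega
        exact .inr (by simp [G, Fermion.mode])
      · omega
  | Q m =>
    refine key0 _ ?_
    by_cases h : 0 < m
    · exact .inl ⟨m, h, by simp [Q]⟩
    · cases A <;> simp only [neg] at hx
      · omega
      · obtain rfl : m = 0 := by omega
        exact .inr (by simp [Q, Fermion.mode])

/-- The rewriting rules used to define `rho` are true identities in the Verma module, so evaluating
words there commutes with the letters. The proof repeats the recursion of `act`, on the length of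
the word. -/
theorem ofCoord_rho_single {x : Gen} {v : List Gen} (hv : Sorted A v) :
    ofCoord A Δ q c (rho A (hw Δ q c) x (Finsupp.single v 1)) = U.of x • wv A Δ q c v := by
  suffices ∀ n, ∀ v, Sorted A v → v.length ≤ n → ∀ x,
      ofCoord A Δ q c (rho A (hw Δ q c) x (Finsupp.single v 1)) = U.of x • wv A Δ q c v from
    this v.length v hv le_rfl x
  have fit : ∀ {x v}, fits A x v →
      ofCoord A Δ q c (rho A (hw Δ q c) x (Finsupp.single v 1)) = U.of x • wv A Δ q c v := by
    intro x v h
    rw [rho_of_fits h, ofCoord_single, wv]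
  have nil : ∀ x, ofCoord A Δ q c (rho A (hw Δ q c) x (Finsupp.single [] 1)) =
      U.of x • wv A Δ q c [] := by
    intro x
    by_cases hx : neg A x
    · exact fit ⟨hx, by simp⟩
    · rw [rho_nil hx, map_smul, ofCoord_single, wv, of_smul_hwv hx]
  have lin : ∀ {f : List Gen →₀ ℂ} {x : Gen}, (∀ v ∈ f.support,
      ofCoord A Δ q c (rho A (hw Δ q c) x (Finsupp.single v 1)) = U.of x • wv A Δ q c v) →
      ofCoord A Δ q c (rho A (hw Δ q c) x f) = U.of x • ofCoord A Δ q c f := by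
    intro f x h
    conv_lhs => rw [← Finsupp.sum_single f]
    conv_rhs => rw [← Finsupp.sum_single f]
    simp only [Finsupp.sum, map_sum, Finset.smul_sum]
    refine Finset.sum_congr rfl fun v hv => ?_
    have : Finsupp.single v (f v) = f v • Finsupp.single v (1 : ℂ) := by simp
    rw [this, map_smul, map_smul, map_smul, h v hv, ofCoord_single, smul_comm]
  intro n
  induction n with
  | zero =>
    intro v hv hn x
    obtain rfl : v = [] := List.length_eq_zero_iff.1 (by omega)
    exact nil x
  | succ n ih =>
    intro v hv hn x
    cases v with
    | nil => exact nil x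
    | cons y w =>
      have hn : w.length ≤ n := Nat.le_of_succ_le_succ hn
      have hw' := (sorted_cons.1 hv).2
      by_cases hf : fits A x (y :: w)
      · exact fit hf
      by_cases hne : x = y
      · subst hne
        have hodd : x.odd = true := by
          by_contra h
          refine hf ⟨(sorted_cons.1 hv).1.1, fun y hy => ?_⟩
          rcases List.mem_cons.1 hy with rfl | hy
          · exact .inr ⟨rfl, by simpa using h⟩
          · exact (sorted_cons.1 hv).1.2 y hy
        have hx := of_mul_of x x
        rw [bracket_self, map_zero, add_zero] at hx
        simp only [eps, hodd, Bool.and_self, if_true, neg_smul, one_smul] at hx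
        have hxx : U.of x * U.of x = 0 := by
          have h2 : (2 : ℂ) • (U.of x * U.of x) = 0 := by
            rw [two_smul]; nth_rewrite 2 [hx]; simp
          exact (smul_eq_zero.1 h2).resolve_left two_ne_zero
        rw [rho_same hodd, map_zero, wv, ← mul_smul, hxx, zero_smul]
      · rw [rho_cons hv hf hne, map_add, map_smul, lin, lin, ofCoord_single, Rho_apply]
        · rw [show wv A Δ q c (y :: w) = U.of y • wv A Δ q c w from rfl,
            ← mul_smul (U.of x) (U.of y), of_mul_of x y, add_smul, ← mul_smul]
          congr 1
          · rw [smul_assoc]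
          · simp only [Finsupp.linearCombination_apply, Finsupp.sum, map_sum, Finset.sum_smul,
              map_smul]
            refine Finset.sum_congr rfl fun k _ => ?_
            rw [ih w hw' hn, smul_assoc]
        · intro u hu
          obtain rfl := Finset.mem_singleton.1 (Finsupp.support_single_subset hu)
          exact ih _ hw' hn x
        · intro u hu
          obtain ⟨hus, hul⟩ := rho_support hw' hu
          rcases hul with hul | hul
          · exact ih u hus (hul.trans hn) y
          · exact fit (fits_of_perm hv hf hne hul hus)

theorem ofCoord_rho {x : Gen} {f : List Gen →₀ ℂ} (hf : f ∈ words A) :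
    ofCoord A Δ q c (rho A (hw Δ q c) x f) = U.of x • ofCoord A Δ q c f :=
  words_induction
    (P := fun f => ofCoord A Δ q c (rho A (hw Δ q c) x f) = U.of x • ofCoord A Δ q c f)
    (by simp) (fun f g hf hg => by simp only [map_add, smul_add, hf, hg])
    (fun r f hf => by rw [map_smul, map_smul, map_smul, hf, smul_comm])
    (fun v hv => by rw [ofCoord_rho_single hv, ofCoord_single]) hf

/-- The spanning half of Poincaré-Birkhoff-Witt: the identity holds on the highest weight vector and
is stable under `U`, which generates everything from it. -/
theorem ofCoord_coord (u : Verma A Δ q c) : ofCoord A Δ q c (coord A Δ q c u) = u := by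
  have main : ∀ a : U, ∀ u : Verma A Δ q c, ofCoord A Δ q c (coord A Δ q c u) = u →
      ofCoord A Δ q c (coord A Δ q c (a • u)) = a • u := by
    intro a
    induction a using U.induction with
    | hsmul r => intro u hu; rw [algebraMap_smul_verma, map_smul, map_smul, hu]
    | hof x => intro u hu; rw [coord_of_smul, ofCoord_rho (coord_mem_words u), hu]
    | hmul a b ha hb => intro u hu; rw [mul_smul]; exact ha _ (hb _ hu)
    | hadd a b ha hb => intro u hu; rw [add_smul, map_add, map_add, ha _ hu, hb _ hu]
  obtain ⟨a, rfl⟩ := Submodule.Quotient.mk_surjective _ u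
  have h : (Submodule.Quotient.mk a : Verma A Δ q c) = a • hwv A Δ q c := by
    have : a • hwv A Δ q c = Verma.proj A Δ q c (a • 1) := (map_smul _ _ _).symm
    rw [this, smul_eq_mul, mul_one]
    rfl
  rw [h]
  exact main a _ (by rw [coord_hwv, ofCoord_single, wv])

theorem coord_injective : Function.Injective (coord A Δ q c) :=
  Function.LeftInverse.injective ofCoord_coord

/-! ### Standard monomials as sorted words -/

/-- The basis element `G_m` or `Q_m`. -/
def Fermion.gen : Fermion → ℤ → Gen
  | .G, m => .G m
  | .Q, m => .Q m

theorem Fermion.mode_eq (F : Fermion) (m : ℤ) : F.mode m = U.of (F.gen m) := by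
  cases F <;> rfl

theorem wv_eq (v : List Gen) : wv A Δ q c v = (v.map U.of).prod • hwv A Δ q c := by
  induction v with
  | nil => simp [wv]
  | cons x v ih => rw [wv, ih, List.map_cons, List.prod_cons, mul_smul]

/-- The word of a standard monomial. -/
def Term.word (A : Fermion) (X : Term) : List Gen :=
  ((X.l.sort (· ≥ ·)).map fun i : ℕ => Gen.L (-(i : ℤ))) ++
  ((X.h.sort (· ≥ ·)).map fun i : ℕ => Gen.H (-(i : ℤ))) ++
  ((X.a.sort (· ≥ ·)).map fun i : ℕ => A.gen (-(i : ℤ))) ++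
  ((X.b.sort (· ≥ ·)).map fun i : ℕ => A.other.gen (-(i : ℤ))) ++
  List.replicate X.k (Gen.L (-1)) ++ List.replicate X.r₁ (A.gen (-1)) ++
  List.replicate X.r₂ (A.other.gen (-1)) ++ List.replicate X.r₃ (A.other.gen 0)

theorem Term.monomial_smul_hwv (X : Term) :
    X.monomial A • hwv A Δ q c = wv A Δ q c (X.word A) := by
  rw [wv_eq]
  simp only [Term.word, Term.monomial, List.map_append, List.map_map, List.prod_append,
    List.map_replicate, List.prod_replicate, Fermion.mode_eq, L, H]
  rfl

theorem key_L {i : ℕ} (h : 2 ≤ i) : key A (.L (-(i : ℤ))) = toLex (0, -(i : ℤ)) := by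
  simp only [key]; rw [if_neg (by omega)]

theorem key_A {i : ℕ} (h : 2 ≤ i) : key A (A.gen (-(i : ℤ))) = toLex (2, -(i : ℤ)) := by
  cases A <;> simp only [key, Fermion.gen] <;> rw [if_neg (by omega)]

theorem key_B {i : ℕ} (h : 2 ≤ i) : key A (A.other.gen (-(i : ℤ))) = toLex (3, -(i : ℤ)) := by
  cases A <;> simp only [key, Fermion.gen, Fermion.other] <;>
    rw [if_neg (by omega), if_neg (by omega)]

theorem key_L_one : key A (.L (-1)) = toLex (4, 0) := by simp [key]

theorem key_A_one : key A (A.gen (-1)) = toLex (5, 0) := by cases A <;> simp [key, Fermion.gen]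

theorem key_B_one : key A (A.other.gen (-1)) = toLex (6, 0) := by
  cases A <;> simp [key, Fermion.gen, Fermion.other]

theorem key_B_zero : key A (A.other.gen 0) = toLex (7, 0) := by
  cases A <;> simp [key, Fermion.gen, Fermion.other]

theorem Fermion.gen_odd (F : Fermion) (m : ℤ) : (F.gen m).odd = true := by cases F <;> rfl

theorem prec_of_lt {x y : Gen} {i j : ℕ} {a b : ℤ} (hx : key A x = toLex (i, a))
    (hy : key A y = toLex (j, b)) (h : i < j) : prec A x y := by
  left
  rw [hx, hy, Prod.Lex.toLex_lt_toLex]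
  exact .inl h

/-- The first component of `key` numbers the eight blocks of a standard monomial from left to right,
so different blocks are ordered by block number. Inside the blocks of varying mode the mode
increases, strictly for fermions. -/
theorem Term.word_sorted (X : Term) : Sorted A (X.word A) := by
  have mem_l : ∀ x ∈ (X.l.sort (· ≥ ·)).map fun i : ℕ => Gen.L (-(i : ℤ)),
      neg A x ∧ ∃ a, key A x = toLex (0, a) := by
    intro x hx
    obtain ⟨i, hi, rfl⟩ := List.mem_map.1 hx
    have hi := X.two_le_l i ((Multiset.mem_sort _).1 hi)
    exact ⟨by simp only [neg]; omega, _, key_L hi⟩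
  have mem_h : ∀ x ∈ (X.h.sort (· ≥ ·)).map fun i : ℕ => Gen.H (-(i : ℤ)),
      neg A x ∧ ∃ a, key A x = toLex (1, a) := by
    intro x hx
    obtain ⟨i, hi, rfl⟩ := List.mem_map.1 hx
    have hi := X.one_le_h i ((Multiset.mem_sort _).1 hi)
    exact ⟨by simp only [neg]; omega, _, rfl⟩
  have mem_a : ∀ x ∈ (X.a.sort (· ≥ ·)).map fun i : ℕ => A.gen (-(i : ℤ)),
      neg A x ∧ ∃ a, key A x = toLex (2, a) := by
    intro x hx
    obtain ⟨i, hi, rfl⟩ := List.mem_map.1 hx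
    have hi := X.two_le_a i ((Finset.mem_sort _).1 hi)
    exact ⟨by cases A <;> simp only [neg, Fermion.gen] <;> omega, _, key_A hi⟩
  have mem_b : ∀ x ∈ (X.b.sort (· ≥ ·)).map fun i : ℕ => A.other.gen (-(i : ℤ)),
      neg A x ∧ ∃ a, key A x = toLex (3, a) := by
    intro x hx
    obtain ⟨i, hi, rfl⟩ := List.mem_map.1 hx
    have hi := X.two_le_b i ((Finset.mem_sort _).1 hi)
    exact ⟨by cases A <;> simp only [neg, Fermion.gen, Fermion.other] <;> omega, _, key_B hi⟩
  have mem_k : ∀ x ∈ List.replicate X.k (Gen.L (-1)),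
      neg A x ∧ ∃ a, key A x = toLex (4, a) := by
    intro x hx
    obtain rfl := (List.mem_replicate.1 hx).2
    exact ⟨by simp [neg], _, key_L_one⟩
  have mem_1 : ∀ x ∈ List.replicate X.r₁ (A.gen (-1)),
      neg A x ∧ ∃ a, key A x = toLex (5, a) := by
    intro x hx
    obtain rfl := (List.mem_replicate.1 hx).2
    exact ⟨by cases A <;> simp [neg, Fermion.gen], _, key_A_one⟩
  have mem_2 : ∀ x ∈ List.replicate X.r₂ (A.other.gen (-1)),
      neg A x ∧ ∃ a, key A x = toLex (6, a) := by
    intro x hx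
    obtain rfl := (List.mem_replicate.1 hx).2
    exact ⟨by cases A <;> simp [neg, Fermion.gen, Fermion.other], _, key_B_one⟩
  have mem_3 : ∀ x ∈ List.replicate X.r₃ (A.other.gen 0),
      neg A x ∧ ∃ a, key A x = toLex (7, a) := by
    intro x hx
    obtain rfl := (List.mem_replicate.1 hx).2
    exact ⟨by cases A <;> simp [neg, Fermion.gen, Fermion.other], _, key_B_zero⟩
  have cross : ∀ {s t : List Gen} {i j : ℕ}, (∀ x ∈ s, neg A x ∧ ∃ a, key A x = toLex (i, a)) →
      (∀ x ∈ t, neg A x ∧ ∃ a, key A x = toLex (j, a)) → i < j →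
      ∀ x ∈ s, ∀ y ∈ t, prec A x y := by
    intro s t i j hs ht hij x hx y hy
    obtain ⟨-, a, ha⟩ := hs x hx
    obtain ⟨-, b, hb⟩ := ht y hy
    exact prec_of_lt ha hb hij
  have pw_r : ∀ (r : Fin 2) (x : Gen), (List.replicate (r : ℕ) x).Pairwise (prec A) := by
    intro r x
    fin_cases r <;> simp
  refine ⟨?_, ?_⟩
  · simp only [Term.word, List.mem_append]
    rintro x (((((((h | h) | h) | h) | h) | h) | h) | h)
    exacts [(mem_l x h).1, (mem_h x h).1, (mem_a x h).1, (mem_b x h).1, (mem_k x h).1,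
      (mem_1 x h).1, (mem_2 x h).1, (mem_3 x h).1]
  · simp only [Term.word, List.pairwise_append, List.mem_append]
    refine ⟨⟨⟨⟨⟨⟨⟨?_, ?_, ?_⟩, ?_, ?_⟩, ?_, ?_⟩, ?_, ?_⟩, pw_r _ _, ?_⟩, pw_r _ _, ?_⟩,
      pw_r _ _, ?_⟩
    · rw [List.pairwise_map]
      refine (Multiset.pairwise_sort X.l (· ≥ ·)).imp_of_mem fun {i j} hi hj hij => ?_
      have hi := X.two_le_l i ((Multiset.mem_sort _).1 hi)
      have hj := X.two_le_l j ((Multiset.mem_sort _).1 hj)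
      rcases eq_or_lt_of_le hij with rfl | hij
      · exact .inr ⟨rfl, rfl⟩
      · left
        rw [key_L hi, key_L hj, Prod.Lex.toLex_lt_toLex]
        exact .inr ⟨rfl, by simpa using hij⟩
    · rw [List.pairwise_map]
      refine (Multiset.pairwise_sort X.h (· ≥ ·)).imp_of_mem fun {i j} hi hj hij => ?_
      rcases eq_or_lt_of_le hij with rfl | hij
      · exact .inr ⟨rfl, rfl⟩
      · left
        rw [key, key, Prod.Lex.toLex_lt_toLex]
        exact .inr ⟨rfl, by simpa using hij⟩
    · exact cross mem_l mem_h (by norm_num)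
    · rw [List.pairwise_map]
      refine (Finset.sortedGT_sort X.a).pairwise.imp_of_mem fun {i j} hi hj hij => ?_
      have hi := X.two_le_a i ((Finset.mem_sort _).1 hi)
      have hj := X.two_le_a j ((Finset.mem_sort _).1 hj)
      left
      rw [key_A hi, key_A hj, Prod.Lex.toLex_lt_toLex]
      exact .inr ⟨rfl, by simpa using hij⟩
    · rintro x (h | h)
      exacts [cross mem_l mem_a (by norm_num) x h, cross mem_h mem_a (by norm_num) x h]
    · rw [List.pairwise_map]
      refine (Finset.sortedGT_sort X.b).pairwise.imp_of_mem fun {i j} hi hj hij => ?_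
      have hi := X.two_le_b i ((Finset.mem_sort _).1 hi)
      have hj := X.two_le_b j ((Finset.mem_sort _).1 hj)
      left
      rw [key_B hi, key_B hj, Prod.Lex.toLex_lt_toLex]
      exact .inr ⟨rfl, by simpa using hij⟩
    · rintro x ((h | h) | h)
      exacts [cross mem_l mem_b (by norm_num) x h, cross mem_h mem_b (by norm_num) x h,
        cross mem_a mem_b (by norm_num) x h]
    · rw [List.pairwise_replicate]
      exact .inr (.inr ⟨rfl, rfl⟩)
    · rintro x (((h | h) | h) | h)
      exacts [cross mem_l mem_k (by norm_num) x h, cross mem_h mem_k (by norm_num) x h,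
        cross mem_a mem_k (by norm_num) x h, cross mem_b mem_k (by norm_num) x h]
    · rintro x ((((h | h) | h) | h) | h)
      exacts [cross mem_l mem_1 (by norm_num) x h, cross mem_h mem_1 (by norm_num) x h,
        cross mem_a mem_1 (by norm_num) x h, cross mem_b mem_1 (by norm_num) x h,
        cross mem_k mem_1 (by norm_num) x h]
    · rintro x (((((h | h) | h) | h) | h) | h)
      exacts [cross mem_l mem_2 (by norm_num) x h, cross mem_h mem_2 (by norm_num) x h,
        cross mem_a mem_2 (by norm_num) x h, cross mem_b mem_2 (by norm_num) x h,
        cross mem_k mem_2 (by norm_num) x h, cross mem_1 mem_2 (by norm_num) x h]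
    · rintro x ((((((h | h) | h) | h) | h) | h) | h)
      exacts [cross mem_l mem_3 (by norm_num) x h, cross mem_h mem_3 (by norm_num) x h,
        cross mem_a mem_3 (by norm_num) x h, cross mem_b mem_3 (by norm_num) x h,
        cross mem_k mem_3 (by norm_num) x h, cross mem_1 mem_3 (by norm_num) x h,
        cross mem_2 mem_3 (by norm_num) x h]

/-- The (negated) modes of `L` in a term. -/
def Term.modesL (X : Term) : Multiset ℕ := X.l + Multiset.replicate X.k 1
/-- The (negated) modes of `A` in a term. -/
def Term.modesA (X : Term) : Multiset ℕ := X.a.val + Multiset.replicate X.r₁ 1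
/-- The (negated) modes of `B` in a term. -/
def Term.modesB (X : Term) : Multiset ℕ :=
  X.b.val + Multiset.replicate X.r₂ 1 + Multiset.replicate X.r₃ 0

theorem Term.coe_word (X : Term) : (X.word A : Multiset Gen) =
    X.modesL.map (fun i : ℕ => Gen.L (-(i : ℤ))) + X.h.map (fun i : ℕ => Gen.H (-(i : ℤ))) +
    X.modesA.map (fun i : ℕ => A.gen (-(i : ℤ))) +
    X.modesB.map (fun i : ℕ => A.other.gen (-(i : ℤ))) := by
  simp only [Term.word, modesL, modesA, modesB, ← Multiset.coe_add, ← Multiset.map_coe,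
    Multiset.sort_eq, Finset.sort_eq, Multiset.map_add, Multiset.map_replicate,
    Multiset.coe_replicate, Nat.cast_one, Nat.cast_zero, neg_zero]
  abel

theorem neg_cases {x : Gen} (hx : neg A x) : (∃ i : ℕ, 1 ≤ i ∧ x = .L (-(i : ℤ))) ∨
    (∃ i : ℕ, 1 ≤ i ∧ x = .H (-(i : ℤ))) ∨ (∃ i : ℕ, 1 ≤ i ∧ x = A.gen (-(i : ℤ))) ∨
    (∃ i : ℕ, x = A.other.gen (-(i : ℤ))) := by
  cases x with
  | L m => exact .inl ⟨(-m).toNat, by simp only [neg] at hx; omega, by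
      congr 1; simp only [neg] at hx; omega⟩
  | H m => exact .inr (.inl ⟨(-m).toNat, by simp only [neg] at hx; omega, by
      congr 1; simp only [neg] at hx; omega⟩)
  | G m =>
    cases A <;> simp only [neg] at hx
    · exact .inr (.inr (.inl ⟨(-m).toNat, by omega, by
        simp only [Fermion.gen]; congr 1; omega⟩))
    · exact .inr (.inr (.inr ⟨(-m).toNat, by
        simp only [Fermion.gen, Fermion.other]; congr 1; omega⟩))
  | Q m =>
    cases A <;> simp only [neg] at hx
    · exact .inr (.inr (.inr ⟨(-m).toNat, by
        simp only [Fermion.gen, Fermion.other]; congr 1; omega⟩))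
    · exact .inr (.inr (.inl ⟨(-m).toNat, by omega, by
        simp only [Fermion.gen]; congr 1; omega⟩))
  | C => exact hx.elim

theorem fin_two_eq_zero {r : Fin 2} (h : (r : ℕ) = 0 ∨ r ≠ 1) : r = 0 := by
  fin_cases r <;> simp_all

/-- Every sorted word is the word of a standard monomial. -/
theorem exists_term {v : List Gen} (hv : Sorted A v) : ∃ X : Term, X.word A = v := by
  -- A sorted word is determined by its letters, so the order may be ignored while a term is
  -- assembled.
  suffices ∃ X : Term, (X.word A : Multiset Gen) = v by
    obtain ⟨X, hX⟩ := this
    exact ⟨X, X.word_sorted.eq_of_perm hv (Multiset.coe_eq_coe.1 hX)⟩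
  induction v with
  | nil =>
    refine ⟨Term.low 0 0 0 0, ?_⟩
    rw [Term.coe_word]
    simp [Term.low, Term.modesL, Term.modesA, Term.modesB]
  | cons x v ih =>
    obtain ⟨hx, hv⟩ := sorted_cons.1 hv
    obtain ⟨X, hX⟩ := ih hv
    -- An odd letter does not precede itself, so its exponent or its place in a `Finset` is still
    -- free.
    have hodd : x.odd = true → x ∉ (X.word A : Multiset Gen) := by
      intro ho hmem
      rw [hX] at hmem
      have := hx.2 x (by simpa using hmem)
      simp [prec, ho] at this
    rw [← Multiset.cons_coe, ← hX]
    rw [Term.coe_word] at hodd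
    rcases neg_cases hx.1 with ⟨i, hi, rfl⟩ | ⟨i, hi, rfl⟩ | ⟨i, hi, rfl⟩ | ⟨i, rfl⟩
    · by_cases h1 : i = 1
      · subst h1
        refine ⟨{ X with k := X.k + 1 }, ?_⟩
        simp [Term.coe_word, Term.modesL, Term.modesA, Term.modesB]
      · refine ⟨{ X with
          l := i ::ₘ X.l
          two_le_l := by
            intro j hj
            rcases Multiset.mem_cons.1 hj with rfl | hj
            exacts [by omega, X.two_le_l j hj] }, ?_⟩
        simp [Term.coe_word, Term.modesL, Term.modesA, Term.modesB]
    · refine ⟨{ X with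
          h := i ::ₘ X.h
          one_le_h := by
            intro j hj
            rcases Multiset.mem_cons.1 hj with rfl | hj
            exacts [by omega, X.one_le_h j hj] }, ?_⟩
      simp [Term.coe_word, Term.modesL, Term.modesA, Term.modesB]
    · have hodd := hodd (A.gen_odd _)
      by_cases h1 : i = 1
      · subst h1
        have h0 : X.r₁ = 0 := fin_two_eq_zero (.inr fun h => hodd (by simp [Term.modesA, h]))
        refine ⟨{ X with r₁ := 1 }, ?_⟩
        simp only [Term.coe_word, Term.modesL, Term.modesA, Term.modesB, h0]
        simp
        rw [← Multiset.singleton_add]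
        abel
      · have ha : i ∉ X.a := fun h => hodd (by
          simp only [Multiset.mem_add, Multiset.mem_map]
          exact .inl (.inr ⟨i, by simp [Term.modesA, h], rfl⟩))
        refine ⟨{ X with
          a := insert i X.a
          two_le_a := by
            intro j hj
            rcases Finset.mem_insert.1 hj with rfl | hj
            exacts [by omega, X.two_le_a j hj] }, ?_⟩
        simp [Term.coe_word, Term.modesL, Term.modesA, Term.modesB,
          Multiset.ndinsert_of_notMem (s := X.a.val) ha]
    · have hodd := hodd (A.other.gen_odd _)
      by_cases h0 : i = 0
      · subst h0
        have h0 : X.r₃ = 0 := fin_two_eq_zero (.inr fun h => hodd (by simp [Term.modesB, h]))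
        refine ⟨{ X with r₃ := 1 }, ?_⟩
        simp only [Term.coe_word, Term.modesL, Term.modesA, Term.modesB, h0]
        simp
        rw [← Multiset.singleton_add]
        abel
      by_cases h1 : i = 1
      · subst h1
        have h0 : X.r₂ = 0 := fin_two_eq_zero (.inr fun h => hodd (by simp [Term.modesB, h]))
        refine ⟨{ X with r₂ := 1 }, ?_⟩
        simp only [Term.coe_word, Term.modesL, Term.modesA, Term.modesB, h0]
        simp
        rw [← Multiset.singleton_add]
        abel
      · have ha : i ∉ X.b := fun h => hodd (by
          simp only [Multiset.mem_add, Multiset.mem_map]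
          exact .inr ⟨i, by simp [Term.modesB, h], rfl⟩)
        refine ⟨{ X with
          b := insert i X.b
          two_le_b := by
            intro j hj
            rcases Finset.mem_insert.1 hj with rfl | hj
            exacts [by omega, X.two_le_b j hj] }, ?_⟩
        simp [Term.coe_word, Term.modesL, Term.modesA, Term.modesB,
          Multiset.ndinsert_of_notMem (s := X.b.val) ha]

/-! ### Recovering a term from its word -/

/-- The modes of the letters selected by `p`, negated. -/
def modesOf (p : Gen → Option ℤ) (s : Multiset Gen) : Multiset ℕ :=
  s.filterMap fun x => (p x).map fun m => (-m).toNat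

/-- The mode of `L_m`. -/
def modeL : Gen → Option ℤ
  | .L m => some m
  | _ => none
/-- The mode of `H_m`. -/
def modeH : Gen → Option ℤ
  | .H m => some m
  | _ => none
/-- The mode of `G_m` or `Q_m`. -/
def Fermion.modeF : Fermion → Gen → Option ℤ
  | .G, .G m => some m
  | .Q, .Q m => some m
  | _, _ => none

theorem modesOf_add (p : Gen → Option ℤ) (s t : Multiset Gen) :
    modesOf p (s + t) = modesOf p s + modesOf p t := Multiset.filterMap_add _ _ _

theorem modesOf_map_some {p : Gen → Option ℤ} {f : ℕ → Gen} (h : ∀ i, p (f i) = some (-(i : ℤ)))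
    (s : Multiset ℕ) : modesOf p (s.map f) = s := by
  rw [modesOf, Multiset.filterMap_map]
  have : ((fun x => (p x).map fun m => (-m).toNat) ∘ f) = some := by
    funext i; simp [h]
  rw [this, Multiset.filterMap_some]

theorem modesOf_map_none {p : Gen → Option ℤ} {f : ℕ → Gen} (h : ∀ i, p (f i) = none)
    (s : Multiset ℕ) : modesOf p (s.map f) = 0 := by
  rw [modesOf, Multiset.filterMap_map]
  have : ((fun x => (p x).map fun m => (-m).toNat) ∘ f) = fun _ => none := by
    funext i; simp [h]
  rw [this]
  induction s using Multiset.induction with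
  | empty => rfl
  | cons a s ih => rw [Multiset.filterMap_cons_none _ _ rfl, ih]

theorem Term.modes_word (X : Term) : modesOf modeL (X.word A) = X.modesL ∧
    modesOf modeH (X.word A) = X.h ∧ modesOf A.modeF (X.word A) = X.modesA ∧
    modesOf A.other.modeF (X.word A) = X.modesB := by
  simp only [coe_word, modesOf_add]
  refine ⟨?_, ?_, ?_, ?_⟩
  · rw [modesOf_map_some (fun _ => rfl), modesOf_map_none (fun _ => rfl),
      modesOf_map_none (by cases A <;> intro _ <;> rfl),
      modesOf_map_none (by cases A <;> intro _ <;> rfl)]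
    simp
  · rw [modesOf_map_none (fun _ => rfl), modesOf_map_some (fun _ => rfl),
      modesOf_map_none (by cases A <;> intro _ <;> rfl),
      modesOf_map_none (by cases A <;> intro _ <;> rfl)]
    simp
  · rw [modesOf_map_none (by cases A <;> intro _ <;> rfl),
      modesOf_map_none (by cases A <;> intro _ <;> rfl),
      modesOf_map_some (by cases A <;> intro _ <;> rfl),
      modesOf_map_none (by cases A <;> intro _ <;> rfl)]
    simp
  · rw [modesOf_map_none (by cases A <;> intro _ <;> rfl),
      modesOf_map_none (by cases A <;> intro _ <;> rfl),
      modesOf_map_none (by cases A <;> intro _ <;> rfl),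
      modesOf_map_some (by cases A <;> intro _ <;> rfl)]
    simp

/-- The word determines the multiset of modes of each kind of letter. The multisets `l`, `a`, `b`
have entries at least 2, so the exponents `k`, `r₁`, `r₂`, `r₃` are read off from the multiplicities
of 1 and 0. -/
theorem Term.word_injective : Function.Injective (Term.word A) := by
  intro X Y h
  obtain ⟨hl, hh, ha, hb⟩ := X.modes_word (A := A)
  obtain ⟨hl', hh', ha', hb'⟩ := Y.modes_word (A := A)
  rw [h] at hl hh ha hb
  replace hl := hl.symm.trans hl'
  replace hh := hh.symm.trans hh'
  replace ha := ha.symm.trans ha'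
  replace hb := hb.symm.trans hb'
  have l1 : ∀ Z : Term, ∀ i < 2, Z.l.count i = 0 := fun Z i hi =>
    Multiset.count_eq_zero.2 fun hm => absurd (Z.two_le_l i hm) (by omega)
  have a1 : ∀ Z : Term, ∀ i < 2, Z.a.val.count i = 0 := fun Z i hi =>
    Multiset.count_eq_zero.2 fun hm => absurd (Z.two_le_a i hm) (by omega)
  have b1 : ∀ Z : Term, ∀ i < 2, Z.b.val.count i = 0 := fun Z i hi =>
    Multiset.count_eq_zero.2 fun hm => absurd (Z.two_le_b i hm) (by omega)
  have cl : ∀ i, X.modesL.count i = Y.modesL.count i := fun i => by rw [hl]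
  have ca : ∀ i, X.modesA.count i = Y.modesA.count i := fun i => by rw [ha]
  have cb : ∀ i, X.modesB.count i = Y.modesB.count i := fun i => by rw [hb]
  simp only [modesL, modesA, modesB, Multiset.count_add, Multiset.count_replicate] at cl ca cb
  have hk := cl 1
  have hr1 := ca 1
  have hr2 := cb 1
  have hr3 := cb 0
  rw [l1 X 1 (by omega), l1 Y 1 (by omega)] at hk
  rw [a1 X 1 (by omega), a1 Y 1 (by omega)] at hr1
  rw [b1 X 1 (by omega), b1 Y 1 (by omega)] at hr2
  rw [b1 X 0 (by omega), b1 Y 0 (by omega)] at hr3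
  have el : X.l = Y.l := by
    ext i
    have := cl i
    split_ifs at this with h
    · subst h; rw [l1 X 1 (by omega), l1 Y 1 (by omega)]
    · simpa using this
  have ea : X.a = Y.a := by
    rw [← Finset.val_inj]
    ext i
    have := ca i
    split_ifs at this with h
    · subst h; rw [a1 X 1 (by omega), a1 Y 1 (by omega)]
    · simpa using this
  have eb : X.b = Y.b := by
    rw [← Finset.val_inj]
    ext i
    by_cases hi : i < 2
    · rw [b1 X i hi, b1 Y i hi]
    · have := cb i
      rw [if_neg (by omega), if_neg (by omega), if_neg (by omega), if_neg (by omega)] at this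
      simpa using this
  cases X; cases Y
  simp only [Term.mk.injEq]
  simp at hk hr1 hr2 hr3
  exact ⟨el, hh, ea, eb, hk, Fin.ext hr1, Fin.ext hr2, Fin.ext hr3⟩

/-! ### Level and charge of words -/

/-- The level of a basis element: minus its mode. -/
def Gen.level : Gen → ℤ
  | .L m => -m
  | .H m => -m
  | .G m => -m
  | .Q m => -m
  | .C => 0

/-- The charge of a basis element. -/
def Gen.charge : Gen → ℤ
  | .G _ => 1
  | .Q _ => -1
  | _ => 0

theorem Gen.level_L (m : ℤ) : (Gen.L m).level = -m := rfl

theorem Gen.level_H (m : ℤ) : (Gen.H m).level = -m := rfl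

theorem Gen.charge_L (m : ℤ) : (Gen.L m).charge = 0 := rfl

theorem Gen.charge_H (m : ℤ) : (Gen.H m).charge = 0 := rfl

theorem Fermion.level_gen (F : Fermion) (m : ℤ) : (F.gen m).level = -m := by cases F <;> rfl

theorem Fermion.charge_gen (F : Fermion) (m : ℤ) : (F.gen m).charge = F.charge := by
  cases F <;> rfl

theorem sum_map_coe (f : Gen → ℤ) (v : List Gen) :
    (v.map f).sum = ((v : Multiset Gen).map f).sum := by simp

theorem sum_map_cast (s : Multiset ℕ) : (s.map fun i : ℕ => (i : ℤ)).sum = (s.sum : ℕ) := by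
  simp

theorem Term.level_word (X : Term) : ((X.word A).map Gen.level).sum = X.level := by
  rw [sum_map_coe, coe_word]
  simp only [Multiset.map_add, Multiset.sum_add, Multiset.map_map, Function.comp_def,
    Gen.level_L, Gen.level_H,
    Fermion.level_gen, neg_neg, sum_map_cast, modesL, modesA, modesB, Term.level,
    Multiset.sum_replicate, Finset.sum, Multiset.map_id']
  push_cast
  simp
  ring

theorem Term.charge_word (X : Term) : ((X.word A).map Gen.charge).sum = X.charge A := by
  rw [sum_map_coe, coe_word]
  simp only [Multiset.map_add, Multiset.sum_add, Multiset.map_map, Function.comp_def,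
    Gen.charge_L, Gen.charge_H,
    Fermion.charge_gen, Multiset.map_const', Multiset.sum_replicate, modesL, modesA, modesB,
    Term.charge, Multiset.card_replicate, smul_zero, zero_add]
  simp
  ring

/-! ### The filtration -/

/-- The filtration degree of a basis element; `L_{-1}` has degree `2`. -/
def Gen.deg : Gen → ℤ
  | .L m => if m = -1 then 2 else 1
  | .H _ => 0
  | .G _ => 1
  | .Q _ => 1
  | .C => 0

theorem Gen.deg_nonneg (x : Gen) : 0 ≤ x.deg := by
  cases x <;> simp only [Gen.deg] <;> (try split_ifs) <;> norm_num

theorem Fermion.deg_gen (F : Fermion) (m : ℤ) : (F.gen m).deg = 1 := by cases F <;> rfl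

/-- The filtration degree of a word. -/
def wdeg (v : List Gen) : ℤ := (v.map Gen.deg).sum

/-- The level of a word. -/
def wlevel (v : List Gen) : ℤ := (v.map Gen.level).sum

theorem wdeg_cons (x : Gen) (v : List Gen) : wdeg (x :: v) = x.deg + wdeg v := by simp [wdeg]

theorem wlevel_cons (x : Gen) (v : List Gen) : wlevel (x :: v) = x.level + wlevel v := by
  simp [wlevel]

theorem level_nonneg {x : Gen} (hx : neg A x) : 0 ≤ x.level := by
  rcases neg_cases hx with ⟨i, hi, rfl⟩ | ⟨i, hi, rfl⟩ | ⟨i, hi, rfl⟩ | ⟨i, rfl⟩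
  · rw [Gen.level_L]; omega
  · rw [Gen.level_H]; omega
  · rw [Fermion.level_gen]; omega
  · rw [Fermion.level_gen]; omega

theorem wlevel_nonneg {v : List Gen} (hv : Sorted A v) : 0 ≤ wlevel v := by
  induction v with
  | nil => simp [wlevel]
  | cons x v ih =>
    obtain ⟨hx, hv⟩ := sorted_cons.1 hv
    rw [wlevel_cons]
    have := level_nonneg hx.1
    have := ih hv
    omega

/-- This is what allows `L_{-1}` to have degree 2: it arises only from two `L` or from two opposite
fermions, all of degree at least 1. -/
theorem deg_bracket (x y : Gen) : ∀ z ∈ (bracket x y).support, z.deg ≤ x.deg + y.deg := by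
  intro z h
  have h1 := x.deg_nonneg
  have h2 := y.deg_nonneg
  contrapose! h
  rw [Finsupp.notMem_support_iff]
  cases x <;> cases y <;> cases z <;> simp_all [bracket, Gen.deg] <;>
    split_ifs at * <;> omega

theorem level_bracket (x y : Gen) : ∀ z ∈ (bracket x y).support, z.level = x.level + y.level := by
  intro z h
  contrapose! h
  rw [Finsupp.notMem_support_iff]
  cases x <;> cases y <;> cases z <;> simp only [bracket, Finsupp.coe_add,
    Finsupp.coe_smul, Finsupp.coe_neg, Finsupp.coe_zero, Finsupp.coe_sub, Pi.add_apply,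
    Pi.smul_apply, Pi.neg_apply, Pi.zero_apply, Pi.sub_apply, Finsupp.single_apply, reduceCtorEq,
    if_false, smul_zero, add_zero, sub_zero, neg_zero, Gen.L.injEq, Gen.H.injEq, Gen.G.injEq,
    Gen.Q.injEq, Gen.level, delta] at h ⊢ <;> split_ifs <;> first | omega | simp

theorem hw_weight {wt : Gen → ℤ} (hL : wt (.L 0) = 0 ∨ 0 ≤ wt (.L 0)) (hH : 0 ≤ wt (.H 0))
    (hC : 0 ≤ wt .C) (x : Gen) (h : hw Δ q c x ≠ 0) : 0 ≤ wt x := by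
  have hL : 0 ≤ wt (.L 0) := by omega
  cases x <;> simp only [hw] at h
  case L m => split_ifs at h with h0 <;> simp_all
  case H m => split_ifs at h with h0 <;> simp_all
  case C => exact hC
  all_goals simp at h

/-- Sorting an arbitrary word never raises a subadditive weight. Applied to the level it kills
vectors of negative level, applied to the degree it makes the filtration visible in coordinates. -/
theorem coord_weight {wt : Gen → ℤ}
    (hwt : ∀ x y, ∀ z ∈ (bracket x y).support, wt z ≤ wt x + wt y)
    (hlam : ∀ x, hw Δ q c x ≠ 0 → 0 ≤ wt x) {v v' : List Gen}
    (h : v' ∈ (coord A Δ q c (wv A Δ q c v)).support) : (v'.map wt).sum ≤ (v.map wt).sum := by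
  induction v generalizing v' with
  | nil =>
    rw [wv, coord_hwv] at h
    obtain rfl := Finset.mem_singleton.1 (Finsupp.support_single_subset h)
    simp
  | cons x v ih =>
    rw [wv, coord_of_smul, rho] at h
    obtain ⟨u, hu, hu'⟩ := Finsupp.exists_mem_support_of_linearCombination h
    have h1 := ih hu
    have h2 := act_weight hwt hlam hu'
    simp only [List.map_cons, List.sum_cons]
    omega

theorem wv_eq_zero_of_level {v : List Gen} (h : wlevel v < 0) : wv A Δ q c v = 0 := by
  apply coord_injective
  rw [map_zero, ← Finsupp.support_eq_empty, Finset.eq_empty_iff_forall_notMem]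
  intro u hu
  have h1 := wlevel_nonneg (sorted_of_mem_words (coord_mem_words _) hu)
  have h2 := coord_weight (wt := Gen.level) (fun x y z hz => (level_bracket x y z hz).le)
    (hw_weight (by simp [Gen.level]) (by simp [Gen.level]) (by simp [Gen.level])) hu
  simp only [wlevel] at *
  omega

variable (A Δ q c) in
/-- The span of the words of filtration degree at most `d`. -/
def Filt (d : ℤ) : Submodule ℂ (Verma A Δ q c) :=
  Submodule.span ℂ {u | ∃ v : List Gen, wdeg v ≤ d ∧ wv A Δ q c v = u}

theorem wv_mem_Filt {v : List Gen} {d : ℤ} (h : wdeg v ≤ d) :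
    wv A Δ q c v ∈ Filt A Δ q c d := Submodule.subset_span ⟨v, h, rfl⟩

theorem Filt_mono {d d' : ℤ} (h : d ≤ d') {u : Verma A Δ q c} (hu : u ∈ Filt A Δ q c d) :
    u ∈ Filt A Δ q c d' := by
  refine Submodule.span_mono ?_ hu
  rintro _ ⟨v, hv, rfl⟩
  exact ⟨v, hv.trans h, rfl⟩

theorem of_smul_mem_Filt {d d' : ℤ} {x : Gen} {u : Verma A Δ q c} (hu : u ∈ Filt A Δ q c d)
    (h : x.deg + d ≤ d') : U.of x • u ∈ Filt A Δ q c d' := by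
  refine Filt_mono h ?_
  induction hu using Submodule.span_induction with
  | mem u hu =>
    obtain ⟨v, hv, rfl⟩ := hu
    exact wv_mem_Filt (v := x :: v) (by rw [wdeg_cons]; omega)
  | zero => rw [smul_zero]; exact zero_mem _
  | add u v _ _ hu hv => rw [smul_add]; exact add_mem hu hv
  | smul r u _ hu => rw [smul_comm]; exact Submodule.smul_mem _ r hu

/-- The filtration is defined by all words, so that letters act on it without sorting. Together with
`mem_Filt_of_support` this shows that sorted words of bounded degree span the same subspace. -/
theorem wdeg_le_of_mem_Filt {d : ℤ} {u : Verma A Δ q c} (hu : u ∈ Filt A Δ q c d) {v : List Gen}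
    (hv : v ∈ (coord A Δ q c u).support) : wdeg v ≤ d := by
  classical
  induction hu using Submodule.span_induction with
  | mem u hu =>
    obtain ⟨w, hw', rfl⟩ := hu
    exact (coord_weight deg_bracket
      (hw_weight (by simp [Gen.deg]) (by simp [Gen.deg]) (by simp [Gen.deg])) hv).trans hw'
  | zero => simp at hv
  | add u w _ _ hu hw =>
    rw [map_add] at hv
    rcases Finset.mem_union.1 (Finsupp.support_add hv) with h | h
    exacts [hu h, hw h]
  | smul r u _ hu =>
    rw [map_smul] at hv
    exact hu (Finsupp.support_smul hv)

theorem coord_eq_zero_of_mem_Filt {d : ℤ} {u : Verma A Δ q c} (hu : u ∈ Filt A Δ q c d)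
    {v : List Gen} (hv : d < wdeg v) : coord A Δ q c u v = 0 := by
  by_contra h
  exact absurd (wdeg_le_of_mem_Filt hu (Finsupp.mem_support_iff.2 h)) (by omega)

theorem mem_Filt_of_support {d : ℤ} {u : Verma A Δ q c}
    (h : ∀ v ∈ (coord A Δ q c u).support, wdeg v ≤ d) : u ∈ Filt A Δ q c d := by
  rw [← ofCoord_coord u, ofCoord, Finsupp.linearCombination_apply]
  exact Submodule.sum_mem _ fun v hv => Submodule.smul_mem _ _ (wv_mem_Filt (h v hv))

/-! ### Commutators -/

variable (A Δ q c) in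
/-- An element of the superalgebra acting on a vector. -/
def lin (α : Gen →₀ ℂ) (u : Verma A Δ q c) : Verma A Δ q c :=
  Finsupp.linearCombination ℂ (fun z => U.of z • u) α

theorem of_smul_of_smul (x y : Gen) (u : Verma A Δ q c) :
    U.of x • U.of y • u = eps x y • U.of y • U.of x • u + lin A Δ q c (bracket x y) u := by
  rw [← mul_smul, of_mul_of, add_smul, smul_assoc, mul_smul, lin]
  congr 1
  simp only [Finsupp.linearCombination_apply, Finsupp.sum, Finset.sum_smul, smul_assoc]

theorem lin_mem_Filt {α : Gen →₀ ℂ} {k d d' : ℤ} (h : ∀ z ∈ α.support, z.deg ≤ k)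
    {u : Verma A Δ q c} (hu : u ∈ Filt A Δ q c d) (hd : k + d ≤ d') :
    lin A Δ q c α u ∈ Filt A Δ q c d' := by
  rw [lin, Finsupp.linearCombination_apply]
  refine Submodule.sum_mem _ fun z hz => Submodule.smul_mem _ _ (of_smul_mem_Filt hu ?_)
  have := h z hz
  omega

theorem lin_sub_smul (α : Gen →₀ ℂ) (r : ℂ) (x : Gen) (u : Verma A Δ q c) :
    lin A Δ q c (α - r • e x) u = lin A Δ q c α u - r • U.of x • u := by
  simp [lin]

theorem deg_bracket_L_neg_one (x : Gen) :
    ∀ z ∈ (bracket x (.L (-1))).support, z.deg ≤ x.deg + 1 := by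
  intro z h
  contrapose! h
  rw [Finsupp.notMem_support_iff]
  cases x <;> cases z <;> simp_all [bracket, Gen.deg] <;>
    split_ifs at * <;> omega

variable (A Δ q c) in
/-- The action of `L_{-1}`. -/
abbrev tt (u : Verma A Δ q c) : Verma A Δ q c := U.of (.L (-1)) • u

/-- The product has degree `x.deg + 2 + d`, the commutator at most one less: `L_{-1}` is central to
leading order and plays the part of a scalar. -/
theorem tt_comm {d d' : ℤ} (x : Gen) {u : Verma A Δ q c} (hu : u ∈ Filt A Δ q c d)
    (h : x.deg + d + 1 ≤ d') :
    U.of x • tt A Δ q c u - tt A Δ q c (U.of x • u) ∈ Filt A Δ q c d' := by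
  rw [tt, of_smul_of_smul]
  have : eps x (.L (-1)) = 1 := by simp [eps, Gen.odd]
  rw [this, one_smul, add_sub_cancel_left]
  exact lin_mem_Filt (deg_bracket_L_neg_one x) hu (by omega)

theorem neg_L_neg_one : neg A (.L (-1)) := by simp [neg]

/-- Multiplication by `L_{-1}` inserts a letter, up to terms of lower degree. -/
theorem exists_tt_wv {w : List Gen} (hw : Sorted A w) : ∃ w', Sorted A w' ∧
    w'.Perm (.L (-1) :: w) ∧
    tt A Δ q c (wv A Δ q c w) - wv A Δ q c w' ∈ Filt A Δ q c (wdeg w + 1) := by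
  induction w with
  | nil =>
    refine ⟨[.L (-1)], sorted_cons.2 ⟨⟨neg_L_neg_one, by simp⟩, hw⟩, .refl _, ?_⟩
    simp [wv]
  | cons x w ih =>
    by_cases hf : fits A (.L (-1)) (x :: w)
    · exact ⟨.L (-1) :: x :: w, sorted_cons.2 ⟨hf, hw⟩, .refl _, by simp [wv]⟩
    · obtain ⟨hx, hw1⟩ := sorted_cons.1 hw
      obtain ⟨w', hs, hp, hm⟩ := ih hw1
      have hnp := not_prec_of_not_fits hw hf neg_L_neg_one
      have hne : Gen.L (-1) ≠ x := by
        rintro rfl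
        exact hnp (.inr ⟨rfl, rfl⟩)
      refine ⟨x :: w', sorted_cons.2 ⟨⟨hx.1, fun y hy => ?_⟩, hs⟩,
        (hp.cons x).trans (List.Perm.swap _ _ _), ?_⟩
      · rcases List.mem_cons.1 (hp.subset hy) with rfl | hy
        · exact prec_total neg_L_neg_one hx.1 hne hnp
        · exact hx.2 y hy
      · have h1 := tt_comm x (wv_mem_Filt (A := A) (Δ := Δ) (q := q) (c := c) (le_refl (wdeg w)))
          (d' := wdeg (x :: w) + 1) (by rw [wdeg_cons])
        have h2 := of_smul_mem_Filt (x := x) hm (d' := wdeg (x :: w) + 1) (by rw [wdeg_cons]; omega)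
        have := sub_mem h2 h1
        rw [smul_sub] at this
        simp only [wv]
        convert this using 1
        abel

/-! ### Symbols -/

/-- The coefficient in the leading term of the action of an operator on a word. -/
def mu (ε δ : Gen → ℂ) : List Gen → ℂ
  | [] => 0
  | x :: v => ε x * mu ε δ v + δ x

theorem mu_eq_zero {ε δ : Gen → ℂ} {x₀ : Gen} (hδ : ∀ x, x ≠ x₀ → δ x = 0) {v : List Gen}
    (h : x₀ ∉ v) : mu ε δ v = 0 := by
  induction v with
  | nil => rfl
  | cons x v ih =>
    rw [List.mem_cons, not_or] at h
    rw [mu, ih h.2, hδ x (Ne.symm h.1), mul_zero, add_zero]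

/-- An odd letter occurs only once in a sorted word, so a single contribution survives and signs
cannot cancel. -/
theorem mu_ne_zero_of_odd {ε δ : Gen → ℂ} {x₀ : Gen} (hδ : ∀ x, x ≠ x₀ → δ x = 0)
    (h₀ : δ x₀ ≠ 0) (hε : ∀ x, ε x ≠ 0) (hodd : x₀.odd = true) {v : List Gen} (hv : Sorted A v)
    (h : x₀ ∈ v) : mu ε δ v ≠ 0 := by
  induction v with
  | nil => simp at h
  | cons x v ih =>
    obtain ⟨hx, hv⟩ := sorted_cons.1 hv
    by_cases hxx : x = x₀
    · subst hxx
      have : x ∉ v := fun hm => by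
        have := hx.2 x hm
        simp [prec, hodd] at this
      rw [mu, mu_eq_zero hδ this, mul_zero, zero_add]
      exact h₀
    · rw [mu, hδ x hxx, add_zero]
      refine mul_ne_zero (hε x) (ih hv ?_)
      rcases List.mem_cons.1 h with h | h
      exacts [absurd h.symm hxx, h]

/-- Without signs, the coefficient is the multiplicity of `x₀` times `δ x₀`. -/
theorem mu_ne_zero_of_even {ε δ : Gen → ℂ} {x₀ : Gen} (hδ : ∀ x, x ≠ x₀ → δ x = 0)
    (h₀ : δ x₀ ≠ 0) (hε : ∀ x, ε x = 1) {v : List Gen} (h : x₀ ∈ v) : mu ε δ v ≠ 0 := by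
  have : ∀ v, mu ε δ v = v.count x₀ * δ x₀ := by
    intro v
    induction v with
    | nil => simp [mu]
    | cons x v ih =>
      rw [mu, ih, hε, one_mul, List.count_cons]
      by_cases hx : x = x₀
      · subst hx; simp; ring
      · simp [hx, hδ x hx]
  rw [this]
  exact mul_ne_zero (by simpa [List.count_eq_zero] using h) h₀

/-- Equal letters of a sorted word are adjacent. This lets the contributions of several copies of
`x₀` be collected on one word in `symbol`. -/
theorem cons_erase_of_mem {x : Gen} {v : List Gen} (hv : Sorted A (x :: v)) (h : x ∈ v) :
    x :: v.erase x = v := by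
  cases v with
  | nil => simp at h
  | cons y w =>
    have : x = y := by
      by_contra hne
      have hxw : x ∈ w := by
        rcases List.mem_cons.1 h with h | h
        exacts [absurd h hne, h]
      have h1 := (sorted_cons.1 hv).1.2 y (by simp)
      have h2 := (sorted_cons.1 (sorted_cons.1 hv).2).1.2 x hxw
      rcases h1 with h1 | h1
      · rcases h2 with h2 | h2
        · exact lt_irrefl _ (h1.trans h2)
        · exact hne h2.1.symm
      · exact hne h1.1
    subst this
    simp

theorem wdeg_erase {x : Gen} {v : List Gen} (h : x ∈ v) : wdeg (v.erase x) = wdeg v - x.deg := by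
  have := (List.perm_cons_erase h).map Gen.deg
  have := this.sum_eq
  simp only [List.map_cons, List.sum_cons] at this
  simp only [wdeg]
  omega

/-- The symbol of an operator that supercommutes with all letters except `x₀`, up to terms of lower
degree. -/
theorem symbol {Γ : U} {ε δ : Gen → ℂ} {x₀ : Gen} {good : Gen → Prop} {M : ℤ}
    (hδ : ∀ x, x ≠ x₀ → δ x = 0)
    (h : ∀ x v, good x → Sorted A (x :: v) → wlevel (x :: v) ≤ M →
      Γ • U.of x • wv A Δ q c v - ε x • U.of x • Γ • wv A Δ q c v
        - δ x • tt A Δ q c (wv A Δ q c v) ∈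
        Filt A Δ q c (wdeg (x :: v) + (2 - x₀.deg) - 1))
    {v : List Gen} (hv : Sorted A v) (hg : ∀ x ∈ v, good x) (hM : wlevel v ≤ M) :
    Γ • wv A Δ q c v - mu ε δ v • tt A Δ q c (wv A Δ q c (v.erase x₀))
      - (v.map ε).prod • (v.map U.of).prod • Γ • hwv A Δ q c ∈
      Filt A Δ q c (wdeg v + (2 - x₀.deg) - 1) := by
  induction v with
  | nil =>
    have : Γ • wv A Δ q c [] - mu ε δ [] • tt A Δ q c (wv A Δ q c ([].erase x₀))
      - (([] : List Gen).map ε).prod • (([] : List Gen).map U.of).prod • Γ • hwv A Δ q c = 0 := by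
      simp [mu, wv]
    rw [this]
    exact zero_mem _
  | cons x v ih =>
    have h1 := h x v (hg x (by simp)) hv hM
    obtain ⟨hx, hv'⟩ := sorted_cons.1 hv
    have hl := level_nonneg hx.1
    have h2 := ih hv' (fun y hy => hg y (by simp [hy])) (by rw [wlevel_cons] at hM; omega)
    have h3 := of_smul_mem_Filt (x := x) h2 (d' := wdeg (x :: v) + (2 - x₀.deg) - 1)
      (by rw [wdeg_cons]; omega)
    -- The `L_{-1}` created further to the right is carried to the front, which costs only lower
    -- degree.
    have h4 : mu ε δ v • (U.of x • tt A Δ q c (wv A Δ q c (v.erase x₀)) -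
        tt A Δ q c (U.of x • wv A Δ q c (v.erase x₀))) ∈
        Filt A Δ q c (wdeg (x :: v) + (2 - x₀.deg) - 1) := by
      by_cases hm : x₀ ∈ v
      · refine Submodule.smul_mem _ _ (tt_comm x (wv_mem_Filt le_rfl) ?_)
        rw [wdeg_erase hm, wdeg_cons]
        omega
      · rw [mu_eq_zero hδ hm, zero_smul]
        exact zero_mem _
    have h5 : mu ε δ (x :: v) • tt A Δ q c (wv A Δ q c ((x :: v).erase x₀)) =
        (ε x * mu ε δ v) • tt A Δ q c (U.of x • wv A Δ q c (v.erase x₀)) +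
          δ x • tt A Δ q c (wv A Δ q c v) := by
      rw [mu]
      by_cases hxx : x = x₀
      · subst hxx
        rw [List.erase_cons_head]
        by_cases hm : x ∈ v
        · have : U.of x • wv A Δ q c (v.erase x) = wv A Δ q c v := by
            conv_rhs => rw [← cons_erase_of_mem hv hm]
            rfl
          rw [this, add_smul]
        · rw [mu_eq_zero hδ hm]
          simp
      · rw [hδ x hxx, List.erase_cons_tail (by simpa using hxx)]
        simp [wv]
    have h6 := add_mem h1 (add_mem (Submodule.smul_mem _ (ε x) h3) (Submodule.smul_mem _ (ε x) h4))
    rw [h5, List.map_cons, List.map_cons, List.prod_cons, List.prod_cons]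
    convert h6 using 1
    simp only [wv, smul_sub, mul_smul, smul_comm (_ : ℂ) (U.of x), smul_comm (_ : ℂ) (U.of (.L (-1)))]
    abel

/-- If an operator with symbol as above lowers the degree of `Ψ`, then the letter `x₀` does not
occur in the leading terms of `Ψ`. -/
theorem not_mem_of_symbol {Γ : U} {ε δ : Gen → ℂ} {x₀ : Gen} (hδ : ∀ x, x ≠ x₀ → δ x = 0)
    {Ψ : Verma A Δ q c} {d : ℤ} (hd : ∀ v ∈ (coord A Δ q c Ψ).support, wdeg v ≤ d)
    (hΓ : ∀ d' u, u ∈ Filt A Δ q c d' → Γ • u ∈ Filt A Δ q c (d' + (2 - x₀.deg)))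
    (hΨ : Γ • Ψ ∈ Filt A Δ q c (d + (2 - x₀.deg) - 1))
    (R : List Gen → Verma A Δ q c)
    (hs : ∀ v ∈ (coord A Δ q c Ψ).support, wdeg v = d →
      Γ • wv A Δ q c v - mu ε δ v • tt A Δ q c (wv A Δ q c (v.erase x₀)) - R v ∈
        Filt A Δ q c (wdeg v + (2 - x₀.deg) - 1))
    (hR : ∀ v ∈ (coord A Δ q c Ψ).support, wdeg v = d → ∀ v₀ ∈ (coord A Δ q c Ψ).support,
      x₀ ∈ v₀ → ∀ w, w.Perm (.L (-1) :: v₀.erase x₀) → coord A Δ q c (R v) w = 0)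
    {v₀ : List Gen} (hv₀ : v₀ ∈ (coord A Δ q c Ψ).support) (hd₀ : wdeg v₀ = d)
    (hmu : mu ε δ v₀ ≠ 0) : x₀ ∉ v₀ := by
  intro hmem
  have hsort : ∀ v ∈ (coord A Δ q c Ψ).support, Sorted A v := fun v hv =>
    sorted_of_mem_words (coord_mem_words Ψ) hv
  have herase : ∀ v, Sorted A v → Sorted A (v.erase x₀) := fun v hv =>
    ⟨fun x hx => hv.1 x (List.mem_of_mem_erase hx), hv.2.sublist List.erase_sublist⟩
  -- The word `w₀` is `v₀` with one `x₀` replaced by `L_{-1}`. Its degree is too high for `Γ • Ψ`,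
  -- but its coefficient there will turn out to be that of `v₀` times the symbol.
  obtain ⟨w₀, hw₀, hp₀, ht₀⟩ := exists_tt_wv (Δ := Δ) (q := q) (c := c) (herase v₀ (hsort v₀ hv₀))
  have hdeg₀ : wdeg w₀ = d + (2 - x₀.deg) := by
    have := (hp₀.map Gen.deg).sum_eq
    have h2 := wdeg_erase hmem
    simp only [List.map_cons, List.sum_cons] at this
    have h3 : (Gen.L (-1)).deg = 2 := by simp [Gen.deg]
    simp only [wdeg] at *
    omega
  have hzero : coord A Δ q c (Γ • Ψ) w₀ = 0 := coord_eq_zero_of_mem_Filt hΨ (by omega)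
  have hexp : Γ • Ψ = ∑ v ∈ (coord A Δ q c Ψ).support, coord A Δ q c Ψ v • Γ • wv A Δ q c v := by
    conv_lhs => rw [← ofCoord_coord Ψ, ofCoord, Finsupp.linearCombination_apply, Finsupp.sum]
    rw [Finset.smul_sum]
    exact Finset.sum_congr rfl fun v _ => smul_comm _ _ _
  -- Only `v₀` contributes to `w₀`: words of lower degree cannot reach it, and among leading words
  -- the replacement of `x₀` by `L_{-1}` is injective up to permutation, hence on sorted words.
  have hcoef : ∀ v ∈ (coord A Δ q c Ψ).support,
      coord A Δ q c (Γ • wv A Δ q c v) w₀ = if v = v₀ then mu ε δ v₀ else 0 := by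
    intro v hv
    rcases lt_or_eq_of_le (hd v hv) with hlt | heq
    · rw [if_neg (by rintro rfl; omega)]
      exact coord_eq_zero_of_mem_Filt (hΓ _ _ (wv_mem_Filt le_rfl)) (by omega)
    · have h1 := coord_eq_zero_of_mem_Filt (hs v hv heq) (v := w₀) (by omega)
      rw [map_sub, map_sub, (coord A Δ q c).map_smul (mu ε δ v), Finsupp.sub_apply, Finsupp.sub_apply,
        hR v hv heq v₀ hv₀ hmem w₀ hp₀, sub_zero, sub_eq_zero] at h1
      rw [h1, Finsupp.smul_apply, smul_eq_mul]
      by_cases hm : x₀ ∈ v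
      · obtain ⟨w, hw, hp, ht⟩ := exists_tt_wv (Δ := Δ) (q := q) (c := c) (herase v (hsort v hv))
        have h2 := coord_eq_zero_of_mem_Filt ht (v := w₀) (by rw [wdeg_erase hm]; omega)
        rw [map_sub, Finsupp.sub_apply, sub_eq_zero, coord_wv hw] at h2
        rw [h2, Finsupp.single_apply]
        by_cases hvv : v = v₀
        · subst hvv
          rw [if_pos (hw.eq_of_perm hw₀ (hp.trans hp₀.symm)), if_pos rfl, mul_one]
        · rw [if_neg, if_neg hvv, mul_zero]
          rintro rfl
          refine hvv ((hsort v hv).eq_of_perm (hsort v₀ hv₀) ?_)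
          have h3 := (hp.symm.trans hp₀).cons_inv
          exact (List.perm_cons_erase hm).trans ((h3.cons x₀).trans (List.perm_cons_erase hmem).symm)
      · rw [mu_eq_zero hδ hm, zero_mul, if_neg]
        rintro rfl
        exact hm hmem
  rw [hexp, map_sum, Finsupp.finsetSum_apply] at hzero
  have : ∑ v ∈ (coord A Δ q c Ψ).support,
      coord A Δ q c (coord A Δ q c Ψ v • Γ • wv A Δ q c v) w₀ =
      ∑ v ∈ (coord A Δ q c Ψ).support, if v = v₀ then coord A Δ q c Ψ v₀ * mu ε δ v₀ else 0 := by
    refine Finset.sum_congr rfl fun v hv => ?_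
    rw [map_smul, Finsupp.smul_apply, hcoef v hv, smul_eq_mul]
    split_ifs with h
    · rw [h]
    · rw [mul_zero]
  rw [this, Finset.sum_ite_eq' , if_pos hv₀] at hzero
  exact mul_ne_zero (Finsupp.mem_support_iff.1 hv₀) hmu hzero

/-! ### The operators `L_n`, `G_n` and `Q_n` -/

/-- For a single letter as operator, the local hypothesis of `symbol` becomes a degree bound on
brackets, once the multiple of `L_{-1}` has been removed. -/
theorem of_step {g x₀ : Gen} {δ : Gen → ℂ} {good : Gen → Prop} (hg : g.deg = 2 - x₀.deg)
    (hb : ∀ x, good x → ∀ z ∈ (bracket g x - δ x • e (.L (-1))).support, z.deg ≤ x.deg + g.deg - 1)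
    (x : Gen) (v : List Gen) (hx : good x) :
    U.of g • U.of x • wv A Δ q c v - eps g x • U.of x • U.of g • wv A Δ q c v
        - δ x • tt A Δ q c (wv A Δ q c v) ∈
        Filt A Δ q c (wdeg (x :: v) + (2 - x₀.deg) - 1) := by
  rw [of_smul_of_smul, add_sub_cancel_left, ← lin_sub_smul]
  exact lin_mem_Filt (hb x hx) (wv_mem_Filt le_rfl) (by rw [wdeg_cons]; omega)

theorem deg_bracket_L {n : ℤ} {x : Gen} (hx : x ≠ .L (-1 - n)) :
    ∀ z ∈ (bracket (.L n) x).support, z.deg ≤ x.deg := by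
  intro z h
  contrapose! h
  rw [Finsupp.notMem_support_iff]
  cases x <;> cases z <;> simp only [bracket, Finsupp.coe_add,
    Finsupp.coe_smul, Finsupp.coe_zero, Pi.add_apply,
    Pi.smul_apply, Pi.zero_apply, Finsupp.single_apply, reduceCtorEq,
    if_false, smul_zero, add_zero, Gen.L.injEq, Gen.deg, ne_eq, not_false_eq_true,
    lt_self_iff_false] at hx h ⊢ <;>
    split_ifs at * <;> first | omega | simp

/-- Positive degree of `x` excludes `H`, whose bracket with a fermion is a fermion and so exceeds
the degree 0 of `H`. -/
theorem deg_bracket_F (F : Fermion) {n : ℤ} {x : Gen} (hx : x ≠ F.other.gen (-1 - n))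
    (hd : 0 < x.deg) : ∀ z ∈ (bracket (F.gen n) x).support, z.deg ≤ x.deg := by
  intro z h
  contrapose! h
  rw [Finsupp.notMem_support_iff]
  cases F <;> cases x <;> cases z <;> simp only [bracket, Finsupp.coe_add,
    Finsupp.coe_smul, Finsupp.coe_zero, Finsupp.coe_sub, Pi.add_apply,
    Pi.smul_apply, Pi.zero_apply, Pi.sub_apply, Finsupp.single_apply, reduceCtorEq,
    if_false, smul_zero, add_zero, sub_zero, Gen.L.injEq, Gen.H.injEq, Gen.G.injEq,
    Gen.Q.injEq, Gen.deg, ne_eq, not_false_eq_true, lt_self_iff_false, Fermion.gen,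
    Fermion.other] at hx h hd ⊢ <;>
    split_ifs at * <;> first | omega | simp

theorem deg_bracket_F_other (F : Fermion) (n : ℤ) :
    ∀ z ∈ (bracket (F.gen n) (F.other.gen (-1 - n)) - (2 : ℂ) • e (.L (-1))).support,
      z.deg ≤ 0 := by
  intro z h
  contrapose! h
  rw [Finsupp.notMem_support_iff]
  have h1 : n + (-1 - n) = -1 := by ring
  have h2 : delta (-1) = 0 := by simp [delta]
  cases F <;> cases z <;>
    simp_all [bracket, Gen.deg, Fermion.gen, Fermion.other]

theorem bracket_L_L (n : ℤ) :
    bracket (.L n) (.L (-1 - n)) - (2 * (n : ℂ) + 1) • e (.L (-1)) = 0 := by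
  have h1 : n + (-1 - n) = -1 := by ring
  rw [bracket, h1]
  push_cast
  module

/-- The Clifford relation `{F_i, F'_j} ≈ 2 L_{-1}` for `i + j = -1`, and `≈ 0` otherwise, where the
neglected terms have degree at most 1. -/
theorem lin_fermion_mem (F : Fermion) (i j : ℤ) {d d' : ℤ} {u : Verma A Δ q c}
    (hu : u ∈ Filt A Δ q c d) (hd : d + 1 ≤ d') :
    lin A Δ q c (bracket (F.gen i) (F.other.gen j)) u -
      (if i + j = -1 then (2 : ℂ) else 0) • tt A Δ q c u ∈ Filt A Δ q c d' := by
  split_ifs with h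
  · obtain rfl : j = -1 - i := by omega
    rw [← lin_sub_smul]
    exact lin_mem_Filt (deg_bracket_F_other F i) hu (by omega)
  · rw [zero_smul, sub_zero]
    refine lin_mem_Filt (fun z hz => ?_) hu (k := 1) (by omega)
    rw [← F.other.deg_gen j]
    refine deg_bracket_F F (fun h' => h ?_) (by rw [Fermion.deg_gen]; norm_num) z hz
    cases F <;> simp [Fermion.gen, Fermion.other] at h' <;> omega

/-! ### The operators `T_n` -/

theorem Fermion.other_other (F : Fermion) : F.other.other = F := by cases F <;> rfl

theorem lin_smul_single (r : ℂ) (x : Gen) (u : Verma A Δ q c) :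
    lin A Δ q c (r • e x) u = r • U.of x • u := by
  simp [lin]

theorem lin_zero (u : Verma A Δ q c) : lin A Δ q c 0 u = 0 := by simp [lin]

/-- The charge of a fermion, as a complex number. -/
def Fermion.sgn (F : Fermion) : ℂ := (F.charge : ℂ)

theorem Fermion.sgn_mul_self (F : Fermion) : F.sgn * F.sgn = 1 := by
  cases F <;> simp [sgn, charge]

theorem Fermion.sgn_other (F : Fermion) : F.other.sgn = -F.sgn := by
  cases F <;> simp [sgn, charge, other]

theorem lin_H_fermion (F : Fermion) (n p : ℤ) (u : Verma A Δ q c) :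
    lin A Δ q c (bracket (.H n) (F.gen p)) u = F.sgn • U.of (F.gen (n + p)) • u := by
  rw [← lin_smul_single]
  congr 1
  cases F <;> simp [Fermion.gen, bracket, Fermion.sgn, Fermion.charge]

theorem lin_fermion_H (F : Fermion) (n p : ℤ) (u : Verma A Δ q c) :
    lin A Δ q c (bracket (F.gen p) (.H n)) u = (-F.sgn) • U.of (F.gen (p + n)) • u := by
  rw [← lin_smul_single]
  congr 1
  cases F <;> simp [Fermion.gen, bracket, Fermion.sgn, Fermion.charge]

theorem lin_same (F : Fermion) (i j : ℤ) (u : Verma A Δ q c) :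
    lin A Δ q c (bracket (F.gen i) (F.gen j)) u = 0 := by
  rw [← lin_zero]
  congr 1
  cases F <;> rfl

theorem C_smul_wv (v : List Gen) : U.of .C • wv A Δ q c v = c • wv A Δ q c v := by
  induction v with
  | nil => rw [wv, of_smul_hwv (by simp [neg]), hw]
  | cons x v ih =>
    have h0 : bracket .C x = 0 := by cases x <;> rfl
    have h1 : eps .C x = 1 := by simp [eps, Gen.odd]
    rw [wv, of_smul_of_smul, h0, h1, lin_zero, ih, one_smul, add_zero, smul_comm]

theorem triple_comm (g₁ g₂ x : Gen) (u : Verma A Δ q c) :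
    U.of g₁ • U.of g₂ • U.of x • u = (eps g₂ x * eps g₁ x) • U.of x • U.of g₁ • U.of g₂ • u +
      eps g₂ x • lin A Δ q c (bracket g₁ x) (U.of g₂ • u) +
      U.of g₁ • lin A Δ q c (bracket g₂ x) u := by
  rw [of_smul_of_smul g₂ x, smul_add, smul_comm (_ : U) (_ : ℂ), of_smul_of_smul g₁ x, smul_add,
    mul_smul]

variable (A) in
/-- The operator `L_{-1} H_n - ½ s ∑ :A_i B_j:`, with the sum over `i + j = n - 1` cut off. -/
def T (n : ℤ) (M : ℕ) : U :=
  -- The bilinear is normal ordered: for `n ≥ 1`, modes annihilating the highest weight vector stand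
  -- on the right, namely `B_{n+k}` in the first sum and `A_k` in the second, which carries the sign
  -- of the exchange.
  U.of (.L (-1)) * U.of (.H n) - (A.sgn / 2) •
    (∑ k ∈ Finset.range M, U.of (A.gen (-1 - k)) * U.of (A.other.gen (n + k)) -
      ∑ k ∈ Finset.range M, U.of (A.other.gen (n - 1 - k)) * U.of (A.gen k))

theorem T_smul (n : ℤ) (M : ℕ) (u : Verma A Δ q c) : T A n M • u =
    tt A Δ q c (U.of (.H n) • u) - (A.sgn / 2) •
    (∑ k ∈ Finset.range M, U.of (A.gen (-1 - k)) • U.of (A.other.gen (n + k)) • u -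
      ∑ k ∈ Finset.range M, U.of (A.other.gen (n - 1 - k)) • U.of (A.gen k) • u) := by
  rw [T, sub_smul, smul_assoc, sub_smul, Finset.sum_smul, Finset.sum_smul]
  simp only [mul_smul]

theorem T_smul_mem_Filt (n : ℤ) (M : ℕ) {d d' : ℤ} {u : Verma A Δ q c} (hu : u ∈ Filt A Δ q c d)
    (h : d + 2 ≤ d') : T A n M • u ∈ Filt A Δ q c d' := by
  have hd1 : (Gen.H n).deg = 0 := rfl
  have hd2 : (Gen.L (-1)).deg = 2 := by simp [Gen.deg]
  have hF : ∀ F F' : Fermion, ∀ i j : ℤ, U.of (F.gen i) • U.of (F'.gen j) • u ∈ Filt A Δ q c d' :=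
    fun F F' i j => of_smul_mem_Filt (of_smul_mem_Filt hu le_rfl) (by
      rw [Fermion.deg_gen, Fermion.deg_gen]; omega)
  rw [T_smul]
  refine sub_mem (of_smul_mem_Filt (of_smul_mem_Filt hu le_rfl) (by rw [hd1, hd2]; omega))
    (Submodule.smul_mem _ _ (sub_mem (Submodule.sum_mem _ fun k _ => hF _ _ _ _)
      (Submodule.sum_mem _ fun k _ => hF _ _ _ _)))

/-- A mode above the level leads to negative level. This makes the cut-off in `T` harmless on words
of bounded level. -/
theorem fermion_smul_wv_eq_zero (F : Fermion) {i : ℤ} {v : List Gen} (h : wlevel v < i) :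
    U.of (F.gen i) • wv A Δ q c v = 0 := by
  refine wv_eq_zero_of_level (v := F.gen i :: v) ?_
  rw [wlevel_cons, Fermion.level_gen]
  omega

theorem sum_range_ite_int {M : Type*} [AddCommMonoid M] (m : ℕ) (k₀ : ℤ) (v : ℕ → M) (w : M)
    (hv : ∀ k : ℕ, (k : ℤ) = k₀ → v k = w) :
    ∑ k ∈ Finset.range m, (if (k : ℤ) = k₀ then v k else 0) =
      if 0 ≤ k₀ ∧ k₀ < m then w else 0 := by
  split_ifs with h
  · rw [Finset.sum_eq_single k₀.toNat]
    · rw [if_pos (by omega)]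
      exact hv _ (by omega)
    · intro b _ hb
      rw [if_neg (by omega)]
    · intro hk
      simp only [Finset.mem_range] at hk
      omega
  · refine Finset.sum_eq_zero fun k hk => ?_
    simp only [Finset.mem_range] at hk
    rw [if_neg (by omega)]

/-- Telescoping with step `m`. It is applied to the commutator of the bilinear with `H_{-m}`, which
is such a difference of shifts; the boundary terms at 0 carry the shift of the central charge. -/
theorem sum_range_sub_shift {M : Type*} [AddCommGroup M] (g : ℕ → M) (N m : ℕ) :
    ∑ k ∈ Finset.range N, (g k - g (k + m)) =
      ∑ k ∈ Finset.range m, g k - ∑ k ∈ Finset.range m, g (N + k) := by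
  have h1 := Finset.sum_range_add g N m
  have h2 := Finset.sum_range_add g m N
  rw [add_comm m N, h1] at h2
  rw [Finset.sum_sub_distrib]
  simp only [add_comm _ m]
  rw [sub_eq_sub_iff_add_eq_add, h2, add_comm]

/-- The half `L_{-1} H_n` of `T` contributes `L_{-1} [H_n, x]` to leading order, since `L_{-1}`
passes through `x`. -/
theorem T_H_part (n : ℤ) (x : Gen) {d d' : ℤ} {u : Verma A Δ q c} (hu : u ∈ Filt A Δ q c d)
    (h : d + 1 + x.deg ≤ d') :
    tt A Δ q c (U.of (.H n) • U.of x • u) - U.of x • tt A Δ q c (U.of (.H n) • u) -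
      tt A Δ q c (lin A Δ q c (bracket (.H n) x) u) ∈ Filt A Δ q c d' := by
  have hd1 : (Gen.H n).deg = 0 := rfl
  have h1 : eps (.H n) x = 1 := by simp [eps, Gen.odd]
  have h2 := tt_comm x (of_smul_mem_Filt (x := .H n) hu (d' := d) (by omega)) (d' := d') (by omega)
  rw [of_smul_of_smul (.H n) x, h1, one_smul, tt, smul_add, tt, add_sub_right_comm,
    add_sub_cancel_right, ← neg_mem_iff, neg_sub]
  exact h2

/-- `T_n` commutes with `L_m` up to terms of lower degree. -/
theorem T_L (n m : ℤ) (M : ℕ) {d d' : ℤ} {u : Verma A Δ q c}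
    (hu : u ∈ Filt A Δ q c d) (h : d + 1 + (Gen.L m).deg ≤ d') :
    T A n M • U.of (.L m) • u - U.of (.L m) • T A n M • u ∈ Filt A Δ q c d' := by
  have hdm : 1 ≤ (Gen.L m).deg := by simp only [Gen.deg]; split_ifs <;> norm_num
  have hd2 : (Gen.L (-1)).deg = 2 := by simp [Gen.deg]
  have hp := T_H_part n (.L m) hu h
  have hb : ∀ z ∈ (bracket (.H n) (.L m)).support, z.deg ≤ 0 := by
    intro z h
    contrapose! h
    rw [Finsupp.notMem_support_iff]
    cases z <;> simp_all [bracket, Gen.deg]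
  have hp2 : tt A Δ q c (lin A Δ q c (bracket (.H n) (.L m)) u) ∈ Filt A Δ q c d' :=
    of_smul_mem_Filt (lin_mem_Filt hb hu le_rfl) (by omega)
  have hbF : ∀ (F : Fermion) (i : ℤ), ∀ z ∈ (bracket (F.gen i) (.L m)).support, z.deg ≤ 1 := by
    intro F i z h
    contrapose! h
    rw [Finsupp.notMem_support_iff]
    cases F <;> cases z <;> simp_all [bracket, Gen.deg, Fermion.gen]
  have hs : ∀ (F F' : Fermion) (i j : ℤ), U.of (F.gen i) • U.of (F'.gen j) • U.of (.L m) • u -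
      U.of (.L m) • U.of (F.gen i) • U.of (F'.gen j) • u ∈ Filt A Δ q c d' := by
    intro F F' i j
    have e1 : ∀ x, eps x (.L m) = 1 := fun x => by simp [eps, Gen.odd]
    rw [triple_comm, e1, e1, mul_one, one_smul, one_smul, add_assoc, add_sub_cancel_left]
    refine add_mem (lin_mem_Filt (hbF F i) (of_smul_mem_Filt hu le_rfl) ?_)
      (of_smul_mem_Filt (lin_mem_Filt (hbF F' j) hu le_rfl) ?_)
    · rw [Fermion.deg_gen]; omega
    · rw [Fermion.deg_gen]; omega
  rw [T_smul, T_smul, smul_sub (U.of _), smul_comm (U.of _) (A.sgn / 2), smul_sub (U.of _),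
    Finset.smul_sum, Finset.smul_sum]
  have h3 := sub_mem (add_mem hp hp2) (Submodule.smul_mem _ (A.sgn / 2) (sub_mem
    (Submodule.sum_mem _ fun (k : ℕ) (_ : k ∈ Finset.range M) =>
      hs A A.other (-1 - k) (n + k))
    (Submodule.sum_mem _ fun (k : ℕ) (_ : k ∈ Finset.range M) =>
      hs A.other A (n - 1 - k) k)))
  convert h3 using 1
  rw [Finset.sum_sub_distrib, Finset.sum_sub_distrib]
  simp only [smul_sub]
  abel

/-- In the commutator of a bilinear with a third fermion only the opposite one contracts, leaving `2
L_{-1}` times the other factor. In `back_mem` the contracted factor stands on the left, which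
reverses the sign. -/
theorem front_mem (F : Fermion) (i j p : ℤ) {d d' : ℤ} {u : Verma A Δ q c}
    (hu : u ∈ Filt A Δ q c d) (h : d + 2 ≤ d') :
    U.of (F.gen i) • U.of (F.other.gen j) • U.of (F.gen p) • u -
      U.of (F.gen p) • U.of (F.gen i) • U.of (F.other.gen j) • u -
      (if j + p = -1 then (2 : ℂ) else 0) • tt A Δ q c (U.of (F.gen i) • u) ∈ Filt A Δ q c d' := by
  have h1 : eps (F.other.gen j) (F.gen p) * eps (F.gen i) (F.gen p) = 1 := by
    simp [eps, Fermion.gen_odd]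
  have h2 := lin_fermion_mem F.other j p hu le_rfl
  rw [F.other_other] at h2
  have h3 := of_smul_mem_Filt (x := F.gen i) h2 (d' := d') (by rw [Fermion.deg_gen]; omega)
  have h4 := tt_comm (F.gen i) hu (d' := d') (by rw [Fermion.deg_gen]; omega)
  have h5 := add_mem h3 (Submodule.smul_mem _ (if j + p = -1 then (2 : ℂ) else 0) h4)
  rw [triple_comm, h1, lin_same, one_smul, smul_zero, add_zero, add_sub_cancel_left]
  rw [smul_sub, smul_comm (U.of (F.gen i)) (ite _ _ _), smul_sub] at h5
  convert h5 using 1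
  abel

theorem back_mem (F : Fermion) (i j p : ℤ) {d d' : ℤ} {u : Verma A Δ q c}
    (hu : u ∈ Filt A Δ q c d) (h : d + 2 ≤ d') :
    U.of (F.other.gen j) • U.of (F.gen i) • U.of (F.gen p) • u -
      U.of (F.gen p) • U.of (F.other.gen j) • U.of (F.gen i) • u +
      (if j + p = -1 then (2 : ℂ) else 0) • tt A Δ q c (U.of (F.gen i) • u) ∈ Filt A Δ q c d' := by
  have h1 : eps (F.gen i) (F.gen p) * eps (F.other.gen j) (F.gen p) = 1 := by
    simp [eps, Fermion.gen_odd]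
  have h1' : eps (F.gen i) (F.gen p) = -1 := by simp [eps, Fermion.gen_odd]
  have h2 := lin_fermion_mem F.other j p (of_smul_mem_Filt (x := F.gen i) hu le_rfl) (d' := d')
    (by rw [Fermion.deg_gen]; omega)
  rw [F.other_other] at h2
  rw [triple_comm, h1, h1', lin_same, one_smul, smul_zero, add_zero, add_sub_cancel_left,
    neg_smul, one_smul]
  convert neg_mem h2 using 1
  abel

theorem sum_mem_sub_ite {M : ℕ} {D : ℤ} {f w : ℕ → Verma A Δ q c} {k₀ : ℤ} {w₀ : Verma A Δ q c}
    (hf : ∀ k : ℕ, f k - (if (k : ℤ) = k₀ then w k else 0) ∈ Filt A Δ q c D)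
    (hw : ∀ k : ℕ, (k : ℤ) = k₀ → w k = w₀) :
    ∑ k ∈ Finset.range M, f k - (if 0 ≤ k₀ ∧ k₀ < M then w₀ else 0) ∈ Filt A Δ q c D := by
  rw [← sum_range_ite_int M k₀ w w₀ hw, ← Finset.sum_sub_distrib]
  exact Submodule.sum_mem _ fun k _ => hf k

theorem T_comm_eq (n : ℤ) (M : ℕ) (x : Gen) (u : Verma A Δ q c) :
    T A n M • U.of x • u - U.of x • T A n M • u =
      (tt A Δ q c (U.of (.H n) • U.of x • u) - U.of x • tt A Δ q c (U.of (.H n) • u)) -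
      (A.sgn / 2) • (∑ k ∈ Finset.range M,
          (U.of (A.gen (-1 - k)) • U.of (A.other.gen (n + k)) • U.of x • u -
            U.of x • U.of (A.gen (-1 - k)) • U.of (A.other.gen (n + k)) • u) -
        ∑ k ∈ Finset.range M,
          (U.of (A.other.gen (n - 1 - k)) • U.of (A.gen k) • U.of x • u -
            U.of x • U.of (A.other.gen (n - 1 - k)) • U.of (A.gen k) • u)) := by
  rw [T_smul, T_smul, smul_sub (U.of _), smul_comm (U.of _) (A.sgn / 2), smul_sub (U.of _),
    Finset.smul_sum, Finset.smul_sum, Finset.sum_sub_distrib, Finset.sum_sub_distrib]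
  simp only [smul_sub]
  abel

/-- `T_n` commutes with the modes of `A` up to terms of lower degree. -/
theorem T_A {n p : ℤ} {M : ℕ} (hn : 0 ≤ n) (hp : p ≤ -1) (hpM : -p ≤ M) (hnM : n ≤ M) {d d' : ℤ}
    {u : Verma A Δ q c} (hu : u ∈ Filt A Δ q c d) (h : d + 2 ≤ d') :
    T A n M • U.of (A.gen p) • u - U.of (A.gen p) • T A n M • u ∈ Filt A Δ q c d' := by
  have hH := T_H_part n (A.gen p) hu (d' := d') (by rw [Fermion.deg_gen]; omega)
  rw [lin_H_fermion] at hH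
  have h1 := sum_mem_sub_ite (M := M) (D := d') (k₀ := -1 - n - p)
    (f := fun k : ℕ => U.of (A.gen (-1 - k)) • U.of (A.other.gen (n + k)) • U.of (A.gen p) • u -
      U.of (A.gen p) • U.of (A.gen (-1 - k)) • U.of (A.other.gen (n + k)) • u)
    (w := fun k => (2 : ℂ) • tt A Δ q c (U.of (A.gen (-1 - k)) • u))
    (w₀ := (2 : ℂ) • tt A Δ q c (U.of (A.gen (n + p)) • u)) (fun k => by
      have := front_mem A (-1 - k) (n + k) p hu h
      by_cases hk : (k : ℤ) = -1 - n - p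
      · rw [if_pos hk]; rwa [if_pos (by omega)] at this
      · rw [if_neg hk]; rwa [if_neg (by omega), zero_smul] at this)
    (fun k hk => by rw [show -1 - (k : ℤ) = n + p by omega])
  have h2 := sum_mem_sub_ite (M := M) (D := d') (k₀ := n + p)
    (f := fun k : ℕ => U.of (A.other.gen (n - 1 - k)) • U.of (A.gen k) • U.of (A.gen p) • u -
      U.of (A.gen p) • U.of (A.other.gen (n - 1 - k)) • U.of (A.gen k) • u)
    (w := fun k => -(2 : ℂ) • tt A Δ q c (U.of (A.gen k) • u))
    (w₀ := -(2 : ℂ) • tt A Δ q c (U.of (A.gen (n + p)) • u)) (fun k => by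
      have := back_mem A k (n - 1 - k) p hu h
      by_cases hk : (k : ℤ) = n + p
      · rw [if_pos hk, neg_smul, sub_neg_eq_add]; rwa [if_pos (by omega)] at this
      · rw [if_neg hk, sub_zero]; rwa [if_neg (by omega), zero_smul, add_zero] at this)
    (fun k hk => by rw [hk])
  have h3 := sub_mem hH (Submodule.smul_mem _ (A.sgn / 2) (sub_mem h1 h2))
  rw [T_comm_eq]
  -- Exactly one of the two sums contains the index that contracts with `A_p`: the second if `n + p
  -- ≥ 0`, the first otherwise. Either way the contribution cancels the one from `L_{-1} H_n`.
  by_cases hc : 0 ≤ n + p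
  · rw [if_neg (by omega), if_pos (by omega)] at h3
    convert h3 using 1
    simp only [tt, smul_comm (_ : U) (_ : ℂ), smul_sub, sub_zero, smul_smul, neg_smul, smul_neg]
    rw [div_mul_cancel₀ _ two_ne_zero]
    abel
  · rw [if_pos (by omega), if_neg (by omega)] at h3
    convert h3 using 1
    simp only [tt, smul_comm (_ : U) (_ : ℂ), smul_sub, sub_zero, smul_smul]
    rw [div_mul_cancel₀ _ two_ne_zero]
    abel

/-- `T_n` commutes with the modes of `B` up to terms of lower degree. -/
theorem T_B {n p : ℤ} {M : ℕ} (hp : p ≤ 0) (hpM : -p < M) {d d' : ℤ}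
    {u : Verma A Δ q c} (hu : u ∈ Filt A Δ q c d) (h : d + 2 ≤ d') :
    T A n M • U.of (A.other.gen p) • u - U.of (A.other.gen p) • T A n M • u ∈
      Filt A Δ q c d' := by
  have hH := T_H_part n (A.other.gen p) hu (d' := d') (by rw [Fermion.deg_gen]; omega)
  rw [lin_H_fermion, Fermion.sgn_other] at hH
  have h1 := sum_mem_sub_ite (M := M) (D := d') (k₀ := p)
    (f := fun k : ℕ => U.of (A.gen (-1 - k)) • U.of (A.other.gen (n + k)) •
      U.of (A.other.gen p) • u -
      U.of (A.other.gen p) • U.of (A.gen (-1 - k)) • U.of (A.other.gen (n + k)) • u)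
    (w := fun k => -(2 : ℂ) • tt A Δ q c (U.of (A.other.gen (n + k)) • u))
    (w₀ := -(2 : ℂ) • tt A Δ q c (U.of (A.other.gen (n + p)) • u)) (fun k => by
      have := back_mem A.other (n + k) (-1 - k) p hu h
      rw [A.other_other] at this
      by_cases hk : (k : ℤ) = p
      · rw [if_pos hk, neg_smul, sub_neg_eq_add]; rwa [if_pos (by omega)] at this
      · rw [if_neg hk, sub_zero]; rwa [if_neg (by omega), zero_smul, add_zero] at this)
    (fun k hk => by rw [hk])
  have h2 := sum_mem_sub_ite (M := M) (D := d') (k₀ := -1 - p)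
    (f := fun k : ℕ => U.of (A.other.gen (n - 1 - k)) • U.of (A.gen k) • U.of (A.other.gen p) • u -
      U.of (A.other.gen p) • U.of (A.other.gen (n - 1 - k)) • U.of (A.gen k) • u)
    (w := fun k => (2 : ℂ) • tt A Δ q c (U.of (A.other.gen (n - 1 - k)) • u))
    (w₀ := (2 : ℂ) • tt A Δ q c (U.of (A.other.gen (n + p)) • u)) (fun k => by
      have := front_mem A.other (n - 1 - k) k p hu h
      rw [A.other_other] at this
      by_cases hk : (k : ℤ) = -1 - p
      · rw [if_pos hk]; rwa [if_pos (by omega)] at this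
      · rw [if_neg hk]; rwa [if_neg (by omega), zero_smul] at this)
    (fun k hk => by rw [show n - 1 - (k : ℤ) = n + p by omega])
  have h3 := sub_mem hH (Submodule.smul_mem _ (A.sgn / 2) (sub_mem h1 h2))
  rw [T_comm_eq]
  -- The first sum contracts only at `k = p`, hence only for `p = 0`; the second contracts at `k =
  -- -1 - p`, hence only for `p ≤ -1`.
  by_cases hc : p = 0
  · rw [if_pos (by omega), if_neg (by omega)] at h3
    convert h3 using 1
    simp only [tt, smul_comm (_ : U) (_ : ℂ), smul_sub, sub_zero, smul_smul, neg_smul, smul_neg]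
    rw [div_mul_cancel₀ _ two_ne_zero]
    abel
  · rw [if_neg (by omega), if_pos (by omega)] at h3
    convert h3 using 1
    simp only [tt, smul_comm (_ : U) (_ : ℂ), smul_sub, sub_zero, smul_smul, neg_smul, smul_neg]
    rw [div_mul_cancel₀ _ two_ne_zero]
    abel

theorem fermions_H (F F' : Fermion) (i j m : ℤ) (u : Verma A Δ q c) :
    U.of (F.gen i) • U.of (F'.gen j) • U.of (.H m) • u -
      U.of (.H m) • U.of (F.gen i) • U.of (F'.gen j) • u =
      -(F.sgn • U.of (F.gen (i + m)) • U.of (F'.gen j) • u) -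
      F'.sgn • U.of (F.gen i) • U.of (F'.gen (j + m)) • u := by
  have e1 : ∀ x, eps x (.H m) = 1 := fun x => by simp [eps, Gen.odd]
  rw [triple_comm, e1, e1, mul_one, one_smul, one_smul, lin_fermion_H, lin_fermion_H,
    neg_smul, neg_smul, smul_neg, smul_comm (U.of _) F'.sgn]
  abel

/-- The commutator of `T_n` with the negative modes of `H` up to terms of lower degree. -/
theorem T_H {n : ℤ} {m M : ℕ} {v : List Gen} (hn : 1 ≤ n) (hM : wlevel v + m < M) {d' : ℤ}
    (h : wdeg v + 1 ≤ d') :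
    T A n M • U.of (.H (-m)) • wv A Δ q c v - U.of (.H (-m)) • T A n M • wv A Δ q c v -
      (if (m : ℤ) = n then n * (c - 3) / 3 else 0 : ℂ) • tt A Δ q c (wv A Δ q c v) ∈
      Filt A Δ q c d' := by
  set u := wv A Δ q c v with hu'
  have hu : u ∈ Filt A Δ q c (wdeg v) := wv_mem_Filt le_rfl
  have hH := T_H_part n (.H (-m)) hu (d' := d') (by simpa [Gen.deg] using h)
  have hHH : lin A Δ q c (bracket (.H n) (.H (-m))) u =
      (if (m : ℤ) = n then n * c / 3 else 0 : ℂ) • u := by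
    rw [bracket, lin_smul_single, hu', C_smul_wv, smul_smul, delta]
    congr 1
    by_cases hmn : (m : ℤ) = n
    · rw [if_pos hmn, if_pos (by omega)]; ring
    · rw [if_neg hmn, if_neg (by omega)]; ring
  set g : ℕ → Verma A Δ q c :=
    fun k => U.of (A.gen (-1 - k)) • U.of (A.other.gen (n + k - m)) • u with hg
  set h' : ℕ → Verma A Δ q c :=
    fun k => U.of (A.other.gen (n - 1 - k)) • U.of (A.gen (k - m)) • u with hh'
  -- Bracketing with `H_{-m}` lowers the mode of either factor by `m`, with opposite signs. The sum
  -- telescopes to its first `m` terms, since the last ones vanish by the cut-off.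
  have s1 : ∑ k ∈ Finset.range M,
      (U.of (A.gen (-1 - k)) • U.of (A.other.gen (n + k)) • U.of (.H (-m)) • u -
        U.of (.H (-m)) • U.of (A.gen (-1 - k)) • U.of (A.other.gen (n + k)) • u) =
      A.sgn • ∑ k ∈ Finset.range m, g k := by
    have : ∀ k ∈ Finset.range m, g (M + k) = 0 := by
      intro k _
      simp only [hg, hu']
      rw [fermion_smul_wv_eq_zero _ (by push_cast; omega), smul_zero]
    rw [← sub_zero (∑ k ∈ Finset.range m, g k), ← Finset.sum_eq_zero this,
      ← sum_range_sub_shift, Finset.smul_sum]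
    refine Finset.sum_congr rfl fun k _ => ?_
    rw [fermions_H, Fermion.sgn_other]
    simp only [hg]
    rw [show -1 - (k : ℤ) + -m = -1 - ((k + m : ℕ) : ℤ) by push_cast; ring,
      show n + (k : ℤ) + -m = n + k - m by ring,
      show n + ((k + m : ℕ) : ℤ) - m = n + k by push_cast; ring]
    simp only [smul_sub, neg_smul]
    abel
  have s2 : ∑ k ∈ Finset.range M,
      (U.of (A.other.gen (n - 1 - k)) • U.of (A.gen k) • U.of (.H (-m)) • u -
        U.of (.H (-m)) • U.of (A.other.gen (n - 1 - k)) • U.of (A.gen k) • u) =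
      -(A.sgn • ∑ k ∈ Finset.range m, h' k) := by
    have : ∀ k ∈ Finset.range m, h' (M + k) = 0 := by
      intro k _
      simp only [hh', hu']
      rw [fermion_smul_wv_eq_zero _ (by push_cast; omega), smul_zero]
    rw [← sub_zero (∑ k ∈ Finset.range m, h' k), ← Finset.sum_eq_zero this,
      ← sum_range_sub_shift, Finset.smul_sum, ← Finset.sum_neg_distrib]
    refine Finset.sum_congr rfl fun k _ => ?_
    rw [fermions_H, Fermion.sgn_other]
    simp only [hh']
    rw [show n - 1 - (k : ℤ) + -m = n - 1 - ((k + m : ℕ) : ℤ) by push_cast; ring,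
      show (k : ℤ) + -m = k - m by ring,
      show ((k + m : ℕ) : ℤ) - m = k by push_cast; ring]
    simp only [smul_sub, neg_smul]
    abel
  -- With one sum reversed, the boundary terms pair up into `m` anticommutators of total mode `n - m
  -- - 1`. Each gives `2 L_{-1}` exactly when `m = n`, which after the factor 1/2 shifts `nc/3` by
  -- `-n`.
  have s3 : ∑ k ∈ Finset.range m, g k + ∑ k ∈ Finset.range m, h' k -
      ∑ k ∈ Finset.range m, (if (m : ℤ) = n then (2 : ℂ) else 0) • tt A Δ q c u ∈
      Filt A Δ q c d' := by
    rw [← Finset.sum_range_reflect h', ← Finset.sum_add_distrib, ← Finset.sum_sub_distrib]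
    refine Submodule.sum_mem _ fun k hk => ?_
    have hk := Finset.mem_range.1 hk
    have h1 := lin_fermion_mem A (-1 - k) (n + k - m) hu h
    have h2 := of_smul_of_smul (A.gen (-1 - k)) (A.other.gen (n + k - m)) u
    have h3 : eps (A.gen (-1 - k)) (A.other.gen (n + k - m)) = -1 := by
      simp [eps, Fermion.gen_odd]
    rw [h3, neg_smul, one_smul] at h2
    simp only [hg, hh']
    rw [show n - 1 - ((m - 1 - k : ℕ) : ℤ) = n + k - m by omega,
      show ((m - 1 - k : ℕ) : ℤ) - m = -1 - k by omega, h2]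
    by_cases hmn : (m : ℤ) = n
    · rw [if_pos (by omega)] at h1
      rw [if_pos hmn]
      convert h1 using 1
      abel
    · rw [if_neg (by omega)] at h1
      rw [if_neg hmn]
      convert h1 using 1
      abel
  have hA := A.sgn_mul_self
  have h4 := sub_mem hH (Submodule.smul_mem _ (A.sgn / 2 * A.sgn) s3)
  rw [hHH, Finset.sum_const, Finset.card_range] at h4
  rw [T_comm_eq, s1, s2]
  have hhalf : A.sgn / 2 * A.sgn = 1 / 2 := by rw [div_mul_eq_mul_div, hA]
  have e1 : (A.sgn / 2) • (A.sgn • ∑ k ∈ Finset.range m, g k -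
      -(A.sgn • ∑ k ∈ Finset.range m, h' k)) =
      (1 / 2 : ℂ) • (∑ k ∈ Finset.range m, g k + ∑ k ∈ Finset.range m, h' k) := by
    rw [sub_neg_eq_add, ← smul_add, smul_smul, hhalf]
  have e2 : ∀ r : ℂ, tt A Δ q c (r • u) = r • tt A Δ q c u := fun r => smul_comm _ _ _
  rw [e1]
  rw [e2, hhalf] at h4
  convert h4 using 1
  by_cases hmn : (m : ℤ) = n
  · have hmc : (m : ℂ) = n := by rw [← hmn]; simp
    rw [if_pos hmn, if_pos hmn, if_pos hmn, ← Nat.cast_smul_eq_nsmul ℂ, hmc,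
      smul_sub _ (_ + _), smul_smul (n : ℂ), smul_smul (1 / 2 : ℂ) (n * 2),
      show (n * (c - 3) / 3 : ℂ) = n * c / 3 - 1 / 2 * (n * 2) by ring, sub_smul]
    abel
  · rw [if_neg hmn, if_neg hmn, if_neg hmn]
    simp only [zero_smul, smul_zero, sub_zero]

theorem T_hwv {n : ℤ} (hn : 1 ≤ n) (M : ℕ) : T A n M • hwv A Δ q c = 0 := by
  have h0 : ∀ x : Gen, ¬ neg A x → hw Δ q c x = 0 → U.of x • hwv A Δ q c = 0 := by
    intro x hx h
    rw [of_smul_hwv hx, h, zero_smul]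
  rw [T_smul, h0 (.H n) (by simp only [neg]; omega) (by rw [hw, if_neg (by omega)])]
  rw [Finset.sum_eq_zero fun k _ => ?_, Finset.sum_eq_zero fun k _ => ?_]
  · simp
  · rw [h0 (A.gen k) ?_ (by cases A <;> rfl), smul_zero]
    cases A <;> simp only [Fermion.gen, neg] <;> omega
  · rw [h0 (A.other.gen (n + k)) ?_ (by cases A <;> rfl), smul_zero]
    cases A <;> simp only [Fermion.gen, Fermion.other, neg] <;> omega

/-- `T_n` supercommutes with all letters except `H_{-n}`, up to terms of lower degree. -/
theorem T_step {n : ℤ} (hn : 1 ≤ n) {M : ℕ} {M₀ : ℤ} (hM : M₀ + n < M) (x : Gen) (v : List Gen)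
    (hv : Sorted A (x :: v)) (hl : wlevel (x :: v) ≤ M₀) :
    T A n M • U.of x • wv A Δ q c v - (1 : ℂ) • U.of x • T A n M • wv A Δ q c v
        - (if x = .H (-n) then n * (c - 3) / 3 else 0 : ℂ) • tt A Δ q c (wv A Δ q c v) ∈
        Filt A Δ q c (wdeg (x :: v) + (2 - (Gen.H (-n)).deg) - 1) := by
  obtain ⟨hx, hv⟩ := sorted_cons.1 hv
  have hlv := wlevel_nonneg hv
  have hdH : (Gen.H (-n)).deg = 0 := rfl
  rw [wlevel_cons] at hl
  rw [wdeg_cons, hdH, sub_zero (2 : ℤ), one_smul]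
  have hu : wv A Δ q c v ∈ Filt A Δ q c (wdeg v) := wv_mem_Filt le_rfl
  rcases neg_cases hx.1 with ⟨i, hi, rfl⟩ | ⟨i, hi, rfl⟩ | ⟨i, hi, rfl⟩ | ⟨i, rfl⟩
  · rw [if_neg (by simp), zero_smul, sub_zero]
    refine T_L n _ M hu ?_
    omega
  · have := T_H (A := A) (Δ := Δ) (q := q) (c := c) (n := n) (m := i) (M := M) (v := v) hn
      (by rw [Gen.level_H] at hl; omega) (d' := (Gen.H (-i)).deg + wdeg v + 2 - 1)
      (by have : (Gen.H (-i)).deg = 0 := rfl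
          omega)
    by_cases h : (i : ℤ) = n
    · rw [if_pos h] at this
      rwa [if_pos (by rw [h])]
    · rw [if_neg h] at this
      rwa [if_neg (by simpa using h)]
  · rw [if_neg (by cases A <;> simp [Fermion.gen]), zero_smul, sub_zero]
    rw [Fermion.level_gen] at hl
    refine T_A (by omega) (by omega) (by omega) (by omega) hu ?_
    rw [Fermion.deg_gen]
    omega
  · rw [if_neg (by cases A <;> simp [Fermion.gen, Fermion.other]), zero_smul, sub_zero]
    rw [Fermion.level_gen] at hl
    refine T_B (by omega) (by omega) hu ?_
    rw [Fermion.deg_gen]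
    omega

/-! ### Weights -/

theorem L_zero_smul_wv (v : List Gen) :
    U.of (.L 0) • wv A Δ q c v = (Δ + (wlevel v : ℂ)) • wv A Δ q c v := by
  induction v with
  | nil => rw [wv, of_smul_hwv (by simp [neg]), hw, if_pos rfl]; simp [wlevel]
  | cons x v ih =>
    have h0 : bracket (.L 0) x = (x.level : ℂ) • e x := by
      cases x <;> simp [bracket, Gen.level]
    have h1 : eps (.L 0) x = 1 := by simp [eps, Gen.odd]
    rw [wv, of_smul_of_smul, h0, h1, lin_smul_single, ih, one_smul, smul_comm (U.of x),
      ← add_smul, wlevel_cons]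
    congr 1
    push_cast
    ring

theorem H_zero_smul_wv (v : List Gen) :
    U.of (.H 0) • wv A Δ q c v = (q + ((v.map Gen.charge).sum : ℂ)) • wv A Δ q c v := by
  induction v with
  | nil => rw [wv, of_smul_hwv (by simp [neg]), hw, if_pos rfl]; simp
  | cons x v ih =>
    have h0 : bracket (.H 0) x = (x.charge : ℂ) • e x := by
      cases x with
      | L m =>
        by_cases h : m = 0
        · simp [bracket, Gen.charge, h]
        · rw [bracket, delta_mul_of_ne (k := 0 + m) (by simpa using h)]
          simp [Gen.charge]
      | _ => simp [bracket, Gen.charge]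
    have h1 : eps (.H 0) x = 1 := by simp [eps, Gen.odd]
    rw [wv, of_smul_of_smul, h0, h1, lin_smul_single, ih, one_smul, smul_comm (U.of x),
      ← add_smul, List.map_cons, List.sum_cons]
    congr 1
    push_cast
    ring

theorem sorted_of_mem_support {Ψ : Verma A Δ q c} {v : List Gen}
    (hv : v ∈ (coord A Δ q c Ψ).support) : Sorted A v :=
  sorted_of_mem_words (coord_mem_words Ψ) hv

theorem smul_eq_sum (a : U) (Ψ : Verma A Δ q c) :
    a • Ψ = ∑ v ∈ (coord A Δ q c Ψ).support, coord A Δ q c Ψ v • a • wv A Δ q c v := by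
  conv_lhs => rw [← ofCoord_coord Ψ, ofCoord, Finsupp.linearCombination_apply, Finsupp.sum]
  rw [Finset.smul_sum]
  exact Finset.sum_congr rfl fun v _ => smul_comm _ _ _

/-- The words in an eigenvector have the right eigenvalue. -/
theorem eigenvalue_of_mem_support {a : U} {f : List Gen → ℂ} {r : ℂ}
    (ha : ∀ v, a • wv A Δ q c v = f v • wv A Δ q c v) {Ψ : Verma A Δ q c} (hΨ : a • Ψ = r • Ψ)
    {w : List Gen} (hw : w ∈ (coord A Δ q c Ψ).support) : f w = r := by
  have h1 : coord A Δ q c (a • Ψ) w = coord A Δ q c Ψ w * f w := by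
    rw [smul_eq_sum, map_sum, Finsupp.finsetSum_apply, Finset.sum_eq_single w]
    · rw [ha, map_smul, map_smul, coord_wv (sorted_of_mem_support hw)]
      simp
    · intro v hv hne
      rw [ha, map_smul, map_smul, coord_wv (sorted_of_mem_support hv)]
      simp [hne]
    · exact fun h => absurd hw h
  rw [hΨ, map_smul, Finsupp.smul_apply, smul_eq_mul, mul_comm] at h1
  exact (mul_left_cancel₀ (Finsupp.mem_support_iff.1 hw) h1).symm

/-! ### Leading terms -/

variable {Ψ : Verma A Δ q c} {d : ℤ}

/-- The leading part of `L_k` replaces one `L_{-1-k}` by `(2k+1) L_{-1}`, and `2k+1` is nonzero. -/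
theorem L_not_mem (hd : ∀ v ∈ (coord A Δ q c Ψ).support, wdeg v ≤ d) {k : ℤ} (hk : 1 ≤ k)
    (hΨ : U.of (.L k) • Ψ = 0) {v₀ : List Gen} (hv₀ : v₀ ∈ (coord A Δ q c Ψ).support)
    (hd₀ : wdeg v₀ = d) : .L (-1 - k) ∉ v₀ := by
  intro hmem
  have hdeg : (Gen.L (-1 - k)).deg = 1 := by rw [Gen.deg, if_neg (by omega)]
  have hdeg' : (Gen.L k).deg = 1 := by rw [Gen.deg, if_neg (by omega)]
  have hhw : U.of (.L k) • hwv A Δ q c = 0 := by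
    rw [of_smul_hwv (by simp only [neg]; omega), hw, if_neg (by omega), zero_smul]
  let δ : Gen → ℂ := fun x => if x = .L (-1 - k) then 2 * (k : ℂ) + 1 else 0
  have hδ : ∀ x, x ≠ .L (-1 - k) → δ x = 0 := fun x hx => if_neg hx
  have hδ₀ : δ (.L (-1 - k)) ≠ 0 := by
    simp only [δ, if_pos]
    norm_cast
    omega
  refine not_mem_of_symbol (Γ := U.of (.L k)) (ε := eps (.L k)) hδ hd (fun d' u hu => ?_) ?_
    (fun _ => 0) (fun v hv hvd => ?_) (fun _ _ _ _ _ _ _ _ => by simp) hv₀ hd₀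
    (mu_ne_zero_of_even hδ hδ₀ (fun x => by simp [eps, Gen.odd]) hmem) hmem
  · exact of_smul_mem_Filt hu (by omega)
  · rw [hΨ]; exact zero_mem _
  · have := symbol (Δ := Δ) (q := q) (c := c) (ε := eps (.L k)) (good := fun _ => True)
      (M := wlevel v) hδ
      (fun x w hx _ _ => of_step (g := .L k) (x₀ := .L (-1 - k)) (δ := δ)
        (good := fun _ => True) (by omega)
        (fun x _ z hz => by
          by_cases hx : x = .L (-1 - k)
          · subst hx
            rw [show δ (.L (-1 - k)) = 2 * (k : ℂ) + 1 from if_pos rfl, bracket_L_L] at hz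
            simp at hz
          · rw [hδ x hx, zero_smul, sub_zero] at hz
            have := deg_bracket_L hx z hz
            omega) x w hx) (sorted_of_mem_support hv) (fun _ _ => trivial) le_rfl
    rwa [hhw, smul_zero, smul_zero] at this

/-- All terms of `T` kill a singular vector except possibly `B_{n-1} A_0`. If `A_0` does not
annihilate the vector, then `B_{n-1}` does, and the anticommutator that remains has degree at most
1, as its mode `n - 1` is not `-1`. So one closed zero mode is enough. -/
theorem T_smul_mem {n : ℤ} (hn : 1 ≤ n) (M : ℕ)
    (hΨ : ∀ k, 1 ≤ k → U.of (.H k) • Ψ = 0 ∧ ∀ F : Fermion, U.of (F.gen k) • Ψ = 0)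
    (hΨ₀ : ∃ F : Fermion, U.of (F.gen 0) • Ψ = 0) (hu : Ψ ∈ Filt A Δ q c d) :
    T A n M • Ψ ∈ Filt A Δ q c (d + 1) := by
  rw [T_smul, (hΨ n hn).1, tt, smul_zero, zero_sub, neg_mem_iff]
  refine Submodule.smul_mem _ _ ?_
  rw [Finset.sum_eq_zero fun k _ => by rw [(hΨ (n + k) (by omega)).2, smul_zero], zero_sub,
    neg_mem_iff]
  refine Submodule.sum_mem _ fun k _ => ?_
  rcases Nat.eq_zero_or_pos k with rfl | hk
  · by_cases hA : U.of (A.gen 0) • Ψ = 0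
    · rw [Nat.cast_zero, hA, smul_zero]; exact zero_mem _
    · have hB : U.of (A.other.gen 0) • Ψ = 0 := by
        obtain ⟨F, hF⟩ := hΨ₀
        cases A <;> cases F <;> first | exact absurd hF hA | exact hF
      have hB' : U.of (A.other.gen (n - 1)) • Ψ = 0 := by
        rcases eq_or_lt_of_le hn with rfl | h
        · exact hB
        · exact (hΨ _ (by omega)).2 _
      rw [Nat.cast_zero, sub_zero, of_smul_of_smul, hB', smul_zero, smul_zero, zero_add]
      have := lin_fermion_mem A.other (n - 1) 0 hu le_rfl
      rwa [if_neg (by omega), zero_smul, sub_zero, A.other_other] at this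
  · rw [(hΨ k (by omega)).2, smul_zero]; exact zero_mem _

/-- The operator `T` replaces `H_{-n}` by `L_{-1}` with factor `n(c-3)/3`, raising the degree by 2,
whereas on `Ψ` it raises the degree by at most 1. -/
theorem H_not_mem (hc : c ≠ 3) (hd : ∀ v ∈ (coord A Δ q c Ψ).support, wdeg v ≤ d)
    (hΨ : ∀ k, 1 ≤ k → U.of (.H k) • Ψ = 0 ∧ ∀ F : Fermion, U.of (F.gen k) • Ψ = 0)
    (hΨ₀ : ∃ F : Fermion, U.of (F.gen 0) • Ψ = 0) {n : ℤ} (hn : 1 ≤ n) {v₀ : List Gen}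
    (hv₀ : v₀ ∈ (coord A Δ q c Ψ).support) (hd₀ : wdeg v₀ = d)
    {m : ℤ} (hm : ∀ v ∈ (coord A Δ q c Ψ).support, wlevel v = m) : .H (-n) ∉ v₀ := by
  intro hmem
  have hdeg : (Gen.H (-n)).deg = 0 := rfl
  let δ : Gen → ℂ := fun x => if x = .H (-n) then n * (c - 3) / 3 else 0
  have hδ : ∀ x, x ≠ .H (-n) → δ x = 0 := fun x hx => if_neg hx
  have hδ₀ : δ (.H (-n)) ≠ 0 := by
    simp only [δ, if_pos]
    have h1 : (n : ℂ) ≠ 0 := by norm_cast; omega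
    exact div_ne_zero (mul_ne_zero h1 (sub_ne_zero.2 hc)) three_ne_zero
  -- All words of `Ψ` have level `m`, so one cut-off serves for all of them.
  obtain ⟨M, hM⟩ : ∃ M : ℕ, m + n < M := ⟨(m + n + 1).toNat, by omega⟩
  refine not_mem_of_symbol (Γ := T A n M) (ε := fun _ => 1) hδ hd (fun d' u hu => ?_) ?_
    (fun _ => 0) (fun v hv hvd => ?_) (fun _ _ _ _ _ _ _ _ => by simp) hv₀ hd₀
    (mu_ne_zero_of_even hδ hδ₀ (fun x => rfl) hmem) hmem
  · exact T_smul_mem_Filt n M hu (by omega)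
  · have := T_smul_mem hn M hΨ hΨ₀ (mem_Filt_of_support hd)
    exact Filt_mono (by omega) this
  · have := symbol (Δ := Δ) (q := q) (ε := fun _ => 1) (good := fun _ => True)
      (M := m) hδ
      (fun x w _ hs hl => T_step hn hM x w hs hl) (sorted_of_mem_support hv)
      (fun _ _ => trivial) (hm v hv).le
    rwa [T_hwv hn, smul_zero, smul_zero] at this

/-- Here `F_k` need not annihilate the highest weight vector. The condition `hR` asks that the extra
term, where `F_k` has passed through the whole word, does not interfere with the word whose
coefficient is inspected. -/
theorem fermion_not_mem_aux (F : Fermion) {k : ℤ}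
    (hd : ∀ v ∈ (coord A Δ q c Ψ).support, wdeg v ≤ d) (hΨ : U.of (F.gen k) • Ψ = 0)
    (hg : ∀ v ∈ (coord A Δ q c Ψ).support, wdeg v = d → ∀ x ∈ v, 0 < x.deg)
    (hR : ∀ v ∈ (coord A Δ q c Ψ).support, wdeg v = d → ∀ v₀ ∈ (coord A Δ q c Ψ).support,
      F.other.gen (-1 - k) ∈ v₀ → ∀ w, w.Perm (.L (-1) :: v₀.erase (F.other.gen (-1 - k))) →
      coord A Δ q c ((v.map U.of).prod • U.of (F.gen k) • hwv A Δ q c) w = 0)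
    {v₀ : List Gen} (hv₀ : v₀ ∈ (coord A Δ q c Ψ).support) (hd₀ : wdeg v₀ = d) :
    F.other.gen (-1 - k) ∉ v₀ := by
  intro hmem
  have hdeg := F.other.deg_gen (-1 - k)
  have hdeg' := F.deg_gen k
  let δ : Gen → ℂ := fun x => if x = F.other.gen (-1 - k) then 2 else 0
  have hδ : ∀ x, x ≠ F.other.gen (-1 - k) → δ x = 0 := fun x hx => if_neg hx
  have hδ₀ : δ (F.other.gen (-1 - k)) ≠ 0 := by simp [δ]
  refine not_mem_of_symbol (Γ := U.of (F.gen k)) (ε := eps (F.gen k)) hδ hd (fun d' u hu => ?_) ?_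
    (fun v => (v.map (eps (F.gen k))).prod • (v.map U.of).prod • U.of (F.gen k) • hwv A Δ q c)
    (fun v hv hvd => ?_) (fun v hv hvd v₀ hv₀ hmem₀ w hw => ?_) hv₀ hd₀
    (mu_ne_zero_of_odd hδ hδ₀ (fun x => ?_) (Fermion.gen_odd _ _) (sorted_of_mem_support hv₀) hmem)
    hmem
  · exact of_smul_mem_Filt hu (by omega)
  · rw [hΨ]; exact zero_mem _
  · exact symbol (good := fun x => 0 < x.deg) (M := wlevel v) hδ
      (fun x w hx _ _ => of_step (g := F.gen k) (x₀ := F.other.gen (-1 - k)) (δ := δ)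
        (good := fun x => 0 < x.deg) (by omega)
        (fun x hx z hz => by
          by_cases hxx : x = F.other.gen (-1 - k)
          · subst hxx
            rw [show δ (F.other.gen (-1 - k)) = 2 from if_pos rfl] at hz
            have := deg_bracket_F_other F k z hz
            omega
          · rw [hδ x hxx, zero_smul, sub_zero] at hz
            have := deg_bracket_F F hxx hx z hz
            omega) x w hx) (sorted_of_mem_support hv) (hg v hv hvd) le_rfl
  · rw [map_smul, Finsupp.smul_apply, hR v hv hvd v₀ hv₀ hmem₀ w hw, smul_zero]
  · intro h
    have := eps_mul_self (F.gen k) x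
    simp [h] at this

theorem fermion_not_mem (F : Fermion) {k : ℤ}
    (hd : ∀ v ∈ (coord A Δ q c Ψ).support, wdeg v ≤ d) (hΨ : U.of (F.gen k) • Ψ = 0)
    (hg : ∀ v ∈ (coord A Δ q c Ψ).support, wdeg v = d → ∀ x ∈ v, 0 < x.deg)
    (hneg : ¬ neg A (F.gen k))
    {v₀ : List Gen} (hv₀ : v₀ ∈ (coord A Δ q c Ψ).support) (hd₀ : wdeg v₀ = d) :
    F.other.gen (-1 - k) ∉ v₀ := by
  have : U.of (F.gen k) • hwv A Δ q c = 0 := by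
    rw [of_smul_hwv hneg, show hw Δ q c (F.gen k) = 0 by cases F <;> rfl, zero_smul]
  exact fermion_not_mem_aux F hd hΨ hg (fun _ _ _ _ _ _ _ _ => by rw [this]; simp) hv₀ hd₀

theorem neg_B_zero : neg A (A.other.gen 0) := by cases A <;> simp [neg, Fermion.gen, Fermion.other]

theorem key_lt_key_B_zero {x : Gen} (hx : neg A x) (h : x ≠ A.other.gen 0) :
    key A x < key A (A.other.gen 0) := by
  rw [key_B_zero, Prod.Lex.lt_iff]
  cases A <;> cases x <;> simp_all [neg, key, Fermion.gen, Fermion.other] <;>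
    split_ifs <;> simp

/-- Letting `B_0` act on the highest weight vector in the vector of a word. -/
theorem prod_smul_B_zero {v : List Gen} (hv : Sorted A v) :
    (v.map U.of).prod • U.of (A.other.gen 0) • hwv A Δ q c = 0 ∨
      Sorted A (v ++ [A.other.gen 0]) := by
  by_cases h : A.other.gen 0 ∈ v
  · left
    obtain ⟨s, t, rfl⟩ := List.append_of_mem h
    have ht : t = [] := by
      refine List.eq_nil_iff_forall_not_mem.2 fun y hy => ?_
      have h1 : prec A (A.other.gen 0) y :=
        List.rel_of_pairwise_cons (List.pairwise_append.1 hv.2).2.1 hy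
      have hy' : neg A y := hv.1 y (by simp [hy])
      rcases h1 with h1 | ⟨-, h1⟩
      · by_cases hyy : y = A.other.gen 0
        · rw [hyy] at h1; exact lt_irrefl _ h1
        · exact lt_asymm h1 (key_lt_key_B_zero hy' hyy)
      · rw [Fermion.gen_odd] at h1; cases h1
    have h2 : U.of (A.other.gen 0) • U.of (A.other.gen 0) • hwv A Δ q c = 0 := by
      have h3 := of_smul_of_smul (A.other.gen 0) (A.other.gen 0) (hwv A Δ q c)
      have h4 : eps (A.other.gen 0) (A.other.gen 0) = -1 := by simp [eps, Fermion.gen_odd]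
      rw [lin_same, h4, add_zero, neg_smul, one_smul, eq_neg_iff_add_eq_zero, ← two_smul ℂ] at h3
      exact (smul_eq_zero.1 h3).resolve_left two_ne_zero
    rw [ht, List.map_append, List.prod_append, List.map_singleton, List.prod_singleton, mul_smul,
      h2, smul_zero]
  · right
    refine ⟨fun x hx => ?_, List.pairwise_append.2 ⟨hv.2, by simp, fun x hx y hy => ?_⟩⟩
    · rcases List.mem_append.1 hx with hx | hx
      · exact hv.1 x hx
      · rw [List.mem_singleton.1 hx]; exact neg_B_zero
    · rw [List.mem_singleton.1 hy]
      exact .inl (key_lt_key_B_zero (hv.1 x hx) (fun hxx => h (hxx ▸ hx)))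

theorem nodup_of_odd {x : Gen} (hx : x.odd = true) {v : List Gen} (hv : Sorted A v) :
    x ∉ v.erase x := by
  induction v with
  | nil => simp
  | cons y v ih =>
    obtain ⟨hy, hv⟩ := sorted_cons.1 hv
    by_cases hxy : y = x
    · subst hxy
      rw [List.erase_cons_head]
      intro hm
      have := hy.2 y hm
      simp [prec, hx] at this
    · rw [List.erase_cons_tail (by simpa using hxy), List.mem_cons, not_or]
      exact ⟨Ne.symm hxy, ih hv⟩

/-- If `A_{-1}` occurs in all leading terms, then `Ψ` is not annihilated by `B_0`. -/
theorem exists_A_neg_one_not_mem (hd : ∀ v ∈ (coord A Δ q c Ψ).support, wdeg v ≤ d)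
    (hΨ : U.of (A.other.gen 0) • Ψ = 0)
    (hg : ∀ v ∈ (coord A Δ q c Ψ).support, wdeg v = d → ∀ x ∈ v, 0 < x.deg)
    {v₀ : List Gen} (hv₀ : v₀ ∈ (coord A Δ q c Ψ).support) (hd₀ : wdeg v₀ = d) :
    ∃ v ∈ (coord A Δ q c Ψ).support, wdeg v = d ∧ A.gen (-1) ∉ v := by
  by_contra! hcon
  have := fermion_not_mem_aux A.other hd hΨ hg (fun v hv hvd v₁ hv₁ hmem w hw => ?_) hv₀ hd₀
  · rw [A.other_other] at this
    exact this (hcon v₀ hv₀ hd₀)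
  · rw [A.other_other, sub_zero] at hw
    rcases prod_smul_B_zero (Δ := Δ) (q := q) (c := c) (sorted_of_mem_support hv) with h | h
    · rw [h]; simp
    · have h1 : (v.map U.of).prod • U.of (A.other.gen 0) • hwv A Δ q c =
          wv A Δ q c (v ++ [A.other.gen 0]) := by
        rw [wv_eq, List.map_append, List.prod_append, mul_smul]
        simp
      rw [h1, coord_wv h, Finsupp.single_apply, if_neg]
      rintro rfl
      -- The extra word `v B_0` still contains `A_{-1}`, while the inspected word has lost its only
      -- copy, so the two differ.
      have h2 : A.gen (-1) ∈ Gen.L (-1) :: v₁.erase (A.gen (-1)) :=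
        hw.subset (List.mem_append_left _ (hcon v hv hvd))
      rcases List.mem_cons.1 h2 with h2 | h2
      · cases A <;> simp [Fermion.gen] at h2
      · exact nodup_of_odd (Fermion.gen_odd _ _) (sorted_of_mem_support hv₁) h2

/-! ### The ordering kernels -/

theorem Term.mem_word_iff {X : Term} {x : Gen} : x ∈ X.word A ↔
    (∃ i ∈ X.modesL, Gen.L (-(i : ℤ)) = x) ∨ (∃ i ∈ X.h, Gen.H (-(i : ℤ)) = x) ∨
    (∃ i ∈ X.modesA, A.gen (-(i : ℤ)) = x) ∨ ∃ i ∈ X.modesB, A.other.gen (-(i : ℤ)) = x := by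
  rw [← Multiset.mem_coe, coe_word]
  simp only [Multiset.mem_add, Multiset.mem_map, or_assoc]

/-- The letters excluded by positive modes are exactly those outside the tail `L_{-1}^k A_{-1}^{r₁}
B_{-1}^{r₂} B_0^{r₃}`. -/
theorem Term.eq_low {X : Term} (hL : ∀ k : ℤ, 1 ≤ k → .L (-1 - k) ∉ X.word A)
    (hH : ∀ k : ℤ, 1 ≤ k → .H (-k) ∉ X.word A)
    (hF : ∀ F : Fermion, ∀ k : ℤ, 1 ≤ k → F.gen (-1 - k) ∉ X.word A) :
    X = Term.low X.k X.r₁ X.r₂ X.r₃ := by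
  have h1 : X.l = 0 := Multiset.eq_zero_of_forall_notMem fun i hi => by
    have := X.two_le_l i hi
    refine hL (i - 1) (by omega) (Term.mem_word_iff.2 (.inl ⟨i, ?_, by congr 1; ring⟩))
    exact Multiset.mem_add.2 (.inl hi)
  have h2 : X.h = 0 := Multiset.eq_zero_of_forall_notMem fun i hi => by
    have := X.one_le_h i hi
    exact hH i (by omega) (Term.mem_word_iff.2 (.inr (.inl ⟨i, hi, rfl⟩)))
  have h3 : X.a = ∅ := Finset.eq_empty_of_forall_notMem fun i hi => by
    have := X.two_le_a i hi
    refine hF A (i - 1) (by omega) (Term.mem_word_iff.2 (.inr (.inr (.inl ⟨i, ?_, ?_⟩))))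
    · exact Multiset.mem_add.2 (.inl hi)
    · congr 1; ring
  have h4 : X.b = ∅ := Finset.eq_empty_of_forall_notMem fun i hi => by
    have := X.two_le_b i hi
    refine hF A.other (i - 1) (by omega) (Term.mem_word_iff.2 (.inr (.inr (.inr ⟨i, ?_, ?_⟩))))
    · exact Multiset.mem_add.2 (.inl (Multiset.mem_add.2 (.inl hi)))
    · congr 1; ring
  cases X
  simp only at h1 h2 h3 h4
  subst h1 h2 h3 h4
  rfl

theorem Term.r₁_eq_zero {X : Term} (h : A.gen (-1) ∉ X.word A) : X.r₁ = 0 :=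
  fin_two_eq_zero (.inr fun h1 => h (Term.mem_word_iff.2 (.inr (.inr (.inl ⟨1, by
    simp [modesA, h1], by simp⟩)))))

theorem Term.r₂_eq_zero {X : Term} (h : A.other.gen (-1) ∉ X.word A) : X.r₂ = 0 :=
  fin_two_eq_zero (.inr fun h1 => h (Term.mem_word_iff.2 (.inr (.inr (.inr ⟨1, by
    simp [modesB, h1], by simp⟩)))))

/-- The fermionic zero modes that annihilate the vectors of a given type. -/
def Closure.closes : Closure → Fermion → Prop
  | .G, .G => True
  | .Q, .Q => True
  | .GQ, _ => True
  | _, _ => False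

theorem Closure.Holds.gen_smul {N : Closure} {Ψ : Verma A Δ q c} (h : N.Holds Ψ) {F : Fermion}
    (hF : N.closes F) : U.of (F.gen 0) • Ψ = 0 := by
  cases N <;> cases F <;> first | exact hF.elim | exact h | exact h.1 | exact h.2

theorem Closure.closes_or (N : Closure) (F : Fermion) : N.closes F ∨ N.closes F.other := by
  cases N <;> cases F <;> simp [closes, Fermion.other]

/-- The table of kernels is the enumeration of the remaining exponents by charge: closure under
`A_0` forces `r₂ = 0`, closure under `B_0` forces `r₁ = 0`, and the level fixes `k`. -/
theorem low_mem_kernel {N : Closure} {m k : ℕ} {n : ℤ} {r₁ r₂ r₃ : Fin 2}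
    (hm : (Term.low k r₁ r₂ r₃).level = m) (hn : (Term.low k r₁ r₂ r₃).charge A = n)
    (h₂ : N.closes A → r₂ = 0) (h₁ : N.closes A.other → r₁ = 0) :
    Term.low k r₁ r₂ r₃ ∈ kernel A N m n := by
  have hm' : k + (r₁ : ℕ) + (r₂ : ℕ) = m := by simpa [Term.level, Term.low] using hm
  subst hn
  cases A <;> cases N <;> simp only [Closure.closes, Fermion.other, true_imp_iff, false_imp_iff]
    at h₁ h₂ <;> (try subst h₁) <;> (try subst h₂) <;>
    (try fin_cases r₁) <;> (try fin_cases r₂) <;> fin_cases r₃ <;>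
    simp [Term.charge, Term.low, Fermion.charge, Fermion.other, kernel, lowTerm] at hm' ⊢ <;>
    simp_all

theorem lowTerm_subsingleton (m : ℕ) (r₁ r₂ r₃ : Fin 2) : (lowTerm m r₁ r₂ r₃).Subsingleton := by
  rintro _ ⟨k, hk, rfl⟩ _ ⟨k', hk', rfl⟩
  obtain rfl : k = k' := by omega
  rfl

theorem encard_kernel_le (A : Fermion) (N : Closure) (m : ℕ) (n : ℤ) :
    (kernel A N m n).encard ≤ maxDim A N n := by
  have h1 := fun r₁ r₂ r₃ => Set.encard_le_one_iff_subsingleton.2 (lowTerm_subsingleton m r₁ r₂ r₃)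
  have h2 : ∀ r₁ r₂ r₃ r₁' r₂' r₃', (lowTerm m r₁ r₂ r₃ ∪ lowTerm m r₁' r₂' r₃').encard ≤ 2 :=
    fun r₁ r₂ r₃ r₁' r₂' r₃' => (Set.encard_union_le _ _).trans
      ((add_le_add (h1 _ _ _) (h1 _ _ _)).trans (by norm_num))
  unfold kernel
  split <;> first | exact h1 _ _ _ | exact h2 _ _ _ _ _ _ | (rw [Set.encard_empty]; exact zero_le)

/-! ### Singular vectors -/

variable (A Δ q c) in
/-- The vectors of level `m` and charge `n` that satisfy the vanishing conditions of singular
vectors of type `N`. -/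
def singularSpace (N : Closure) (m : ℕ) (n : ℤ) : Submodule ℂ (Verma A Δ q c) where
  carrier := {Ψ | L 0 • Ψ = (Δ + m) • Ψ ∧ H 0 • Ψ = (q + n) • Ψ ∧
    (∀ k : ℤ, 0 < k → L k • Ψ = 0 ∧ H k • Ψ = 0 ∧ G k • Ψ = 0 ∧ Q k • Ψ = 0) ∧ N.Holds Ψ}
  zero_mem' := by cases N <;> simp [Closure.Holds]
  add_mem' := by
    rintro u v ⟨h1, h2, h3, h4⟩ ⟨h1', h2', h3', h4'⟩
    refine ⟨?_, ?_, fun k hk => ?_, ?_⟩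
    · simp only [smul_add, h1, h1']
    · simp only [smul_add, h2, h2']
    · obtain ⟨a, b, c, d⟩ := h3 k hk
      obtain ⟨a', b', c', d'⟩ := h3' k hk
      simp only [smul_add, a, b, c, d, a', b', c', d', add_zero, and_self]
    · cases N <;> simp only [Closure.Holds] at h4 h4' ⊢ <;> simp [h4, h4']
  smul_mem' := by
    rintro r u ⟨h1, h2, h3, h4⟩
    refine ⟨?_, ?_, fun k hk => ?_, ?_⟩
    · rw [smul_comm, h1, smul_comm]
    · rw [smul_comm, h2, smul_comm]
    · obtain ⟨a, b, c, d⟩ := h3 k hk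
      simp only [smul_comm (_ : U) r, a, b, c, d, smul_zero, and_self]
    · cases N <;> simp only [Closure.Holds] at h4 ⊢ <;> simp [smul_comm (_ : U) r, h4]

theorem IsSingular.mem_singularSpace {N : Closure} {m : ℕ} {n : ℤ} {Ψ : Verma A Δ q c}
    (h : IsSingular N m n Ψ) : Ψ ∈ singularSpace A Δ q c N m n :=
  ⟨h.level, h.charge, h.positive, h.closed⟩

theorem IsSingular.ne_zero {N : Closure} {m : ℕ} {n : ℤ} {Ψ : Verma A Δ q c}
    (h : IsSingular N m n Ψ) : Ψ ≠ 0 := by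
  have := h.not_proportional 0
  rwa [zero_smul] at this

variable {N : Closure} {m : ℕ} {n : ℤ} {Ψ : Verma A Δ q c}

theorem wlevel_eq (h : Ψ ∈ singularSpace A Δ q c N m n) {v : List Gen}
    (hv : v ∈ (coord A Δ q c Ψ).support) : wlevel v = m := by
  have := eigenvalue_of_mem_support L_zero_smul_wv h.1 hv
  exact_mod_cast add_left_cancel this

theorem charge_eq (h : Ψ ∈ singularSpace A Δ q c N m n) {v : List Gen}
    (hv : v ∈ (coord A Δ q c Ψ).support) : (v.map Gen.charge).sum = n := by
  have := eigenvalue_of_mem_support H_zero_smul_wv h.2.1 hv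
  exact_mod_cast add_left_cancel this

theorem mem_terms_of_mem_support (h : Ψ ∈ singularSpace A Δ q c N m n) {X : Term}
    (hX : X.word A ∈ (coord A Δ q c Ψ).support) : X ∈ terms A m n := by
  refine ⟨?_, ?_⟩
  · have := wlevel_eq h hX
    rw [wlevel, X.level_word] at this
    exact_mod_cast this
  · rw [← charge_eq h hX, X.charge_word]

/-- Singular vectors have a nonzero coefficient on the ordering kernel. -/
theorem exists_kernel_coord_ne_zero (hc : c ≠ 3) (h : Ψ ∈ singularSpace A Δ q c N m n)
    (hne : Ψ ≠ 0) : ∃ X ∈ kernel A N m n, coord A Δ q c Ψ (X.word A) ≠ 0 := by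
  have hpos : ∀ k : ℤ, 1 ≤ k → U.of (.H k) • Ψ = 0 ∧ ∀ F : Fermion, U.of (F.gen k) • Ψ = 0 :=
    fun k hk => ⟨(h.2.2.1 k hk).2.1, fun F => by
      cases F
      exacts [(h.2.2.1 k hk).2.2.1, (h.2.2.1 k hk).2.2.2]⟩
  have hzero : ∃ F : Fermion, U.of (F.gen 0) • Ψ = 0 := by
    rcases N.closes_or .G with hF | hF
    exacts [⟨_, h.2.2.2.gen_smul hF⟩, ⟨_, h.2.2.2.gen_smul hF⟩]
  have hsupp : (coord A Δ q c Ψ).support.Nonempty := by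
    rw [Finsupp.support_nonempty_iff]
    exact fun h0 => hne (coord_injective (by rw [h0, map_zero]))
  -- The leading terms are those of maximal filtration degree `wdeg v₀`.
  obtain ⟨v₀, hv₀, hd⟩ := Finset.exists_max_image _ wdeg hsupp
  have hL : ∀ v ∈ (coord A Δ q c Ψ).support, wdeg v = wdeg v₀ → ∀ k : ℤ, 1 ≤ k →
      .L (-1 - k) ∉ v := fun v hv hvd k hk => L_not_mem hd hk (h.2.2.1 k hk).1 hv hvd
  have hH : ∀ v ∈ (coord A Δ q c Ψ).support, wdeg v = wdeg v₀ → ∀ k : ℤ, 1 ≤ k →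
      .H (-k) ∉ v := fun v hv hvd k hk =>
    H_not_mem hc hd hpos hzero hk hv hvd (fun v hv => wlevel_eq h hv)
  -- With `H` gone every letter of a leading term has positive degree, as the fermionic arguments
  -- require.
  have hg : ∀ v ∈ (coord A Δ q c Ψ).support, wdeg v = wdeg v₀ → ∀ x ∈ v, 0 < x.deg := by
    intro v hv hvd x hx
    rcases neg_cases ((sorted_of_mem_support hv).1 x hx) with
      ⟨i, hi, rfl⟩ | ⟨i, hi, rfl⟩ | ⟨i, hi, rfl⟩ | ⟨i, rfl⟩
    · simp only [Gen.deg]; split_ifs <;> norm_num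
    · exact absurd hx (hH v hv hvd i (by omega))
    · rw [Fermion.deg_gen]; norm_num
    · rw [Fermion.deg_gen]; norm_num
  have hF : ∀ v ∈ (coord A Δ q c Ψ).support, wdeg v = wdeg v₀ → ∀ F : Fermion, ∀ k : ℤ, 1 ≤ k →
      F.gen (-1 - k) ∉ v := by
    intro v hv hvd F k hk
    have := fermion_not_mem F.other hd ((hpos k hk).2 _) hg
      (by cases A <;> cases F <;> simp only [Fermion.gen, Fermion.other, neg] <;> omega) hv hvd
    rwa [F.other_other] at this
  have hB : N.closes A → ∀ v ∈ (coord A Δ q c Ψ).support, wdeg v = wdeg v₀ →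
      A.other.gen (-1) ∉ v := by
    intro hN v hv hvd
    have := fermion_not_mem A hd (h.2.2.2.gen_smul hN) hg
      (by cases A <;> simp [Fermion.gen, neg]) hv hvd
    rwa [sub_zero] at this
  -- All other restrictions hold for every leading term; only the absence of `A_{-1}` has to be
  -- secured by the choice of the term.
  obtain ⟨v, hv, hvd, hA⟩ : ∃ v ∈ (coord A Δ q c Ψ).support, wdeg v = wdeg v₀ ∧
      (N.closes A.other → A.gen (-1) ∉ v) := by
    by_cases hN : N.closes A.other
    · obtain ⟨v, hv, hvd, hA⟩ :=
        exists_A_neg_one_not_mem hd (h.2.2.2.gen_smul hN) hg hv₀ rfl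
      exact ⟨v, hv, hvd, fun _ => hA⟩
    · exact ⟨v₀, hv₀, rfl, fun h => absurd h hN⟩
  obtain ⟨X, rfl⟩ := exists_term (sorted_of_mem_support hv)
  have hX := mem_terms_of_mem_support h hv
  refine ⟨X, ?_, Finsupp.mem_support_iff.1 hv⟩
  rw [Term.eq_low (hL _ hv hvd) (hH _ hv hvd) (hF _ hv hvd)] at hX ⊢
  exact low_mem_kernel hX.1 hX.2 (fun hN => Term.r₂_eq_zero (hB hN _ hv hvd))
    (fun hN => Term.r₁_eq_zero (hA hN))

/-! ### Normal forms and the dimension bound -/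

/-- The coefficients of a vector along the standard vectors. -/
def normalForm (Ψ : Verma A Δ q c) : Term →₀ ℂ :=
  (coord A Δ q c Ψ).comapDomain (Term.word A) Term.word_injective.injOn

theorem sum_normalForm (Ψ : Verma A Δ q c) :
    ((normalForm Ψ).sum fun X z => z • (X.monomial A • hwv A Δ q c)) = Ψ := by
  simp only [Term.monomial_smul_hwv]
  conv_rhs => rw [← ofCoord_coord Ψ, ofCoord, Finsupp.linearCombination_apply]
  refine Finsupp.sum_comapDomain (Term.word A) (coord A Δ q c Ψ)
    (fun v z => z • wv A Δ q c v) ⟨?_, Term.word_injective.injOn, ?_⟩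
  · exact fun X hX => by simpa using hX
  · intro v hv
    obtain ⟨X, rfl⟩ := exists_term (sorted_of_mem_support hv)
    exact ⟨X, by simpa using hv, rfl⟩

theorem IsNormalForm.eq_coord {x : Term →₀ ℂ} (h : IsNormalForm m n x Ψ) (X : Term) :
    x X = coord A Δ q c Ψ (X.word A) := by
  rw [← h.2, map_finsuppSum, Finsupp.sum_apply, Finsupp.sum_eq_single X]
  · rw [Term.monomial_smul_hwv, map_smul, coord_wv X.word_sorted]
    simp
  · intro Y _ hne
    rw [Term.monomial_smul_hwv, map_smul, coord_wv Y.word_sorted]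
    simp [Term.word_injective.ne hne]
  · simp

theorem existsUnique_isNormalForm (h : Ψ ∈ singularSpace A Δ q c N m n) :
    ∃! x, IsNormalForm m n x Ψ := by
  refine ⟨normalForm Ψ, ⟨fun X hX => ?_, sum_normalForm Ψ⟩, fun x hx => ?_⟩
  · exact mem_terms_of_mem_support h (by simpa [normalForm] using hX)
  · ext X
    rw [hx.eq_coord X]
    rfl

/-- The singular vectors of fixed type, level and charge lie in a linear space, on which reading off
the kernel coefficients is injective; so independence survives in a space of dimension the size of
the kernel. -/
theorem card_le_maxDim (hc : c ≠ 3) {k : ℕ} {Ψ : Fin k → Verma A Δ q c}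
    (hΨ : LinearIndependent ℂ Ψ) (h : ∀ i, Ψ i ∈ singularSpace A Δ q c N m n) :
    k ≤ maxDim A N n := by
  have hfin : (kernel A N m n).Finite :=
    Set.finite_of_encard_le_coe (encard_kernel_le A N m n)
  have := hfin.fintype
  let f : Verma A Δ q c →ₗ[ℂ] (kernel A N m n → ℂ) :=
    LinearMap.pi fun X => Finsupp.lapply (X.1.word A) ∘ₗ coord A Δ q c
  have hli : LinearIndependent ℂ (f ∘ Ψ) := by
    refine hΨ.map ?_
    rw [Submodule.disjoint_def]
    intro u hu hf
    by_contra hne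
    have hu' : u ∈ singularSpace A Δ q c N m n := by
      refine Submodule.span_le.2 ?_ hu
      rintro _ ⟨i, rfl⟩
      exact h i
    obtain ⟨X, hX, hX'⟩ := exists_kernel_coord_ne_zero hc hu' hne
    exact hX' (congrFun hf ⟨X, hX⟩)
  have h1 := hli.fintype_card_le_finrank
  rw [Fintype.card_fin, Module.finrank_fintype_fun_eq_card] at h1
  have h2 := encard_kernel_le A N m n
  rw [Set.encard_eq_coe_toFinset_card, Set.toFinset_card] at h2
  exact h1.trans (by exact_mod_cast h2)

/-- Since `{G_0, Q_0} = 2 L_0`, a chiral vector has `L_0`-eigenvalue 0. -/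
theorem eq_neg_of_chiral (h : Ψ ∈ singularSpace A Δ q c .GQ m n) (hne : Ψ ≠ 0) : Δ = -m := by
  have h1 := of_smul_of_smul (.G 0) (.Q 0) Ψ
  have hG : U.of (.G 0) • Ψ = 0 := h.2.2.2.1
  have hQ : U.of (.Q 0) • Ψ = 0 := h.2.2.2.2
  have hL : U.of (.L 0) • Ψ = (Δ + m) • Ψ := h.1
  have hb : bracket (.G 0) (.Q 0) = (2 : ℂ) • e (.L 0) := by simp [bracket]
  rw [hG, hQ, hb, lin_smul_single, hL, smul_zero, smul_zero, smul_zero, zero_add, smul_smul] at h1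
  have h2 := (smul_eq_zero.1 h1.symm).resolve_right hne
  exact eq_neg_of_add_eq_zero_left ((mul_eq_zero.1 h2).resolve_left two_ne_zero)

end TopN2

end

theorem mainTheorem5 (A : TopN2.Fermion) (N : TopN2.Closure) (Δ q c : ℂ) (hc : c ≠ 3)
    (m : ℕ) (n : ℤ) :
    -- at most `maxDim A N n` linearly independent singular vectors at level `m` and charge `n`
    (∀ (k : ℕ) (Ψ : Fin k → TopN2.Verma A Δ q c), LinearIndependent ℂ Ψ →
      (∀ i, TopN2.IsSingular N m n (Ψ i)) → k ≤ TopN2.maxDim A N n) ∧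
    -- a singular vector has a nonzero coefficient on a term of the ordering kernel
    (∀ Ψ : TopN2.Verma A Δ q c, TopN2.IsSingular N m n Ψ →
      (∃! x, TopN2.IsNormalForm m n x Ψ) ∧
      ∀ x, TopN2.IsNormalForm m n x Ψ → ∃ X ∈ TopN2.kernel A N m n, x X ≠ 0) ∧
    -- no singular vectors for the charges with maximal dimension `0`
    (TopN2.maxDim A N n = 0 → ∀ Ψ : TopN2.Verma A Δ q c, ¬ TopN2.IsSingular N m n Ψ) ∧
    -- chiral singular vectors have conformal weight `0`
    (N = TopN2.Closure.GQ → ∀ Ψ : TopN2.Verma A Δ q c, TopN2.IsSingular N m n Ψ → Δ = -m) := by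
  refine ⟨fun k Ψ hΨ h => TopN2.card_le_maxDim hc hΨ fun i => (h i).mem_singularSpace,
    fun Ψ h => ⟨TopN2.existsUnique_isNormalForm h.mem_singularSpace, fun x hx => ?_⟩,
    fun h0 Ψ h => ?_, ?_⟩
  · obtain ⟨X, hX, hX'⟩ := TopN2.exists_kernel_coord_ne_zero hc h.mem_singularSpace h.ne_zero
    exact ⟨X, hX, by rwa [hx.eq_coord]⟩
  -- A singular vector is nonzero, hence an independent family of size one, which a bound of 0
  -- forbids.
  · have := TopN2.card_le_maxDim hc (Ψ := fun _ : Fin 1 => Ψ)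
      ((linearIndependent_subsingleton_index_iff _).2 fun _ => h.ne_zero)
      fun _ => h.mem_singularSpace
    omega
  · rintro rfl Ψ h
    exact TopN2.eq_neg_of_chiral h.mem_singularSpace h.ne_zero
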